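/- **Conventions.** Graphs are finite and loopless; several edges may join the same two vertices. An edge is *multiple* if another edge has the same ends; a *bundle* is the set of all edges between two vertices, if there are at least two of them. Consider the following six families of graphs with $n$ vertices $u_0,\dots,u_{n-1}$ and $m\ge 2$ multiple edges, all of which join $u_0$ and $u_1$ and form the unique bundle $B$: - $\tilde P_{n,m}$ ($n\ge 2$): the other edges form the path $u_1u_2\cdots u_{n-1}$; - $\tilde S_{n,m}$ ($n\ge 5$ odd): the other edges form the path $u_1u_2\cdots u_{n-3}$ together with $u_{n-3}u_{n-2}$ and $u_{n-3}u_{n-1}$; - $\tilde T_{n,m}$ ($n\ge 5$ odd): $\tilde S_{n,m}$ with the further edge $u_{n-2}u_{n-1}$; - $\tilde P'_{n,m}$ ($n\ge 3$), $\tilde S'_{n,m}$, $\tilde T'_{n,m}$ ($n\ge5$ odd): $\tilde P_{n,m},\tilde S_{n,m},\tilde T_{n,m}$ with the further edge $u_0u_2$. Let $G$ be one of these graphs, with vertex set $V$. A set $A\subseteq V\cup B$ is *admissible* if $|A\cap V|$ is even, every vertex incident to no multiple edge is in $A$, and $A\cap B$ is nonempty of even size. A subgraph $I$ of $G$ is *semi-induced*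 if any two vertices of $I$ adjacent in $G$ are adjacent in $I$; it is identified with the set of its vertices and of its edges in $B$. It is *$A$-even* if $|I'\cap A|$ is even for each connected component $I'$ of $I$. Let $\mathcal P^{\rm even}_{G,A}$ be the set of $A$-even semi-induced subgraphs of $G$, ordered by containment. **Labeling.** Name the vertices $1,2,\dots,n$ so that $\{1,2\}=\{u_0,u_1\}$ and $i=u_{i-1}$ for $i\ge 3$ (for some numbering $u_0,\dots,u_{n-1}$ as above), with $1\notin A$ if $n$ is odd, and $1$ adjacent to $3$ if $n\ge 4$ is even. Let $A\cap B=\{a_1,\dots,a_p\}$ and $B\setminus A=\{b_1,\dots,b_q\}$, in any order. For $I\in\mathcal P^{\rm even}_{G,A}$ let $<_I$ be the linear order on $V\cup B$ given by - $1,2,\dots,n,a_1,\dots,a_p,b_1,\dots,b_q$ if $I\cap B=\emptyset$; - $1,2,a_1,\dots,a_k,3,\dots,n,a_{k+1},\dots,a_p,b_1,\dots,b_q$ if $\emptyset\ne I\cap B\subseteq A$, where $k=\max\{i: a_i\in I\}$; - $1,2,a_1,\dots,a_p,b_1,\dots,b_k,3,\dots,n,b_{k+1},\dots,b_q$ if $I\cap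 (B\setminus A)\neq\emptyset$, where $k=\max\{i:b_i\in I\}$. For two atoms $J,J'$ of the interval $[I,G]$ put $X=J\setminus I$ and $X'=J'\setminus I$. Say that $X$ *has priority* over $X'$ if either $|X\cap\{1,2\}|=1$ and $|X'\cap\{1,2\}|=2$, or $|X\cap\{1,2\}|=|X'\cap\{1,2\}|=1$, $X\cap (B\setminus A)=\emptyset$ and $X'\cap (B\setminus A)\ne\emptyset$. Let $J\prec_I J'$ if $X$ has priority over $X'$, or if $X'$ does not have priority over $X$ and $X$ (written in increasing order with respect to $<_I$) precedes $X'$ lexicographically. **Shellability.** A bounded poset $\mathcal P$ *admits a recursive atom ordering* if it has length $1$, or it has length greater than $1$ and its atoms can be ordered $\alpha_1,\dots,\alpha_t$ such that (1) each $[\alpha_j,\hat 1]$ admits a recursive atom ordering in which the atoms of $[\alpha_j,\hat1]$ that belong to $[\alpha_i,\hat 1]$ for some $i<j$ come first; (2) if $i<j$ and $\alpha_i,\alpha_j<y$, then there are $k<j$ and an atom $z$ of $[\alpha_j,\hat1]$ with $\alpha_k<z\le y$. A family of total orders, one on the atoms of each $[x,\hat 1]$, *forms* a recursive atom ordering if conditions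 (1) and (2) hold for every $[x,\hat 1]$ with the given orders. $\mathcal P$ is *CL-shellable* if there is a labeling of the pairs ($\sigma$, cover along $\sigma$), $\sigma$ a maximal chain of $\mathcal P$, by elements of some poset, such that the labels of two maximal chains agree along their bottom $d$ covers whenever the chains do, and, for all $x\le y$ and every maximal chain $r$ of $[\hat 0,x]$, the interval $[x,y]$ rooted at $r$ has a unique maximal chain with strictly increasing labels, and its label sequence lexicographically precedes those of all other maximal chains. **Theorem.** Let $G$ be a graph of one of the six families and $A$ an admissible collection of $G$. Then $\mathcal P^{\rm even}_{G,A}$ is bounded; a labeling as above exists, and for every such labeling the orderings $\prec_I$ ($I\in\mathcal P^{\rm even}_{G,A}$) form a recursive atom ordering. In particular $\mathcal P^{\rm even}_{G,A}$ admits a recursive atom ordering, and hence it is CL-shellable. -/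

import Mathlib

/-! ### Finite bounded posets: recursive atom orderings and CL-shellability -/

namespace PosetShelling

section RecursiveAtomOrdering

variable {P : Type*} [PartialOrder P] [BoundedOrder P]

/-- `r` totally (and strictly) orders the atoms of the interval `[x, ⊤]`,
i.e. the elements covering `x`. -/
def OrdersAtoms (x : P) (r : P → P → Prop) : Prop :=
  IsStrictTotalOrder {y : P // x ⋖ y} (fun y z => r y.1 z.1)

/-- `z` belongs to `[a, ⊤]` for some atom `a` of `[x, ⊤]` that precedes the atom `b`. -/
def AboveEarlierAtom (x : P) (r : P → P → Prop) (b z : P) : Prop :=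
  ∃ a, x ⋖ a ∧ r a b ∧ a ≤ z

/-- In the ordering `s` of the atoms of `[b, ⊤]`, those that belong to `[a, ⊤]` for some
atom `a` of `[x, ⊤]` preceding `b` come first. -/
def EarlierComeFirst (x : P) (r : P → P → Prop) (b : P) (s : P → P → Prop) : Prop :=
  ∀ z z', b ⋖ z → b ⋖ z' → AboveEarlierAtom x r b z → ¬ AboveEarlierAtom x r b z' → s z z'

/-- If the atoms `a`, `b` of `[x, ⊤]`, with `a` before `b`, lie below `y`, then some atom `z` of
`[b, ⊤]` with `z ≤ y` lies above an atom `c` of `[x, ⊤]` that precedes `b`. -/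
def ExchangeCondition (x : P) (r : P → P → Prop) : Prop :=
  ∀ a b y, x ⋖ a → x ⋖ b → r a b → a < y → b < y →
    ∃ c z, x ⋖ c ∧ r c b ∧ b ⋖ z ∧ c < z ∧ z ≤ y

/-- `IsRecursiveAtomOrdering x r`: `r` is a recursive atom ordering of the interval `[x, ⊤]`.
The relation `s b` is the recursive atom ordering chosen for the interval `[b, ⊤]`. -/
inductive IsRecursiveAtomOrdering : P → (P → P → Prop) → Prop
  | length_one (x : P) (r : P → P → Prop) (hx : x ⋖ ⊤) : IsRecursiveAtomOrdering x r
  | step (x : P) (r : P → P → Prop) (s : P → P → P → Prop)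
      (hlt : x < ⊤) (hx : ¬ x ⋖ ⊤)
      (horder : OrdersAtoms x r)
      (hrec : ∀ b, x ⋖ b → IsRecursiveAtomOrdering b (s b))
      (hfirst : ∀ b, x ⋖ b → EarlierComeFirst x r b (s b))
      (hexch : ExchangeCondition x r) : IsRecursiveAtomOrdering x r

variable (P) in
/-- The bounded poset `P` admits a recursive atom ordering. -/
def AdmitsRecursiveAtomOrdering : Prop :=
  ∃ r : P → P → Prop, IsRecursiveAtomOrdering (⊥ : P) r

/-- A family `r`, in which `r x` orders the atoms of `[x, ⊤]` for every `x`, forms a recursive atom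
ordering: the defining conditions hold at every `x` when `r b` is the ordering used for the
interval `[b, ⊤]` above an atom `b` of `[x, ⊤]`. -/
structure FormsRecursiveAtomOrdering (r : P → P → P → Prop) : Prop where
  ordersAtoms : ∀ x, OrdersAtoms x (r x)
  earlierComeFirst : ∀ x b, x ⋖ b → EarlierComeFirst x (r x) b (r b)
  exchange : ∀ x, ExchangeCondition x (r x)

end RecursiveAtomOrdering

section CLShellable

variable {P : Type*} [PartialOrder P]

/-- `c` lists, from bottom to top, a maximal chain `x = c₀ ⋖ c₁ ⋖ ⋯ ⋖ c_k = y` of `[x, y]`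
(in a finite poset). -/
def IsMaximalChain (x y : P) (c : List P) : Prop :=
  c.IsChain (· ⋖ ·) ∧ c.head? = some x ∧ c.getLast? = some y

variable [BoundedOrder P] {L : Type*}

/-- A chain-edge labeling. For a maximal chain `σ : σ₀ ⋖ σ₁ ⋖ ⋯` of `P`, the value `ρ σ i` is the
label of the pair `(σ, σ_i ⋖ σ_{i+1})`; values at other arguments are irrelevant. If two maximal
chains coincide along their bottom `d` covers, so do their labels. -/
def IsChainEdgeLabeling (ρ : List P → ℕ → L) : Prop :=
  ∀ σ τ : List P, IsMaximalChain ⊥ ⊤ σ → IsMaximalChain ⊥ ⊤ τ →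
    ∀ d : ℕ, σ.take (d + 1) = τ.take (d + 1) → ∀ i < d, ρ σ i = ρ τ i

/-- For maximal chains `r` of `[⊥, x]`, `c` of `[x, y]` and `t` of `[y, ⊤]`, the labels of the
covers of `c` along the maximal chain of `P` composed of `r`, `c` and `t`. For a chain-edge labeling
they do not depend on `t`: they are the labels of `c` in the rooted interval `[x, y]_r`. -/
def rootedLabels (ρ : List P → ℕ → L) (r c t : List P) : List L :=
  (List.range (c.length - 1)).map fun i => ρ (r ++ c.tail ++ t.tail) (r.length - 1 + i)

/-- A CL-labeling: a chain-edge labeling such that each closed rooted interval `[x, y]_r` has a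
unique strictly increasing maximal chain, which lexicographically precedes all the others. -/
def IsCLLabeling [PartialOrder L] (ρ : List P → ℕ → L) : Prop :=
  IsChainEdgeLabeling ρ ∧
    ∀ x y : P, x ≤ y → ∀ r t : List P, IsMaximalChain ⊥ x r → IsMaximalChain y ⊤ t →
      ∃ c, IsMaximalChain x y c ∧ (rootedLabels ρ r c t).Pairwise (· < ·) ∧
        ∀ c', IsMaximalChain x y c' → c' ≠ c →
          ¬ (rootedLabels ρ r c' t).Pairwise (· < ·) ∧
            List.Lex (· < ·) (rootedLabels ρ r c t) (rootedLabels ρ r c' t)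

variable (P) in
/-- The bounded poset `P` is CL-shellable. -/
def CLShellable : Prop :=
  ∃ (L : Type) (_ : PartialOrder L) (ρ : List P → ℕ → L), IsCLLabeling ρ

end CLShellable

end PosetShelling

/-! ### Multigraphs, admissible collections and the poset of even subgraphs -/

namespace Graph

variable {α β : Type*}

/-- An edge is multiple if another edge has the same ends. -/
def IsMultiple (G : Graph α β) (e : β) : Prop :=
  ∃ f x y, f ≠ e ∧ G.IsLink e x y ∧ G.IsLink f x y

/-- A bundle: all the edges between two vertices, if there are at least two of them. -/
def IsBundle (G : Graph α β) (B : Set β) : Prop :=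
  B.Nontrivial ∧ ∃ x y, B = {e | G.IsLink e x y}

/-- The set expression of a subgraph `I` of `G`: the vertices of `I` and the edges of `I` that are
multiple edges of `G`. For `I = G` it is the set of all vertices and multiple edges of `G`. -/
def code (G I : Graph α β) : Set (α ⊕ β) :=
  Sum.inl '' I.vertexSet ∪ Sum.inr '' {e | e ∈ I.edgeSet ∧ G.IsMultiple e}

/-- `I` is a semi-induced subgraph of `G`. -/
def IsSemiInduced (I G : Graph α β) : Prop :=
  I ≤ G ∧ ∀ x ∈ I.vertexSet, ∀ y ∈ I.vertexSet, G.Adj x y → I.Adj x y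

/-- A nonempty graph in which any two vertices are joined by a walk. -/
def IsConnected (G : Graph α β) : Prop :=
  G.vertexSet.Nonempty ∧
    ∀ x ∈ G.vertexSet, ∀ y ∈ G.vertexSet, Relation.ReflTransGen G.Adj x y

/-- `H` is a connected component of `I`. -/
def IsComponent (H I : Graph α β) : Prop :=
  H.IsClosedSubgraph I ∧ H.IsConnected

/-- `A` is an admissible collection of the connected finite graph `G`. -/
structure IsAdmissible (G : Graph α β) (A : Set (α ⊕ β)) : Prop where
  subset : A ⊆ G.code G
  even_vertices : Even {v | v ∈ G.vertexSet ∧ Sum.inl v ∈ A}.ncard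
  simple_mem : ∀ v ∈ G.vertexSet, (∀ e, G.Inc e v → ¬ G.IsMultiple e) → Sum.inl v ∈ A
  bundle_nonempty : ∀ B, G.IsBundle B → {e | e ∈ B ∧ Sum.inr e ∈ A}.Nonempty
  bundle_even : ∀ B, G.IsBundle B → Even {e | e ∈ B ∧ Sum.inr e ∈ A}.ncard

/-- The subgraph `I` of `G` is `A`-even: every component of `I` has an even number of elements
in `A`. -/
def IsEvenSubgraph (G : Graph α β) (A : Set (α ⊕ β)) (I : Graph α β) : Prop :=
  ∀ H, H.IsComponent I → Even (G.code H ∩ A).ncard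

/-- The poset of all `A`-even semi-induced subgraphs of `G`, ordered by subgraph containment. -/
abbrev EvenPoset (G : Graph α β) (A : Set (α ⊕ β)) : Type _ :=
  {I : Graph α β // I.IsSemiInduced G ∧ G.IsEvenSubgraph A I}

/-! ### The six families of graphs -/

/-- Names of the families `P̃`, `S̃`, `T̃`, `P̃'`, `S̃'`, `T̃'`. -/
inductive Family
  | P | S | T | P' | S' | T'

/-- The number `n` of vertices allowed in each family. -/
def Family.Allows : Family → ℕ → Prop
  | .P, n => 2 ≤ n
  | .P', n => 3 ≤ n
  | .S, n | .T, n | .S', n | .T', n => 5 ≤ n ∧ Odd n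

/-- The simple edges `{i, j}`, `i < j`, for vertices numbered `0, …, n - 1`; the ends of the bundle
are `0` and `1`.
`P̃`: the path `1, 2, …, n - 1`.
`S̃`: the path `1, 2, …, n - 3` with two further vertices `n - 2`, `n - 1` attached to `n - 3`.
`T̃`: as `S̃`, with `n - 2` and `n - 1` also adjacent.
The primed families have the further edge `{0, 2}`. -/
def Family.SimpleEdge : Family → ℕ → ℕ → ℕ → Prop
  | .P, _, i, j => 1 ≤ i ∧ j = i + 1
  | .S, n, i, j => (1 ≤ i ∧ j = i + 1 ∧ j + 2 ≤ n) ∨ (i + 3 = n ∧ j + 1 = n)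
  | .T, n, i, j => (1 ≤ i ∧ j = i + 1) ∨ (i + 3 = n ∧ j + 1 = n)
  | .P', _, i, j => (1 ≤ i ∧ j = i + 1) ∨ (i = 0 ∧ j = 2)
  | .S', n, i, j =>
      (1 ≤ i ∧ j = i + 1 ∧ j + 2 ≤ n) ∨ (i + 3 = n ∧ j + 1 = n) ∨ (i = 0 ∧ j = 2)
  | .T', n, i, j => (1 ≤ i ∧ j = i + 1) ∨ (i + 3 = n ∧ j + 1 = n) ∨ (i = 0 ∧ j = 2)

open scoped Classical in
/-- The number of edges between the vertices `i` and `j` of the member of the family with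
`n` vertices and `m` multiple edges. -/
noncomputable def Family.multiplicity (F : Family) (n m i j : ℕ) : ℕ :=
  if (i = 0 ∧ j = 1) ∨ (i = 1 ∧ j = 0) then m
  else if F.SimpleEdge n i j ∨ F.SimpleEdge n j i then 1
  else 0

/-- `G` is the member of the family `F` with `m ≥ 2` multiple edges, its vertices being
`vs[0], vs[1], …` in the numbering used for `F`. -/
structure IsFamilyMember (G : Graph α β) (F : Family) (m : ℕ) (vs : List α) : Prop where
  allows : F.Allows vs.length
  two_le : 2 ≤ m
  nodup : vs.Nodup
  mem_iff : ∀ x, x ∈ vs ↔ x ∈ G.vertexSet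
  encard_eq : ∀ (i j : ℕ) (hi : i < vs.length) (hj : j < vs.length),
    {e | G.IsLink e vs[i] vs[j]}.encard = F.multiplicity vs.length m i j

/-- `G` belongs to one of the six families. -/
def IsListed (G : Graph α β) : Prop :=
  ∃ F m vs, G.IsFamilyMember F m vs

/-! ### The orderings of the atoms -/

/-- A labeling of the vertices and multiple edges of a graph `G` of one of the six families with
admissible collection `A`: the vertices `1, 2, 3, …, n` are `one`, `two` and the entries of `rest`,
the ends of the bundle being `one` and `two`; `as = [a₁, a₂, …]` lists the multiple edges
in `A`, and `bs = [b₁, b₂, …]` those not in `A`. -/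
structure Labeling (G : Graph α β) (A : Set (α ⊕ β)) where
  one : α
  two : α
  rest : List α
  as : List β
  bs : List β
  member : ∃ F m, G.IsFamilyMember F m (one :: two :: rest) ∨
    G.IsFamilyMember F m (two :: one :: rest)
  odd : Odd (rest.length + 2) → Sum.inl one ∉ A
  even : Even (rest.length + 2) → ∀ three ∈ rest.head?, G.Adj one three
  as_nodup : as.Nodup
  mem_as : ∀ e, e ∈ as ↔ G.IsMultiple e ∧ Sum.inr e ∈ A
  bs_nodup : bs.Nodup
  mem_bs : ∀ e, e ∈ bs ↔ G.IsMultiple e ∧ Sum.inr e ∉ A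

namespace Labeling

variable {G : Graph α β} {A : Set (α ⊕ β)}

open scoped Classical in
/-- The initial segment of `es` up to its last entry that is an edge of `I`. -/
noncomputable def upToLast (I : Graph α β) (es : List β) : List β :=
  es.rdropWhile fun e => decide (e ∉ I.edgeSet)

open scoped Classical in
/-- The entries of `es` after the last one that is an edge of `I`. -/
noncomputable def afterLast (I : Graph α β) (es : List β) : List β :=
  es.rtakeWhile fun e => decide (e ∉ I.edgeSet)

open scoped Classical in
/-- The vertices and multiple edges of `G`, listed in the linear order attached to `I`:
`1, 2, 3, …, n, a₁, …, b₁, …` if `I` has no multiple edge;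
`1, 2, a₁, …, a_k, 3, …, n, a_{k+1}, …, b₁, …` if `I` has some `a_i` but no `b_i`, with `a_k` the
last one in `I`;
`1, 2, a₁, …, b₁, …, b_k, 3, …, n, b_{k+1}, …` if `I` has some `b_i`, with `b_k` the last one
in `I`. -/
noncomputable def letters (ℓ : Labeling G A) (I : Graph α β) : List (α ⊕ β) :=
  if ∃ e ∈ ℓ.bs, e ∈ I.edgeSet then
    [Sum.inl ℓ.one, Sum.inl ℓ.two] ++ ℓ.as.map Sum.inr ++ (upToLast I ℓ.bs).map Sum.inr ++
      ℓ.rest.map Sum.inl ++ (afterLast I ℓ.bs).map Sum.inr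
  else if ∃ e ∈ ℓ.as, e ∈ I.edgeSet then
    [Sum.inl ℓ.one, Sum.inl ℓ.two] ++ (upToLast I ℓ.as).map Sum.inr ++
      ℓ.rest.map Sum.inl ++ (afterLast I ℓ.as).map Sum.inr ++ ℓ.bs.map Sum.inr
  else
    [Sum.inl ℓ.one, Sum.inl ℓ.two] ++ ℓ.rest.map Sum.inl ++ ℓ.as.map Sum.inr ++ ℓ.bs.map Sum.inr

/-- `x` comes before `y` in the linear order attached to `I`. -/
def LetterLT (ℓ : Labeling G A) (I : Graph α β) (x y : α ⊕ β) : Prop :=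
  [x, y].Sublist (ℓ.letters I)

/-- The lexicographic comparison of two sets `X`, `Y` of letters, neither containing the other, each
written in increasing order: the first letter where they differ belongs to `X`. -/
def LexLT (ℓ : Labeling G A) (I : Graph α β) (X Y : Set (α ⊕ β)) : Prop :=
  ∃ x ∈ X, x ∉ Y ∧ ∀ z, ℓ.LetterLT I z x → (z ∈ X ↔ z ∈ Y)

/-- The number of ends of the bundle in `X`. -/
noncomputable def endCount (ℓ : Labeling G A) (X : Set (α ⊕ β)) : ℕ :=
  (X ∩ {Sum.inl ℓ.one, Sum.inl ℓ.two}).ncard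

/-- `X` contains a multiple edge that is not in `A`. -/
def HasB (ℓ : Labeling G A) (X : Set (α ⊕ β)) : Prop :=
  ∃ e ∈ ℓ.bs, Sum.inr e ∈ X

/-- The rule that takes precedence over the lexicographic comparison: `X` contains exactly one end
of the bundle, and either `Y` contains both ends, or `Y` contains exactly one end and a multiple
edge outside `A` while `X` contains no multiple edge outside `A`. -/
def Priority (ℓ : Labeling G A) (X Y : Set (α ⊕ β)) : Prop :=
  ℓ.endCount X = 1 ∧ (ℓ.endCount Y = 2 ∨ (ℓ.endCount Y = 1 ∧ ¬ ℓ.HasB X ∧ ℓ.HasB Y))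

/-- The comparison `J ≺_I J'` of two atoms `J`, `J'` of `[I, G]`, through the differences
`J \ I` and `J' \ I`. -/
def AtomLT (ℓ : Labeling G A) (I J J' : G.EvenPoset A) : Prop :=
  let X := G.code J.1 \ G.code I.1
  let Y := G.code J'.1 \ G.code I.1
  ℓ.Priority X Y ∨ (¬ ℓ.Priority Y X ∧ ℓ.LexLT I.1 X Y)

end Labeling

end Graph

/-! ### Even sets in a graph with a single bundle -/

/-! A semi-induced subgraph is determined by its vertices and its multiple edges, and containment
becomes inclusion of these sets of letters. Regard a multiple edge in `A` as an extra vertex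
adjacent to both ends of the bundle, and one outside `A` as an isolated extra vertex. Then a
subgraph is even exactly if every union of components of its set of letters meets `A` in an even
number of letters. `EvenModel` keeps only what the argument needs of the graph: the vertices other
than the ends lie in `A`, and, by `jump`, an edge that passes over a vertex `p` of `W` occurs only
at the far end of the path, starts at a neighbour of `p`, and forces the vertex 1 to lie outside
`A`.

Covers. The parity lemma `exists_linked` says that a letter of `A` missing from an even set `I` but
present in a larger even set `Y` is linked, over `I`, to a second missing letter of `Y`. Therefore
every element above `I` contains `I ∪ X` for some `X` of one of the ten kinds of `Atom`
(`exists_atom`). No such `X` contains another (`Atom.eq_of_subset`), so these are precisely the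
differences between `I` and its covers.

Atoms above earlier atoms come first (`earlier_of_prec`). Let `X` be an atom over `I`, let `J = I ∪
X`, and let `Z'` precede `Z` in the order attached to `J`. If `X ∪ Z` contains an atom over `I`
before `X`, so should `X ∪ Z'`. Within one class, the earlier atom brings in a letter `y` of `Z`
that comes before a letter of `X` it gives up, and `Z'` contains a letter `p` not after `y` in the
order of `J`. The aim is to exchange `p` as well. If `p` and `y` are vertices, a walk to `y` jumps
over `p` and starts its jump at a neighbour of `p`, so `p` is linked wherever `y` is
(`Linked.of_lt`). If `p` is an edge in `A`, it is linked to the ends anyway. Passing from `I` to `J`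
changes the order only by moving edges ahead of the vertices (`key_switch`), namely those up to the
last multiple edge present, and these are the edges that can be exchanged for an edge of `X`. What
remains is a walk past a missing vertex while a second one is missing too, which cannot occur
(`Linked.not_two_missing`). The priority rule settles the atoms that contain ends of the bundle.

The exchange condition (`exchange`) again follows from parity: a letter of the earlier atom that is
missing from `J` is completed inside `Y` to an atom over `J`, if necessary after replacing the
earlier atom by one that differs from `X` in fewer letters.

CL-shellability. Along a maximal chain integer labels are assigned such that a step goes down if it
leads above an earlier atom and up otherwise, and such that labels grow with the place of the atom.
The increasing chain of an interval is the one that always takes the first available atom, and every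
other chain has a descent by the exchange condition (`not_pairwise_labelsFrom`). -/

/-- A combinatorial model of a graph of one of the six families with an admissible collection `A`.
The letters are the ends `one`, `two` of the bundle, the other vertices `W`, and the multiple edges
`EA` in `A` and `EB` outside `A`. Two letters are adjacent if they are adjacent vertices, or an
end of the bundle and an edge in `EA`. The function `rk` numbers the letters. -/
structure EvenModel (ω : Type*) where
  one : ω
  two : ω
  W : Set ω
  EA : Set ω
  EB : Set ω
  A : Set ω
  adj : ω → ω → Prop
  rk : ω → ℕ
  adj_symm : ∀ {x y}, adj x y → adj y x
  adj_one_two : adj one two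
  adj_EA_one : ∀ {e}, e ∈ EA → adj e one
  adj_EA_two : ∀ {e}, e ∈ EA → adj e two
  adj_EA : ∀ {e x}, e ∈ EA → adj e x → x = one ∨ x = two
  adj_EB : ∀ {e x}, e ∈ EB → ¬ adj e x
  W_A : ∀ {x}, x ∈ W → x ∈ A
  EA_A : ∀ {x}, x ∈ EA → x ∈ A
  EB_A : ∀ {x}, x ∈ EB → x ∉ A
  rk_one_two : rk one < rk two
  rk_two_W : ∀ {x}, x ∈ W → rk two < rk x
  rk_two_EA : ∀ {x}, x ∈ EA → rk two < rk x
  rk_two_EB : ∀ {x}, x ∈ EB → rk two < rk x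
  rk_W_EA : ∀ {x y}, x ∈ W → y ∈ EA → rk x < rk y
  rk_W_EB : ∀ {x y}, x ∈ W → y ∈ EB → rk x < rk y
  rk_EA_EB : ∀ {x y}, x ∈ EA → y ∈ EB → rk x < rk y
  rk_inj : Set.InjOn rk ({one, two} ∪ W ∪ EA ∪ EB)
  finite_letters : ({one, two} ∪ W ∪ EA ∪ EB).Finite
  -- The vertex 1 can be in `A` only if the number of vertices is even, and then parity puts either
  -- both ends into `A` or none.
  two_mem_A : one ∈ A → two ∈ A
  -- In the families the only such edge joins the third vertex from the end to the last one, and `p`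
  -- lies between them. It occurs only for an odd number of vertices, when the vertex 1 is not in
  -- `A`.
  jump : ∀ {y y' p}, adj y y' → p ∈ W → y ∈ ({one, two} ∪ W : Set ω) →
    y' ∈ ({one, two} ∪ W : Set ω) → rk y < rk p → rk p < rk y' →
    one ∉ A ∧ adj y p ∧ ∀ u ∈ W, u ≠ p → u ≠ y' → rk u ≤ rk y
  -- This reflects the requirement that the vertex 1 be adjacent to 3 when the number of vertices is
  -- even.
  adj_one_of_adj_two : ∀ {y}, one ∈ A → y ∈ W → adj two y → adj one y

namespace EvenModel

variable {ω : Type*} (M : EvenModel ω)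

/-- All letters. -/
def U : Set ω := {M.one, M.two} ∪ M.W ∪ M.EA ∪ M.EB

/-- `T` is a union of components of `S`. -/
def ClosedIn (T S : Set ω) : Prop := T ⊆ S ∧ ∀ x ∈ T, ∀ y ∈ S, M.adj x y → y ∈ T

/-- Every component of `S` has an even number of letters in `A`. -/
def EvenSet (S : Set ω) : Prop := ∀ T, M.ClosedIn T S → Even (T ∩ M.A).ncard

/-- `S` is the set expression of an even semi-induced subgraph. -/
structure Mem (S : Set ω) : Prop where
  subset : S ⊆ M.U
  ends : ∀ e ∈ S, e ∈ M.EA ∪ M.EB → M.one ∈ S ∧ M.two ∈ S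
  edge : M.one ∈ S → M.two ∈ S → ∃ e ∈ S, e ∈ M.EA ∪ M.EB
  even : M.EvenSet S

/-- `x` and `y` lie in the same component of `S`. -/
def Linked (S : Set ω) (x y : ω) : Prop := x ∈ S ∧ y ∈ S ∧ ∀ T, M.ClosedIn T S → x ∈ T → y ∈ T

/-- `w` and `w'` are the two ends of the bundle. -/
def Ends (w w' : ω) : Prop := (w = M.one ∧ w' = M.two) ∨ (w = M.two ∧ w' = M.one)

variable {M}

/-! ### The kinds of letters -/

section kinds

theorem mem_U {x : ω} :
    x ∈ M.U ↔ x = M.one ∨ x = M.two ∨ x ∈ M.W ∨ x ∈ M.EA ∨ x ∈ M.EB := by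
  simp [U, or_assoc]

theorem one_ne_two : M.one ≠ M.two := fun h => absurd M.rk_one_two (by rw [h]; exact lt_irrefl _)

theorem rk_injOn {x y : ω} (hx : x ∈ M.U) (hy : y ∈ M.U) (h : M.rk x = M.rk y) : x = y :=
  M.rk_inj hx hy h

theorem one_notMem_W : M.one ∉ M.W := fun h => absurd (M.rk_two_W h) M.rk_one_two.not_gt
theorem two_notMem_W : M.two ∉ M.W := fun h => absurd (M.rk_two_W h) (lt_irrefl _)
theorem one_notMem_EA : M.one ∉ M.EA := fun h => absurd (M.rk_two_EA h) M.rk_one_two.not_gt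
theorem two_notMem_EA : M.two ∉ M.EA := fun h => absurd (M.rk_two_EA h) (lt_irrefl _)
theorem one_notMem_EB : M.one ∉ M.EB := fun h => absurd (M.rk_two_EB h) M.rk_one_two.not_gt
theorem two_notMem_EB : M.two ∉ M.EB := fun h => absurd (M.rk_two_EB h) (lt_irrefl _)

theorem W_EA {x : ω} (h : x ∈ M.W) : x ∉ M.EA := fun h' => absurd (M.rk_W_EA h h') (lt_irrefl _)
theorem W_EB {x : ω} (h : x ∈ M.W) : x ∉ M.EB := fun h' => absurd (M.rk_W_EB h h') (lt_irrefl _)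
theorem EA_EB {x : ω} (h : x ∈ M.EA) : x ∉ M.EB :=
  fun h' => absurd (M.rk_EA_EB h h') (lt_irrefl _)

theorem Ends.symm {w w' : ω} (h : M.Ends w w') : M.Ends w' w := by
  unfold Ends at *; tauto

theorem Ends.ne {w w' : ω} (h : M.Ends w w') : w ≠ w' := by
  rcases h with ⟨rfl, rfl⟩ | ⟨rfl, rfl⟩
  exacts [one_ne_two, one_ne_two.symm]

theorem Ends.adj_EA {w w' e : ω} (h : M.Ends w w') (he : e ∈ M.EA) : M.adj w e := by
  rcases h with ⟨rfl, rfl⟩ | ⟨rfl, rfl⟩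
  exacts [M.adj_symm (M.adj_EA_one he), M.adj_symm (M.adj_EA_two he)]

theorem Ends.notMem_W {w w' : ω} (h : M.Ends w w') : w ∉ M.W := by
  rcases h with ⟨rfl, rfl⟩ | ⟨rfl, rfl⟩
  exacts [one_notMem_W, two_notMem_W]

theorem Ends.notMem_EA {w w' : ω} (h : M.Ends w w') : w ∉ M.EA := by
  rcases h with ⟨rfl, rfl⟩ | ⟨rfl, rfl⟩
  exacts [one_notMem_EA, two_notMem_EA]

theorem Ends.notMem_EB {w w' : ω} (h : M.Ends w w') : w ∉ M.EB := by
  rcases h with ⟨rfl, rfl⟩ | ⟨rfl, rfl⟩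
  exacts [one_notMem_EB, two_notMem_EB]

theorem Ends.mem_U {w w' : ω} (h : M.Ends w w') : w ∈ M.U := by
  rcases h with ⟨rfl, rfl⟩ | ⟨rfl, rfl⟩ <;> simp [U]

theorem Ends.rk_lt {w w' x : ω} (h : M.Ends w w') (hx : x ∈ M.W) : M.rk w < M.rk x := by
  have := M.rk_two_W hx
  have := M.rk_one_two
  rcases h with ⟨rfl, rfl⟩ | ⟨rfl, rfl⟩ <;> omega

theorem Ends.eq_or_eq {w w' x : ω} (h : M.Ends w w') (hx : x = M.one ∨ x = M.two) :
    x = w ∨ x = w' := by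
  rcases h with ⟨rfl, rfl⟩ | ⟨rfl, rfl⟩ <;> tauto

theorem Ends.iff {w w' : ω} (h : M.Ends w w') {S : Set ω} :
    (M.one ∈ S ∧ M.two ∈ S) ↔ (w ∈ S ∧ w' ∈ S) := by
  rcases h with ⟨rfl, rfl⟩ | ⟨rfl, rfl⟩ <;> tauto

end kinds

/-! ### Unions of components and linkage -/

section linked

theorem ClosedIn.inter {T S S' : Set ω} (h : M.ClosedIn T S') (hS : S ⊆ S') :
    M.ClosedIn (T ∩ S) S :=
  ⟨Set.inter_subset_right, fun x hx y hy hxy => ⟨h.2 x hx.1 y (hS hy) hxy, hy⟩⟩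

theorem ClosedIn.compl {T S : Set ω} (h : M.ClosedIn T S) : M.ClosedIn (S \ T) S :=
  ⟨Set.sdiff_subset, fun x hx y hy hxy => ⟨hy, fun hyT => hx.2 (h.2 y hyT x hx.1 (M.adj_symm hxy))⟩⟩

namespace Linked

variable {S S' : Set ω} {x y z : ω}

theorem refl (hx : x ∈ S) : M.Linked S x x := ⟨hx, hx, fun _ _ h => h⟩

/-- The complement of a union of components is again one, so no union of components separates `y`
from `x`. -/
theorem symm (h : M.Linked S x y) : M.Linked S y x :=
  ⟨h.2.1, h.1, fun _ hT hy => by_contra fun hx => (h.2.2 _ hT.compl ⟨h.1, hx⟩).2 hy⟩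

theorem trans (h : M.Linked S x y) (h' : M.Linked S y z) : M.Linked S x z :=
  ⟨h.1, h'.2.1, fun T hT hx => h'.2.2 T hT (h.2.2 T hT hx)⟩

theorem mono (h : M.Linked S x y) (hS : S ⊆ S') : M.Linked S' x y :=
  ⟨hS h.1, hS h.2.1, fun _ hT hx => (h.2.2 _ (hT.inter hS) ⟨hx, h.1⟩).1⟩

theorem of_adj (h : M.adj x y) (hx : x ∈ S) (hy : y ∈ S) : M.Linked S x y :=
  ⟨hx, hy, fun _ hT hxT => hT.2 x hxT y hy h⟩

end Linked

theorem closedIn_setOf_linked {S : Set ω} (x : ω) : M.ClosedIn {y | M.Linked S x y} S :=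
  ⟨fun _ hy => hy.2.1, fun _ hy _ hz hyz => hy.trans (.of_adj hyz hy.2.1 hz)⟩

/-- Multiple edges are not needed to link vertices. -/
theorem Linked.drop_edges {S S' : Set ω} {x y : ω} (h : M.Linked S x y)
    (hS : ∀ z ∈ S, z ∉ S' → z ∈ M.EA ∪ M.EB) (hx : x ∈ S') (hy : y ∈ S')
    (hE : (∀ z ∈ S, z ∉ S' → z ∉ M.EA) ∨ (M.one ∈ S' ∧ M.two ∈ S')) : M.Linked S' x y := by
  refine ⟨hx, hy, fun T hT hxT => ?_⟩
  -- A union `T` of components of the smaller set is completed by the dropped edges in `A` that hang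
  -- on it. If both ends are present they are adjacent, so `T` contains both or neither, and testing
  -- `one` suffices.
  have key : M.ClosedIn ((T ∩ S) ∪ {e | e ∈ S ∧ e ∉ S' ∧ e ∈ M.EA ∧ M.one ∈ T}) S := by
    refine ⟨by rintro z (hz | hz); exacts [hz.2, hz.1], ?_⟩
    rintro z hz u hu hzu
    by_cases huS : u ∈ S'
    · rcases hz with hz | hz
      · exact .inl ⟨hT.2 z hz.1 u huS hzu, hu⟩
      · rcases hE with hE | hE
        · exact absurd hz.2.2.1 (hE z hz.1 hz.2.1)
        · rcases M.adj_EA hz.2.2.1 hzu with rfl | rfl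
          · exact .inl ⟨hz.2.2.2, hu⟩
          · exact .inl ⟨hT.2 _ hz.2.2.2 _ hE.2 M.adj_one_two, hu⟩
    · have huE : u ∈ M.EA := by
        rcases hS u hu huS with h | h
        · exact h
        · exact absurd (M.adj_symm hzu) (M.adj_EB h)
      rcases hE with hE | hE
      · exact absurd huE (hE u hu huS)
      · refine .inr ⟨hu, huS, huE, ?_⟩
        rcases hz with hz | hz
        · rcases M.adj_EA huE (M.adj_symm hzu) with rfl | rfl
          · exact hz.1
          · exact hT.2 _ hz.1 _ hE.1 (M.adj_symm M.adj_one_two)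
        · exact hz.2.2.2
  rcases h.2.2 _ key (.inl ⟨hxT, h.1⟩) with h' | h'
  · exact h'.1
  · exact absurd hy h'.2.1

end linked

/-! ### Parity -/

section parity

variable {I S X Y : Set ω}

theorem finite_of_subset_U (h : S ⊆ M.U) : S.Finite := M.finite_letters.subset h

/-- Adding to an even set an even number of letters in `A` that are linked to each other. -/
theorem EvenSet.union (hI : M.EvenSet I) (hIU : I ⊆ M.U) (hXU : X ⊆ M.U)
    (hX : Even ((X \ I) ∩ M.A).ncard)
    (hl : ∀ x ∈ X \ I, ∀ y ∈ X \ I, x ∈ M.A → y ∈ M.A → M.Linked (I ∪ X) x y) :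
    M.EvenSet (I ∪ X) := by
  intro T hT
  -- The first part is counted by the evenness of `I`. Of the second, `T` contains everything or
  -- nothing, since the new letters in `A` are linked.
  have hd : (T ∩ M.A) = (T ∩ I) ∩ M.A ∪ T ∩ ((X \ I) ∩ M.A) := by
    ext z
    have := @hT.1 z
    simp only [Set.mem_inter_iff, Set.mem_union, Set.mem_sdiff] at *
    tauto
  have hfin : ∀ Z, (Z ∩ T) ⊆ M.U := fun Z z hz => by
    rcases hT.1 hz.2 with h | h
    exacts [hIU h, hXU h]
  have f1 : (T ∩ I ∩ M.A).Finite := finite_of_subset_U (M := M) fun z hz => hfin T ⟨hz.1.1, hz.1.1⟩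
  have f2 : (T ∩ ((X \ I) ∩ M.A)).Finite :=
    finite_of_subset_U (M := M) fun z hz => hfin T ⟨hz.1, hz.1⟩
  rw [hd, Set.ncard_union_eq ?_ f1 f2]
  · refine (hI _ (hT.inter Set.subset_union_left)).add ?_
    by_cases h : ∃ x ∈ T, x ∈ (X \ I) ∩ M.A
    · obtain ⟨x, hxT, hx, hxA⟩ := h
      have : T ∩ ((X \ I) ∩ M.A) = (X \ I) ∩ M.A :=
        Set.inter_eq_right.2 fun y hy => (hl x hx y hy.1 hxA hy.2).2.2 T hT hxT
      rwa [this]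
    · have : T ∩ ((X \ I) ∩ M.A) = ∅ := by
        ext z; simp only [Set.mem_inter_iff, Set.mem_empty_iff_false, iff_false]
        exact fun hz => h ⟨z, hz.1, hz.2⟩
      simp [this]
  · rw [Set.disjoint_left]
    exact fun z hz hz' => hz'.2.1.2 hz.1.2

/-- A letter in `A` outside of the even set `I` is linked to another one in every even set
above `I`. -/
theorem exists_linked (hI : M.EvenSet I) (hY : M.EvenSet Y) (hYU : Y ⊆ M.U) (hIY : I ⊆ Y) {y : ω}
    (hyY : y ∈ Y) (hyI : y ∉ I) (hyA : y ∈ M.A) :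
    ∃ u ∈ Y, u ∉ I ∧ u ≠ y ∧ M.Linked (I ∪ {y, u}) y u := by
  set T := {z | M.Linked (I ∪ {y}) y z} with hT
  have hTc : M.ClosedIn T (I ∪ {y}) := closedIn_setOf_linked y
  have hyT : y ∈ T := Linked.refl (by simp)
  -- If no further letter of `Y` is adjacent to the component `T` of `y`, then `T` is a union of
  -- components of `Y`, hence even. But `T` without `y` is a union of components of `I`, also even,
  -- and `y` is in `A`.
  have hTY : T ⊆ Y := fun z hz => by
    rcases hTc.1 hz with h | h
    · exact hIY h
    · rw [Set.mem_singleton_iff.1 h]; exact hyY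
  by_contra hcon
  have hTcY : M.ClosedIn T Y := by
    refine ⟨hTY, fun x hx u hu hxu => by_contra fun huT => hcon ?_⟩
    have hu' : u ∉ I ∪ {y} := fun h => huT (hTc.2 x hx u h hxu)
    simp only [Set.mem_union, Set.mem_singleton_iff, not_or] at hu'
    refine ⟨u, hu, hu'.1, hu'.2, ?_⟩
    have h1 : M.Linked (I ∪ {y, u}) y x := Linked.mono hx (by
      intro z; simp only [Set.mem_union, Set.mem_insert_iff, Set.mem_singleton_iff]; tauto)
    exact h1.trans (.of_adj hxu h1.2.1 (by simp))
  have h1 := hY T hTcY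
  have h2 := hI _ (hTc.inter Set.subset_union_left)
  have h3 : T ∩ M.A = insert y (T ∩ I ∩ M.A) := by
    ext z
    have := @hTc.1 z
    simp only [Set.mem_inter_iff, Set.mem_union, Set.mem_insert_iff, Set.mem_singleton_iff] at *
    constructor
    · tauto
    · rintro (rfl | h) <;> tauto
  rw [h3, Set.ncard_insert_of_notMem (fun h => hyI h.1.2)
    (finite_of_subset_U (M := M) fun z hz => hYU (hTY hz.1.1))] at h1
  exact (Nat.even_add_one.1 h1) h2

end parity

/-! ### Walks past a missing vertex -/

section jumps

variable {S : Set ω} {x y p : ω}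

/-- A path that leads past `p` jumps over `p`. -/
theorem Linked.exists_jump (h : M.Linked S x y) (hS : S ⊆ M.U) (hp : p ∈ M.W) (hpS : p ∉ S)
    (hx : x ∈ M.EA ∨ M.rk x < M.rk p) (hy : y ∈ M.W) (hpy : M.rk p < M.rk y) :
    ∃ z z', z' ∈ S ∧ z ∈ ({M.one, M.two} ∪ M.W : Set ω) ∧ z' ∈ ({M.one, M.two} ∪ M.W : Set ω) ∧
      M.rk z < M.rk p ∧ M.rk p < M.rk z' ∧ M.adj z z' ∧
      M.Linked {z ∈ S | z ∈ M.EA ∨ M.rk z < M.rk p} x z := by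
  by_contra! hcon
  -- The part of `S` before `p`. Edges in `A` rank behind all vertices and have to be admitted
  -- separately; this does no harm, since they lead only to the ends. If no edge jumped over `p`,
  -- the component of `x` in this part would be one of `S`.
  set S' := {z ∈ S | z ∈ M.EA ∨ M.rk z < M.rk p} with hS'
  have key : M.ClosedIn {z | M.Linked S' x z} S := by
    refine ⟨fun z hz => hz.2.1.1, fun z hz u hu hzu => ?_⟩
    have hz' : z ∈ S' := hz.2.1
    by_cases hu' : u ∈ S'
    · exact Linked.trans hz (.of_adj hzu hz.2.1 hu')
    · have huEB : u ∉ M.EB := fun h => M.adj_EB h (M.adj_symm hzu)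
      have huEA : u ∉ M.EA := fun h => hu' ⟨hu, .inl h⟩
      have hup : M.rk p < M.rk u := by
        have h1 : ¬ M.rk u < M.rk p := fun h => hu' ⟨hu, .inr h⟩
        have h2 : M.rk u ≠ M.rk p := fun h => hpS (by
          rw [← rk_injOn (hS hu) (mem_U.2 (by tauto)) h]; exact hu)
        omega
      have h2p := M.rk_two_W hp
      have h12 := M.rk_one_two
      have hzEA : z ∉ M.EA := fun h => by
        rcases M.adj_EA h hzu with rfl | rfl <;> omega
      have hzEB : z ∉ M.EB := fun h => M.adj_EB h hzu
      have hzv := mem_U.1 (hS hz'.1)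
      have huv := mem_U.1 (hS hu)
      have hzp : M.rk z < M.rk p := hz'.2.resolve_left hzEA
      exact absurd hz (hcon z u hu (by simp; tauto) (by simp; tauto) hzp hup hzu)
  have hyT := h.2.2 _ key (Linked.refl ⟨h.1, hx⟩)
  rcases hyT.2.1.2 with h' | h'
  · exact W_EA hy h'
  · omega

/-- The walk to `y` has to jump over the missing vertex `p`. By `jump` the letter from which it
jumps is adjacent to `p`, and up to there the walk uses only letters before `p` and edges in `A`, in
particular not `y`. -/
theorem Linked.of_lt (h : M.Linked (S ∪ {y}) x y) (hS : S ⊆ M.U) (hp : p ∈ M.W) (hpS : p ∉ S)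
    (hx : x ∈ M.EA ∨ M.rk x < M.rk p) (hy : y ∈ M.W) (hpy : M.rk p < M.rk y) :
    M.Linked (S ∪ {p}) x p := by
  have hpy' : p ≠ y := fun h => by rw [h] at hpy; omega
  obtain ⟨z, z', -, hz, hz', hzp, hpz', hzz', hl⟩ := h.exists_jump
    (Set.union_subset hS (by simpa using mem_U.2 (by tauto))) hp (by simp [hpS, hpy']) hx hy hpy
  have hl' : M.Linked (S ∪ {p}) x z := hl.mono (by
    rintro t ⟨ht | ht, ht'⟩
    · exact .inl ht
    · rw [Set.mem_singleton_iff.1 ht] at ht'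
      rcases ht' with h | h
      · exact absurd h (W_EA hy)
      · omega)
  exact hl'.trans (.of_adj (M.jump hzz' hp hz hz' hzp hpz').2.1 hl'.2.1 (by simp))

/-- If a vertex `p` is jumped over, then all vertices other than `p` have been visited. -/
theorem Linked.not_two_missing (h : M.Linked S x y) (hS : S ⊆ M.U) (hp : p ∈ M.W) (hpS : p ∉ S)
    (hx : x = M.one ∨ x = M.two) (hy : y ∈ M.W) (hpy : M.rk p < M.rk y) {u : ω} (hu : u ∈ M.W)
    (huS : u ∉ S) (hup : u ≠ p) : False := by
  have h12 := M.rk_one_two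
  have low : ∀ {v}, v ∈ M.W → M.rk x < M.rk v := fun {v} hv => by
    have := M.rk_two_W hv
    rcases hx with rfl | rfl <;> omega
  obtain ⟨z, z', hz'S, hz, hz', hzp, hpz', hzz', hl⟩ :=
    h.exists_jump hS hp hpS (.inr (low hp)) hy hpy
  -- The jump over `p` starts at `z`, behind all other vertices except its target. So the missing
  -- vertex `u` is before `z`, and the walk to `z` must jump over `u` as well. That jump starts
  -- before `u`, yet at or behind `p`, which is absurd.
  have h1 := (M.jump hzz' hp hz hz' hzp hpz').2.2 u hu hup (fun h => huS (h ▸ hz'S))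
  have hl' : M.Linked S x z := hl.mono (Set.sep_subset _ _)
  have hzu : M.rk u < M.rk z := by
    refine lt_of_le_of_ne h1 fun h => huS ?_
    rw [rk_injOn (mem_U.2 (by tauto)) (hS hl'.2.1) h]; exact hl'.2.1
  have hzW : z ∈ M.W := by
    have := M.rk_two_W hu
    simp only [Set.mem_union, Set.mem_insert_iff, Set.mem_singleton_iff] at hz
    rcases hz with (rfl | rfl) | hz
    · omega
    · omega
    · exact hz
  obtain ⟨t, t', ht'S, ht, ht', htp, hpt', htt', -⟩ :=
    hl'.exists_jump hS hu huS (.inr (low hu)) hzW hzu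
  have h2 := (M.jump htt' hu ht ht' htp hpt').2.2 p hp hup.symm (fun h => hpS (h ▸ ht'S))
  omega

end jumps

end EvenModel

namespace EvenModel

variable {ω : Type*} {M : EvenModel ω}

/-! ### The possible differences between an element and its covers -/

section atoms

variable {I X Y : Set ω}

theorem EvenSet.insert (hI : M.EvenSet I) (hIU : I ⊆ M.U) {x : ω} (hx : x ∈ M.U)
    (hxA : x ∉ M.A) : M.EvenSet (I ∪ {x}) := by
  have h : ∀ z, z ∈ ({x} : Set ω) → z ∉ M.A := by rintro z rfl; exact hxA
  refine hI.union hIU (by simpa using hx) ?_ fun z hz _ _ hzA => absurd hzA (h z hz.1)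
  have : ({x} \ I) ∩ M.A = ∅ := by
    ext z; simp only [Set.mem_inter_iff, Set.mem_empty_iff_false, iff_false]
    exact fun hz => h z hz.1.1 hz.2
  simp [this]

theorem EvenSet.pair (hI : M.EvenSet I) (hIU : I ⊆ M.U) {x y : ω} (hx : x ∈ M.U) (hy : y ∈ M.U)
    (hxA : x ∈ M.A) (hyA : y ∈ M.A) (hxI : x ∉ I) (hyI : y ∉ I) (hxy : x ≠ y)
    (h : M.Linked (I ∪ {x, y}) x y) : M.EvenSet (I ∪ {x, y}) := by
  have hs : ({x, y} \ I) ∩ M.A = {x, y} := by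
    ext z; simp only [Set.mem_inter_iff, Set.mem_sdiff, Set.mem_insert_iff, Set.mem_singleton_iff]
    constructor
    · tauto
    · rintro (rfl | rfl) <;> tauto
  refine hI.union hIU (by rintro z (rfl | rfl) <;> assumption) ?_ ?_
  · rw [hs, Set.ncard_pair hxy]; exact even_two
  · rintro z ⟨rfl | rfl, -⟩ z' ⟨rfl | rfl, -⟩ - -
    exacts [.refl (by simp), h, h.symm, .refl (by simp)]

variable (M I) in
/-- The letters that may occur in an atom with two elements. -/
def Free (x : ω) : Prop := x ∉ I ∧ (x ∈ M.W ∨ (x ∈ M.EA ∧ M.one ∈ I ∧ M.two ∈ I))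

variable (M I) in
/-- The differences `J \ I` for the elements `J` that cover `I`. -/
inductive Atom : Set ω → Prop
  | edge (b : ω) (hb : b ∈ M.EB) (hbI : b ∉ I) (h1 : M.one ∈ I) (h2 : M.two ∈ I) : Atom {b}
  | pair (x y : ω) (hxy : x ≠ y) (hx : M.Free I x) (hy : M.Free I y)
      (h : M.Linked (I ∪ {x, y}) x y) : Atom {x, y}
  | endEdge (w w' a : ω) (hw : M.Ends w w') (hwI : w ∈ I) (hwI' : w' ∉ I) (hA : w' ∈ M.A)
      (ha : a ∈ M.EA) : Atom {w', a}
  | endEdgeVertex (w w' b v : ω) (hw : M.Ends w w') (hwI : w ∈ I) (hwI' : w' ∉ I) (hA : w' ∈ M.A)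
      (hb : b ∈ M.EB) (hv : v ∈ M.W) (hvI : v ∉ I) (h : M.Linked (I ∪ {w', v}) w' v) :
      Atom {w', b, v}
  | endFreeEdge (w w' b : ω) (hw : M.Ends w w') (hwI : w ∈ I) (hwI' : w' ∉ I) (hA : w' ∉ M.A)
      (hb : b ∈ M.EB) : Atom {w', b}
  | endPair (w w' a y : ω) (hw : M.Ends w w') (hwI : w ∈ I) (hwI' : w' ∉ I) (hA : w' ∉ M.A)
      (ha : a ∈ M.EA) (hy : y ∈ M.W ∪ M.EA) (hyI : y ∉ I) (hay : a ≠ y)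
      (h : M.Linked (I ∪ {w', y}) w' y) : Atom {w', a, y}
  | single (w w' : ω) (hw : M.Ends w w') (hwI : w ∉ I) (hwI' : w' ∉ I) (hA : w' ∉ M.A) :
      Atom {w'}
  | endVertex (w w' v : ω) (hw : M.Ends w w') (hwI : w ∉ I) (hwI' : w' ∉ I) (hA : w' ∈ M.A)
      (hv : v ∈ M.W) (hvI : v ∉ I) (h : M.Linked (I ∪ {w', v}) w' v) : Atom {w', v}
  | bothFreeEdge (b : ω) (h1 : M.one ∉ I) (h2 : M.two ∉ I) (hA1 : M.one ∈ M.A)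
      (hA2 : M.two ∈ M.A) (hb : b ∈ M.EB) : Atom {M.one, M.two, b}
  | bothPair (a a' : ω) (h1 : M.one ∉ I) (h2 : M.two ∉ I) (hA1 : M.one ∈ M.A)
      (hA2 : M.two ∈ M.A) (ha : a ∈ M.EA) (ha' : a' ∈ M.EA) (haa : a ≠ a') :
      Atom {M.one, M.two, a, a'}

theorem Free.mem_U {x : ω} (h : M.Free I x) : x ∈ M.U :=
  EvenModel.mem_U.2 (by have := h.2; tauto)
theorem Free.mem_A {x : ω} (h : M.Free I x) : x ∈ M.A := by
  rcases h.2 with h | h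
  exacts [M.W_A h, M.EA_A h.1]
theorem Free.notMem_EB {x : ω} (h : M.Free I x) : x ∉ M.EB := fun h' => M.EB_A h' h.mem_A
theorem Free.ne_one {x : ω} (h : M.Free I x) : x ≠ M.one := by
  rintro rfl
  rcases h.2 with h | h
  exacts [one_notMem_W h, one_notMem_EA h.1]
theorem Free.ne_two {x : ω} (h : M.Free I x) : x ≠ M.two := by
  rintro rfl
  rcases h.2 with h | h
  exacts [two_notMem_W h, two_notMem_EA h.1]

theorem Mem.notMem_of_ends (hI : M.Mem I) {w w' e : ω} (hw : M.Ends w w') (hwI : w' ∉ I)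
    (he : e ∈ M.EA ∨ e ∈ M.EB) : e ∉ I := fun heI => hwI (hw.iff.1 (hI.ends e heI he)).2

theorem ends_one_two : M.Ends M.one M.two := .inl ⟨rfl, rfl⟩

theorem Mem.atom_disjoint (hI : M.Mem I) (hX : M.Atom I X) : ∀ x ∈ X, x ∉ I := by
  cases hX with
  | edge b hb hbI h1 h2 => simpa using hbI
  | pair x y hxy hx hy h => simp [hx.1, hy.1]
  | endEdge w w' a hw hwI hwI' hA ha => simp [hwI', hI.notMem_of_ends hw hwI' (.inl ha)]
  | endEdgeVertex w w' b v hw hwI hwI' hA hb hv hvI h =>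
    simp [hwI', hvI, hI.notMem_of_ends hw hwI' (.inr hb)]
  | endFreeEdge w w' b hw hwI hwI' hA hb => simp [hwI', hI.notMem_of_ends hw hwI' (.inr hb)]
  | endPair w w' a y hw hwI hwI' hA ha hy hyI hay h =>
    simp [hwI', hyI, hI.notMem_of_ends hw hwI' (.inl ha)]
  | single w w' hw hwI hwI' hA => simpa using hwI'
  | endVertex w w' v hw hwI hwI' hA hv hvI h => simp [hwI', hvI]
  | bothFreeEdge b h1 h2 hA1 hA2 hb =>
    simp [h1, h2, hI.notMem_of_ends ends_one_two h2 (.inr hb)]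
  | bothPair a a' h1 h2 hA1 hA2 ha ha' haa =>
    simp [h1, h2, hI.notMem_of_ends ends_one_two h2 (.inl ha),
      hI.notMem_of_ends ends_one_two h2 (.inl ha')]

theorem Atom.nonempty (hX : M.Atom I X) : X.Nonempty := by
  cases hX <;> simp

theorem Atom.subset_U (hX : M.Atom I X) : X ⊆ M.U := by
  cases hX with
  | edge b hb hbI h1 h2 => simpa using mem_U.2 (by tauto)
  | pair x y hxy hx hy h => rintro z (rfl | rfl); exacts [hx.mem_U, hy.mem_U]
  | endEdge w w' a hw hwI hwI' hA ha =>
    rintro z (rfl | rfl); exacts [hw.symm.mem_U, mem_U.2 (by tauto)]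
  | endEdgeVertex w w' b v hw hwI hwI' hA hb hv hvI h =>
    rintro z (rfl | rfl | rfl)
    exacts [hw.symm.mem_U, mem_U.2 (by tauto), mem_U.2 (by tauto)]
  | endFreeEdge w w' b hw hwI hwI' hA hb =>
    rintro z (rfl | rfl); exacts [hw.symm.mem_U, mem_U.2 (by tauto)]
  | endPair w w' a y hw hwI hwI' hA ha hy hyI hay h =>
    rintro z (rfl | rfl | rfl)
    exacts [hw.symm.mem_U, mem_U.2 (by tauto), mem_U.2 (by rcases hy with h | h <;> tauto)]
  | single w w' hw hwI hwI' hA => simpa using hw.symm.mem_U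
  | endVertex w w' v hw hwI hwI' hA hv hvI h =>
    rintro z (rfl | rfl); exacts [hw.symm.mem_U, mem_U.2 (by tauto)]
  | bothFreeEdge b h1 h2 hA1 hA2 hb =>
    rintro z (rfl | rfl | rfl) <;> exact mem_U.2 (by tauto)
  | bothPair a a' h1 h2 hA1 hA2 ha ha' haa =>
    rintro z (rfl | rfl | rfl | rfl) <;> exact mem_U.2 (by tauto)

theorem Atom.ends_of_edge (hX : M.Atom I X) {e : ω} (he : e ∈ X) (heE : e ∈ M.EA ∪ M.EB) :
    M.one ∈ I ∪ X ∧ M.two ∈ I ∪ X := by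
  cases hX with
  | edge b hb hbI h1 h2 => exact ⟨.inl h1, .inl h2⟩
  | pair x y hxy hx hy h =>
    have : ∀ z, M.Free I z → z ∈ M.EA ∪ M.EB → M.one ∈ I ∧ M.two ∈ I := by
      rintro z hz (hz' | hz')
      · rcases hz.2 with h | h
        · exact absurd hz' (W_EA h)
        · exact h.2
      · exact absurd hz' hz.notMem_EB
    have : M.one ∈ I ∧ M.two ∈ I := by
      rcases he with rfl | rfl
      exacts [this _ hx heE, this _ hy heE]
    exact ⟨.inl this.1, .inl this.2⟩
  | endEdge w w' a hw hwI hwI' hA ha => exact hw.iff.2 ⟨.inl hwI, by simp⟩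
  | endEdgeVertex w w' b v hw hwI hwI' hA hb hv hvI h => exact hw.iff.2 ⟨.inl hwI, by simp⟩
  | endFreeEdge w w' b hw hwI hwI' hA hb => exact hw.iff.2 ⟨.inl hwI, by simp⟩
  | endPair w w' a y hw hwI hwI' hA ha hy hyI hay h => exact hw.iff.2 ⟨.inl hwI, by simp⟩
  | single w w' hw hwI hwI' hA =>
    rw [Set.mem_singleton_iff.1 he] at heE
    exact absurd heE (by simp [hw.symm.notMem_EA, hw.symm.notMem_EB])
  | endVertex w w' v hw hwI hwI' hA hv hvI h =>
    rcases he with rfl | rfl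
    · exact absurd heE (by simp [hw.symm.notMem_EA, hw.symm.notMem_EB])
    · exact absurd heE (by simp [W_EA hv, W_EB hv])
  | bothFreeEdge b h1 h2 hA1 hA2 hb => simp
  | bothPair a a' h1 h2 hA1 hA2 ha ha' haa => simp

theorem Mem.edge_of_atom (hI : M.Mem I) (hX : M.Atom I X) (h1 : M.one ∈ I ∪ X)
    (h2 : M.two ∈ I ∪ X) : ∃ e ∈ I ∪ X, e ∈ M.EA ∪ M.EB := by
  by_cases h : M.one ∈ I ∧ M.two ∈ I
  · obtain ⟨e, he, he'⟩ := hI.edge h.1 h.2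
    exact ⟨e, .inl he, he'⟩
  cases hX with
  | edge b hb hbI h1' h2' => exact absurd ⟨h1', h2'⟩ h
  | pair x y hxy hx hy _ =>
    simp [hx.ne_one.symm, hy.ne_one.symm, hx.ne_two.symm, hy.ne_two.symm] at h1 h2
    exact absurd ⟨h1, h2⟩ h
  | endEdge w w' a hw hwI hwI' hA ha => exact ⟨a, by simp, .inl ha⟩
  | endEdgeVertex w w' b v hw hwI hwI' hA hb hv hvI h => exact ⟨b, by simp, .inr hb⟩
  | endFreeEdge w w' b hw hwI hwI' hA hb => exact ⟨b, by simp, .inr hb⟩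
  | endPair w w' a y hw hwI hwI' hA ha hy hyI hay h => exact ⟨a, by simp, .inl ha⟩
  | single w w' hw hwI hwI' hA =>
    have := (hw.iff.1 ⟨h1, h2⟩).1
    simp [hwI, hw.ne] at this
  | endVertex w w' v hw hwI hwI' hA hv hvI _ =>
    have := (hw.iff.1 ⟨h1, h2⟩).1
    have hwv : w ≠ v := fun h => hw.notMem_W (h ▸ hv)
    simp [hwI, hw.ne, hwv] at this
  | bothFreeEdge b h1 h2 hA1 hA2 hb => exact ⟨b, by simp, .inr hb⟩
  | bothPair a a' h1 h2 hA1 hA2 ha ha' haa => exact ⟨a, by simp, .inl ha⟩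

/-- Every kind of atom is assembled from two moves that preserve evenness: adding a letter outside
`A`, and adding two linked letters in `A`. -/
theorem Mem.even_of_atom (hI : M.Mem I) (hX : M.Atom I X) : M.EvenSet (I ∪ X) := by
  have hIU := hI.subset
  have hXU := hX.subset_U
  have hXI := hI.atom_disjoint hX
  have hE := hI.even
  cases hX with
  | edge b hb hbI h1 h2 => exact hE.insert hIU (hXU rfl) (M.EB_A hb)
  | pair x y hxy hx hy h =>
    exact hE.pair hIU hx.mem_U hy.mem_U hx.mem_A hy.mem_A hx.1 hy.1 hxy h
  | endEdge w w' a hw hwI hwI' hA ha =>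
    exact hE.pair hIU (hXU (by simp)) (hXU (by simp)) hA (M.EA_A ha) (hXI _ (by simp))
      (hXI _ (by simp)) (fun h => hw.symm.notMem_EA (h ▸ ha))
      (.of_adj (hw.symm.adj_EA ha) (by simp) (by simp))
  | endEdgeVertex w w' b v hw hwI hwI' hA hb hv hvI h =>
    have h1 : M.EvenSet (I ∪ {w', v}) :=
      hE.pair hIU (hXU (by simp)) (hXU (by simp)) hA (M.W_A hv) (hXI _ (by simp))
        (hXI _ (by simp)) (fun h => hw.symm.notMem_W (h ▸ hv)) h
    have h2 := h1.insert (x := b) (by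
      rintro z (hz | rfl | rfl); exacts [hIU hz, hXU (by simp), hXU (by simp)])
      (hXU (by simp)) (M.EB_A hb)
    convert h2 using 1
    ext z; simp; tauto
  | endFreeEdge w w' b hw hwI hwI' hA hb =>
    have h1 : M.EvenSet (I ∪ {w'}) := hE.insert hIU (hXU (by simp)) hA
    have h2 := h1.insert (x := b) (by
      rintro z (hz | rfl); exacts [hIU hz, hXU (by simp)]) (hXU (by simp)) (M.EB_A hb)
    convert h2 using 1
    ext z; simp; tauto
  | endPair w w' a y hw hwI hwI' hA ha hy hyI hay h =>
    have h1 : M.EvenSet (I ∪ {w'}) := hE.insert hIU (hXU (by simp)) hA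
    have hyA : y ∈ M.A := by
      rcases hy with hy | hy
      exacts [M.W_A hy, M.EA_A hy]
    have haw : a ≠ w' := fun h => hw.symm.notMem_EA (h ▸ ha)
    have hyw : y ≠ w' := by
      rintro rfl
      rcases hy with hy | hy
      exacts [hw.symm.notMem_W hy, hw.symm.notMem_EA hy]
    have h2 := h1.pair (x := a) (y := y) (by
      rintro z (hz | rfl); exacts [hIU hz, hXU (by simp)]) (hXU (by simp)) (hXU (by simp))
      (M.EA_A ha) hyA (by simp [haw, hXI a]) (by simp [hyw, hyI]) hay
      ((Linked.of_adj (M.adj_symm (hw.symm.adj_EA ha)) (by simp) (by simp)).trans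
        (h.mono (by intro z; simp; tauto)))
    convert h2 using 1
    ext z; simp; tauto
  | single w w' hw hwI hwI' hA => exact hE.insert hIU (hXU (by simp)) hA
  | endVertex w w' v hw hwI hwI' hA hv hvI h =>
    exact hE.pair hIU (hXU (by simp)) (hXU (by simp)) hA (M.W_A hv) (hXI _ (by simp))
        (hXI _ (by simp)) (fun h => hw.symm.notMem_W (h ▸ hv)) h
  | bothFreeEdge b h1 h2 hA1 hA2 hb =>
    have h3 : M.EvenSet (I ∪ {M.one, M.two}) :=
      hE.pair hIU (hXU (by simp)) (hXU (by simp)) hA1 hA2 (hXI _ (by simp))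
        (hXI _ (by simp)) one_ne_two (.of_adj M.adj_one_two (by simp) (by simp))
    have h4 := h3.insert (x := b) (by
      rintro z (hz | rfl | rfl); exacts [hIU hz, hXU (by simp), hXU (by simp)])
      (hXU (by simp)) (M.EB_A hb)
    convert h4 using 1
    ext z; simp; tauto
  | bothPair a a' h1 h2 hA1 hA2 ha ha' haa =>
    have h3 : M.EvenSet (I ∪ {M.one, M.two}) :=
      hE.pair hIU (hXU (by simp)) (hXU (by simp)) hA1 hA2 (hXI _ (by simp))
        (hXI _ (by simp)) one_ne_two (.of_adj M.adj_one_two (by simp) (by simp))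
    have hne : ∀ e ∈ M.EA, e ≠ M.one ∧ e ≠ M.two := fun e he =>
      ⟨fun h => one_notMem_EA (h ▸ he), fun h => two_notMem_EA (h ▸ he)⟩
    have h4 := h3.pair (x := a) (y := a') (by
      rintro z (hz | rfl | rfl); exacts [hIU hz, hXU (by simp), hXU (by simp)])
      (hXU (by simp)) (hXU (by simp)) (M.EA_A ha) (M.EA_A ha')
      (by simp [hne a ha, hXI a]) (by simp [hne a' ha', hXI a']) haa
      ((Linked.of_adj (y := M.one) (M.adj_EA_one ha) (by simp) (by simp)).trans
        (.of_adj (M.adj_symm (M.adj_EA_one ha')) (by simp) (by simp)))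
    convert h4 using 1
    ext z; simp; tauto

theorem Mem.union_atom (hI : M.Mem I) (hX : M.Atom I X) : M.Mem (I ∪ X) where
  subset := Set.union_subset hI.subset hX.subset_U
  ends := by
    rintro e (he | he) heE
    · have := hI.ends e he heE
      exact ⟨.inl this.1, .inl this.2⟩
    · exact hX.ends_of_edge he heE
  edge := hI.edge_of_atom hX
  even := hI.even_of_atom hX

end atoms

/-! ### Every larger element contains an atom -/

section existence

variable {I X Y : Set ω}

/-- An edge outside `A` has no neighbours and therefore forms a component by itself. -/
theorem Linked.notMem_EB {S : Set ω} {x y : ω} (h : M.Linked S x y) (hxy : x ≠ y) :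
    y ∉ M.EB := fun hy => by
  have : M.ClosedIn {y} S := ⟨by simpa using h.2.1, by
    rintro z rfl u - hu; exact absurd hu (M.adj_EB hy)⟩
  exact hxy (Set.mem_singleton_iff.1 (h.symm.2.2 _ this rfl))

theorem ends_mem (hY : M.Mem Y) {e : ω} (he : e ∈ Y) (hE : e ∈ M.EA ∨ e ∈ M.EB) :
    M.one ∈ Y ∧ M.two ∈ Y := hY.ends e he hE

/-- A free letter of an element above `I` belongs to an atom with two elements, if the ends of the
bundle are in `I` or not available. -/
theorem exists_pair_atom (hI : M.Mem I) (hY : M.Mem Y) (hIY : I ⊆ Y) {y : ω}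
    (hyY : y ∈ Y) (hy : M.Free I y)
    (h : (M.one ∈ Y → M.one ∈ I) ∧ (M.two ∈ Y → M.two ∈ I)) :
    ∃ u ∈ Y, u ≠ y ∧ M.Free I u ∧ M.Linked (I ∪ {y, u}) y u ∧ M.Atom I {y, u} := by
  obtain ⟨u, huY, huI, huy, hl⟩ := exists_linked hI.even hY.even hY.subset hIY hyY hy.1 hy.mem_A
  have hEB := hl.notMem_EB huy.symm
  have hu : M.Free I u := by
    refine ⟨huI, ?_⟩
    rcases mem_U.1 (hY.subset huY) with rfl | rfl | h' | h' | h'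
    · exact absurd (h.1 huY) huI
    · exact absurd (h.2 huY) huI
    · exact .inl h'
    · have := ends_mem hY huY (.inl h')
      exact .inr ⟨h', h.1 this.1, h.2 this.2⟩
    · exact absurd h' hEB
  exact ⟨u, huY, huy, hu, hl, .pair y u huy.symm hy hu hl⟩

/-- With its second end an element must also contain a multiple edge. If `w'` is in `A`, an edge in
`A` balances it; otherwise an edge outside `A` is taken and `exists_linked` supplies a vertex as
partner of `w'`. If `w'` is not in `A`, an edge outside `A` suffices; otherwise an edge in `A` is
taken together with its partner. -/
theorem exists_atom_of_other_end (hI : M.Mem I) (hY : M.Mem Y) (hIY : I ⊆ Y) {w w' : ω}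
    (hw : M.Ends w w') (hwI : w ∈ I) (hwI' : w' ∉ I) (hwY : w' ∈ Y) :
    ∃ X, M.Atom I X ∧ X ⊆ Y ∧ w' ∈ X := by
  have h12 := hw.iff.2 ⟨hIY hwI, hwY⟩
  by_cases hA : w' ∈ M.A
  · by_cases ha : ∃ a ∈ Y, a ∈ M.EA
    · obtain ⟨a, haY, ha⟩ := ha
      exact ⟨_, .endEdge w w' a hw hwI hwI' hA ha,
        by rintro z (rfl | rfl) <;> assumption, by simp⟩
    · obtain ⟨b, hbY, hb⟩ := hY.edge h12.1 h12.2
      have hb : b ∈ M.EB := hb.resolve_left fun h => ha ⟨b, hbY, h⟩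
      obtain ⟨u, huY, huI, huw, hl⟩ :=
        exists_linked hI.even hY.even hY.subset hIY hwY hwI' hA
      have huW : u ∈ M.W := by
        rcases mem_U.1 (hY.subset huY) with h' | h' | h' | h' | h'
        · rcases hw.eq_or_eq (.inl h') with rfl | rfl <;> contradiction
        · rcases hw.eq_or_eq (.inr h') with rfl | rfl <;> contradiction
        · exact h'
        · exact absurd ⟨u, huY, h'⟩ ha
        · exact absurd h' (hl.notMem_EB huw.symm)
      exact ⟨_, .endEdgeVertex w w' b u hw hwI hwI' hA hb huW huI hl,
        by rintro z (rfl | rfl | rfl) <;> assumption, by simp⟩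
  · by_cases hb : ∃ b ∈ Y, b ∈ M.EB
    · obtain ⟨b, hbY, hb⟩ := hb
      exact ⟨_, .endFreeEdge w w' b hw hwI hwI' hA hb,
        by rintro z (rfl | rfl) <;> assumption, by simp⟩
    · obtain ⟨a, haY, ha⟩ := hY.edge h12.1 h12.2
      have ha : a ∈ M.EA := ha.resolve_right fun h => hb ⟨a, haY, h⟩
      have haw : a ≠ w' := fun h => hw.symm.notMem_EA (h ▸ ha)
      have hIw : M.EvenSet (I ∪ {w'}) := hI.even.insert hI.subset (hY.subset hwY) hA
      obtain ⟨u, huY, huI, hua, hl⟩ :=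
        exists_linked hIw hY.even hY.subset (by rintro z (hz | rfl); exacts [hIY hz, hwY]) haY
          (by simp [haw, hI.notMem_of_ends hw hwI' (.inl ha)]) (M.EA_A ha)
      simp only [Set.mem_union, Set.mem_singleton_iff, not_or] at huI
      have huWA : u ∈ M.W ∪ M.EA := by
        rcases mem_U.1 (hY.subset huY) with h' | h' | h' | h' | h'
        · rcases hw.eq_or_eq (.inl h') with rfl | rfl
          exacts [absurd hwI huI.1, absurd rfl huI.2]
        · rcases hw.eq_or_eq (.inr h') with rfl | rfl
          exacts [absurd hwI huI.1, absurd rfl huI.2]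
        · exact .inl h'
        · exact .inr h'
        · exact absurd h' (hl.notMem_EB hua.symm)
      have hends : M.one ∈ I ∪ {w', u} ∧ M.two ∈ I ∪ {w', u} := hw.iff.2 ⟨.inl hwI, by simp⟩
      -- The edge `a` serves only as a link between ends that are both present, so it can be
      -- dropped.
      have hl' : M.Linked (I ∪ {w', u}) w' u := by
        refine Linked.drop_edges (S := I ∪ {w'} ∪ {a, u}) ?_ ?_ (by simp) (by simp) (.inr hends)
        · exact (Linked.of_adj (hw.symm.adj_EA ha) (by simp) (by simp)).trans hl
        · rintro z hz hz'
          have : z = a := by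
            simp only [Set.mem_union, Set.mem_insert_iff, Set.mem_singleton_iff] at hz hz'; tauto
          exact .inl (this ▸ ha)
      exact ⟨_, .endPair w w' a u hw hwI hwI' hA ha huWA huI.1 hua.symm hl',
        by rintro z (rfl | rfl | rfl) <;> assumption, by simp⟩

/-- A letter linked to the two ends of the bundle is linked to one of them without the other. -/
theorem Linked.of_both {v : ω} (h : M.Linked (I ∪ {M.one, M.two} ∪ {v}) M.one v) (h1 : M.one ∉ I)
    (hv1 : v ≠ M.one) :
    M.Linked (I ∪ {M.one, v}) M.one v ∨ M.Linked (I ∪ {M.two, v}) M.two v := by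
  by_contra! hcon
  -- Otherwise the component of `v` without the ends touches neither of them, so it remains a
  -- component when both are added.
  have hcl : M.ClosedIn {z | M.Linked (I ∪ {v}) v z} (I ∪ {M.one, M.two} ∪ {v}) := by
    refine ⟨fun z hz => ?_, fun z hz t ht hzt => ?_⟩
    · rcases hz.2.1 with h | h
      · exact .inl (.inl h)
      · simp [Set.mem_singleton_iff.1 h]
    · have hz1 : ∀ e, M.Linked (I ∪ {e, v}) v z := fun e =>
        Linked.mono hz (by intro z; simp; tauto)
      have hgo : t ∈ I ∪ {v} → M.Linked (I ∪ {v}) v t := fun ht =>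
        Linked.trans hz (.of_adj hzt hz.2.1 ht)
      rcases ht with (ht | rfl | rfl) | ht
      · exact hgo (.inl ht)
      · exact absurd ((hz1 M.one).trans (.of_adj hzt (hz1 _).2.1 (by simp))).symm hcon.1
      · exact absurd ((hz1 M.two).trans (.of_adj hzt (hz1 _).2.1 (by simp))).symm hcon.2
      · exact hgo (.inr ht)
  have := (h.symm.2.2 _ hcl (Linked.refl (by simp))).2.1
  simp [h1, hv1.symm] at this

/-- An end outside `A` is an atom by itself, and an end in `A` forms one with a linked vertex. If
neither occurs, both ends are in `A` and in `Y`. They are then added together with an edge outside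
`A` or two edges in `A`, unless the partner of an edge in `A` is a vertex; by `Linked.of_both` that
vertex is linked to one end alone. -/
theorem exists_atom_of_end (hI : M.Mem I) (hY : M.Mem Y) (hIY : I ⊆ Y) (h1 : M.one ∉ I)
    (h2 : M.two ∉ I) {w w' : ω} (hw : M.Ends w w') (hwY : w' ∈ Y) :
    ∃ X, M.Atom I X ∧ X ⊆ Y ∧ (M.one ∈ X ∨ M.two ∈ X) := by
  have hwI : w ∉ I ∧ w' ∉ I := by rcases hw with ⟨rfl, rfl⟩ | ⟨rfl, rfl⟩ <;> tauto
  have hmem : ∀ Z : Set ω, w' ∈ Z → M.one ∈ Z ∨ M.two ∈ Z := fun Z hZ => by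
    rcases hw with ⟨rfl, rfl⟩ | ⟨rfl, rfl⟩ <;> tauto
  by_cases hA : w' ∈ M.A
  swap
  · exact ⟨_, .single w w' hw hwI.1 hwI.2 hA, by simpa using hwY, hmem _ rfl⟩
  obtain ⟨u, huY, huI, huw, hl⟩ := exists_linked hI.even hY.even hY.subset hIY hwY hwI.2 hA
  by_cases huW : u ∈ M.W
  · exact ⟨_, .endVertex w w' u hw hwI.1 hwI.2 hA huW huI hl,
      by rintro z (rfl | rfl) <;> assumption, hmem _ (by simp)⟩
  have h12 : M.one ∈ Y ∧ M.two ∈ Y := by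
    rcases mem_U.1 (hY.subset huY) with h' | h' | h' | h' | h'
    · rcases hw.eq_or_eq (.inl h') with h | h
      exacts [hw.iff.2 ⟨h ▸ huY, hwY⟩, absurd h huw]
    · rcases hw.eq_or_eq (.inr h') with h | h
      exacts [hw.iff.2 ⟨h ▸ huY, hwY⟩, absurd h huw]
    · exact absurd h' huW
    · exact ends_mem hY huY (.inl h')
    · exact ends_mem hY huY (.inr h')
  by_cases hA1 : M.one ∈ M.A
  swap
  · exact ⟨_, .single _ _ ends_one_two.symm h2 h1 hA1, by simpa using h12.1, by simp⟩
  have hA2 := M.two_mem_A hA1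
  by_cases hb : ∃ b ∈ Y, b ∈ M.EB
  · obtain ⟨b, hbY, hb⟩ := hb
    exact ⟨_, .bothFreeEdge b h1 h2 hA1 hA2 hb,
      by rintro z (rfl | rfl | rfl); exacts [h12.1, h12.2, hbY], by simp⟩
  obtain ⟨a, haY, ha⟩ := hY.edge h12.1 h12.2
  have ha : a ∈ M.EA := ha.resolve_right fun h => hb ⟨a, haY, h⟩
  have hI' : M.EvenSet (I ∪ {M.one, M.two}) :=
    hI.even.pair hI.subset (hY.subset h12.1) (hY.subset h12.2) hA1 hA2 h1 h2 one_ne_two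
      (.of_adj M.adj_one_two (by simp) (by simp))
  have ha1 : a ≠ M.one := fun h => one_notMem_EA (h ▸ ha)
  have ha2 : a ≠ M.two := fun h => two_notMem_EA (h ▸ ha)
  obtain ⟨v, hvY, hvI, hva, hl'⟩ := exists_linked hI' hY.even hY.subset
    (by rintro z (hz | rfl | rfl); exacts [hIY hz, h12.1, h12.2]) haY
    (by simp [ha1, ha2, hI.notMem_of_ends ends_one_two h2 (.inl ha)]) (M.EA_A ha)
  simp only [Set.mem_union, Set.mem_insert_iff, Set.mem_singleton_iff, not_or] at hvI
  rcases mem_U.1 (hY.subset hvY) with h' | h' | h' | h' | h'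
  · exact absurd h' hvI.2.1
  · exact absurd h' hvI.2.2
  · have hav : M.Linked (I ∪ {M.one, M.two} ∪ {v}) M.one v := by
      refine Linked.drop_edges (S := I ∪ {M.one, M.two} ∪ {a, v})
        ((Linked.of_adj (M.adj_symm (M.adj_EA_one ha)) (by simp) (by simp)).trans hl') ?_ (by simp)
        (by simp) (.inr (by simp))
      rintro z (hz | rfl | rfl) hz'
      exacts [absurd (.inl hz) hz', .inl ha, absurd (by simp) hz']
    rcases hav.of_both h1 hvI.2.1 with hv | hv
    · exact ⟨_, .endVertex _ _ v ends_one_two.symm h2 h1 hA1 h' hvI.1 hv,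
        by rintro z (rfl | rfl); exacts [h12.1, hvY], by simp⟩
    · exact ⟨_, .endVertex _ _ v ends_one_two h1 h2 hA2 h' hvI.1 hv,
        by rintro z (rfl | rfl); exacts [h12.2, hvY], by simp⟩
  · exact ⟨_, .bothPair a v h1 h2 hA1 hA2 ha h' hva.symm,
      by rintro z (rfl | rfl | rfl | rfl); exacts [h12.1, h12.2, haY, hvY], by simp⟩
  · exact absurd h' (hl'.notMem_EB hva.symm)

/-- If `Y` offers a new end, the two preceding lemmas apply. Otherwise any new letter in `A` has a
partner that is no end, and a new edge outside `A` is an atom by itself. -/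
theorem exists_atom (hI : M.Mem I) (hY : M.Mem Y) (hIY : I ⊂ Y) : ∃ X, M.Atom I X ∧ X ⊆ Y := by
  obtain ⟨y, hyY, hyI⟩ := Set.exists_of_ssubset hIY
  have hIY' := hIY.subset
  by_cases h1 : M.one ∈ Y ∧ M.one ∉ I
  · by_cases h2 : M.two ∈ I
    · obtain ⟨X, h⟩ := exists_atom_of_other_end hI hY hIY' ends_one_two.symm h2 h1.2 h1.1
      exact ⟨X, h.1, h.2.1⟩
    · obtain ⟨X, h⟩ := exists_atom_of_end hI hY hIY' h1.2 h2 ends_one_two.symm h1.1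
      exact ⟨X, h.1, h.2.1⟩
  by_cases h2 : M.two ∈ Y ∧ M.two ∉ I
  · by_cases h1 : M.one ∈ I
    · obtain ⟨X, h⟩ := exists_atom_of_other_end hI hY hIY' ends_one_two h1 h2.2 h2.1
      exact ⟨X, h.1, h.2.1⟩
    · obtain ⟨X, h⟩ := exists_atom_of_end hI hY hIY' h1 h2.2 ends_one_two h2.1
      exact ⟨X, h.1, h.2.1⟩
  have hends : (M.one ∈ Y → M.one ∈ I) ∧ (M.two ∈ Y → M.two ∈ I) := by tauto
  have hE : y ∈ M.EA ∨ y ∈ M.EB → M.one ∈ I ∧ M.two ∈ I := fun h => by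
    have := ends_mem hY hyY h; tauto
  have hfree : y ∈ M.W ∨ y ∈ M.EA → ∃ X, M.Atom I X ∧ X ⊆ Y := fun h => by
    obtain ⟨u, hu, -, -, -, hat⟩ :=
      exists_pair_atom hI hY hIY' hyY ⟨hyI, by tauto⟩ hends
    exact ⟨_, hat, by rintro z (rfl | rfl) <;> assumption⟩
  rcases mem_U.1 (hY.subset hyY) with rfl | rfl | h' | h' | h'
  · tauto
  · tauto
  · exact hfree (.inl h')
  · exact hfree (.inr h')
  · have := hE (.inr h')
    exact ⟨_, .edge y h' hyI this.1 this.2, by simpa using hyY⟩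

end existence

end EvenModel

/-! ### The atoms, sorted by the ends of the bundle in `I`, are the covers -/

namespace EvenModel

variable {ω : Type*} {M : EvenModel ω} {I X Y : Set ω}

theorem Atom.cases_both (hX : M.Atom I X) (h1 : M.one ∈ I) (h2 : M.two ∈ I) :
    (∃ b ∈ M.EB, b ∉ I ∧ X = {b}) ∨
    (∃ x y, x ≠ y ∧ M.Free I x ∧ M.Free I y ∧ M.Linked (I ∪ {x, y}) x y ∧ X = {x, y}) := by
  have he : ∀ {w w'}, M.Ends w w' → w ∈ I ∧ w' ∈ I := fun hw => hw.iff.1 ⟨h1, h2⟩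
  cases hX with
  | edge b hb hbI => exact .inl ⟨b, hb, hbI, rfl⟩
  | pair x y hxy hx hy h => exact .inr ⟨x, y, hxy, hx, hy, h, rfl⟩
  | endEdge w w' a hw hwI hwI' => exact absurd (he hw).2 hwI'
  | endEdgeVertex w w' b v hw hwI hwI' => exact absurd (he hw).2 hwI'
  | endFreeEdge w w' b hw hwI hwI' => exact absurd (he hw).2 hwI'
  | endPair w w' a y hw hwI hwI' => exact absurd (he hw).2 hwI'
  | single w w' hw hwI hwI' => exact absurd (he hw).2 hwI'
  | endVertex w w' v hw hwI hwI' => exact absurd (he hw).2 hwI'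
  | bothFreeEdge b h1' => exact absurd h1 h1'
  | bothPair a a' h1' => exact absurd h1 h1'

theorem Ends.unique {w w' z z' : ω} (hw : M.Ends w w') (hz : M.Ends z z') (hwI : w ∈ I)
    (hwI' : w' ∉ I) (hzI' : z' ∉ I) : z = w ∧ z' = w' := by
  rcases hw with ⟨rfl, rfl⟩ | ⟨rfl, rfl⟩ <;> rcases hz with ⟨rfl, rfl⟩ | ⟨rfl, rfl⟩ <;> tauto

theorem Free.mem_W {w w' x : ω} (h : M.Free I x) (hw : M.Ends w w') (hwI' : w' ∉ I) :
    x ∈ M.W := by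
  rcases h.2 with h | h
  · exact h
  · exact absurd (hw.iff.1 h.2).2 hwI'

theorem Atom.cases_one (hX : M.Atom I X) {w w' : ω} (hw : M.Ends w w') (hwI : w ∈ I)
    (hwI' : w' ∉ I) :
    (∃ x y, x ≠ y ∧ M.Free I x ∧ M.Free I y ∧ M.Linked (I ∪ {x, y}) x y ∧ X = {x, y}) ∨
    (w' ∈ M.A ∧ ((∃ a ∈ M.EA, X = {w', a}) ∨
      ∃ b ∈ M.EB, ∃ v ∈ M.W, v ∉ I ∧ M.Linked (I ∪ {w', v}) w' v ∧ X = {w', b, v})) ∨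
    (w' ∉ M.A ∧ ((∃ b ∈ M.EB, X = {w', b}) ∨
      ∃ a ∈ M.EA, ∃ y ∈ M.W ∪ M.EA, y ∉ I ∧ a ≠ y ∧ M.Linked (I ∪ {w', y}) w' y ∧
        X = {w', a, y})) := by
  have hn : ¬ (M.one ∈ I ∧ M.two ∈ I) := fun h => hwI' (hw.iff.1 h).2
  have hn' : ¬ (M.one ∉ I ∧ M.two ∉ I) := fun h => by
    rcases hw with ⟨rfl, rfl⟩ | ⟨rfl, rfl⟩ <;> tauto
  cases hX with
  | edge b hb hbI h1 h2 => exact absurd ⟨h1, h2⟩ hn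
  | pair x y hxy hx hy h => exact .inl ⟨x, y, hxy, hx, hy, h, rfl⟩
  | endEdge z z' a hz hzI hzI' hA ha =>
    obtain ⟨rfl, rfl⟩ := hw.unique hz hwI hwI' hzI'
    exact .inr (.inl ⟨hA, .inl ⟨a, ha, rfl⟩⟩)
  | endEdgeVertex z z' b v hz hzI hzI' hA hb hv hvI h =>
    obtain ⟨rfl, rfl⟩ := hw.unique hz hwI hwI' hzI'
    exact .inr (.inl ⟨hA, .inr ⟨b, hb, v, hv, hvI, h, rfl⟩⟩)
  | endFreeEdge z z' b hz hzI hzI' hA hb =>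
    obtain ⟨rfl, rfl⟩ := hw.unique hz hwI hwI' hzI'
    exact .inr (.inr ⟨hA, .inl ⟨b, hb, rfl⟩⟩)
  | endPair z z' a y hz hzI hzI' hA ha hy hyI hay h =>
    obtain ⟨rfl, rfl⟩ := hw.unique hz hwI hwI' hzI'
    exact .inr (.inr ⟨hA, .inr ⟨a, ha, y, hy, hyI, hay, h, rfl⟩⟩)
  | single z z' hz hzI hzI' =>
    obtain ⟨rfl, rfl⟩ := hw.unique hz hwI hwI' hzI'; contradiction
  | endVertex z z' v hz hzI hzI' =>
    obtain ⟨rfl, rfl⟩ := hw.unique hz hwI hwI' hzI'; contradiction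
  | bothFreeEdge b h1 h2 => exact absurd ⟨h1, h2⟩ hn'
  | bothPair a a' h1 h2 => exact absurd ⟨h1, h2⟩ hn'

theorem Atom.cases_none (hX : M.Atom I X) (h1 : M.one ∉ I) (h2 : M.two ∉ I) :
    (∃ x y, x ≠ y ∧ M.Free I x ∧ M.Free I y ∧ M.Linked (I ∪ {x, y}) x y ∧ X = {x, y}) ∨
    (∃ w w', M.Ends w w' ∧ w' ∉ M.A ∧ X = {w'}) ∨
    (∃ w w' v, M.Ends w w' ∧ w' ∈ M.A ∧ v ∈ M.W ∧ v ∉ I ∧ M.Linked (I ∪ {w', v}) w' v ∧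
      X = {w', v}) ∨
    (M.one ∈ M.A ∧ M.two ∈ M.A ∧ ((∃ b ∈ M.EB, X = {M.one, M.two, b}) ∨
      ∃ a ∈ M.EA, ∃ a' ∈ M.EA, a ≠ a' ∧ X = {M.one, M.two, a, a'})) := by
  have hn : ∀ {w w'}, M.Ends w w' → w ∉ I := fun hw => by
    rcases hw with ⟨rfl, rfl⟩ | ⟨rfl, rfl⟩ <;> tauto
  cases hX with
  | edge b hb hbI h1' => exact absurd h1' h1
  | pair x y hxy hx hy h => exact .inl ⟨x, y, hxy, hx, hy, h, rfl⟩
  | endEdge w w' a hw hwI => exact absurd hwI (hn hw)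
  | endEdgeVertex w w' b v hw hwI => exact absurd hwI (hn hw)
  | endFreeEdge w w' b hw hwI => exact absurd hwI (hn hw)
  | endPair w w' a y hw hwI => exact absurd hwI (hn hw)
  | single w w' hw hwI hwI' hA => exact .inr (.inl ⟨w, w', hw, hA, rfl⟩)
  | endVertex w w' v hw hwI hwI' hA hv hvI h =>
    exact .inr (.inr (.inl ⟨w, w', v, hw, hA, hv, hvI, h, rfl⟩))
  | bothFreeEdge b _ _ hA1 hA2 hb => exact .inr (.inr (.inr ⟨hA1, hA2, .inl ⟨b, hb, rfl⟩⟩))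
  | bothPair a a' _ _ hA1 hA2 ha ha' haa =>
    exact .inr (.inr (.inr ⟨hA1, hA2, .inr ⟨a, ha, a', ha', haa, rfl⟩⟩))

theorem ends_cases (I : Set ω) : (M.one ∈ I ∧ M.two ∈ I) ∨ (M.one ∉ I ∧ M.two ∉ I) ∨
    ∃ w w', M.Ends w w' ∧ w ∈ I ∧ w' ∉ I := by
  by_cases h1 : M.one ∈ I <;> by_cases h2 : M.two ∈ I
  · exact .inl ⟨h1, h2⟩
  · exact .inr (.inr ⟨_, _, ends_one_two, h1, h2⟩)
  · exact .inr (.inr ⟨_, _, ends_one_two.symm, h2, h1⟩)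
  · exact .inr (.inl ⟨h1, h2⟩)

/-- Once it is fixed which ends lie in `I`, only a few kinds of atoms remain. For each two of them,
the types of the letters and the membership of the ends in `A` rule out a proper containment. -/
theorem Atom.eq_of_subset (hX : M.Atom I X) (hY : M.Atom I Y) (h : X ⊆ Y) : X = Y := by
  have W1 := @W_EA _ M
  have W2 := @W_EB _ M
  have W3 := @EA_EB _ M
  have W4 : ∀ {w w'}, M.Ends w w' → w ∉ M.W ∧ w ∉ M.EA ∧ w ∉ M.EB := fun hw =>
    ⟨hw.notMem_W, hw.notMem_EA, hw.notMem_EB⟩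
  rcases ends_cases (M := M) I with ⟨h1, h2⟩ | ⟨h1, h2⟩ | ⟨w, w', hw, hwI, hwI'⟩
  · have hf : ∀ {x}, M.Free I x → x ∉ M.EB := fun hx => hx.notMem_EB
    rcases hX.cases_both h1 h2 with ⟨b, hb, hbI, rfl⟩ | ⟨x, y, hxy, hx, hy, -, rfl⟩ <;>
    rcases hY.cases_both h1 h2 with ⟨b', hb', hbI', rfl⟩ | ⟨x', y', hxy', hx', hy', -, rfl⟩ <;>
    simp only [Set.insert_subset_iff, Set.singleton_subset_iff, Set.mem_insert_iff,
      Set.mem_singleton_iff] at h <;> ext z <;> simp only [Set.mem_insert_iff,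
      Set.mem_singleton_iff] <;> grind
  · have hf : ∀ {x}, M.Free I x → x ∈ M.W := fun hx => hx.mem_W ends_one_two h2
    have h12 := @one_ne_two _ M
    have e1 := W4 (@ends_one_two _ M)
    have e2 := W4 (@ends_one_two _ M).symm
    have hE : ∀ {w w'}, M.Ends w w' → w' = M.one ∨ w' = M.two := fun hw => by
      rcases hw with h | h <;> tauto
    rcases hX.cases_none h1 h2 with ⟨x, y, hxy, hx, hy, -, rfl⟩ | ⟨w, w', hw, hA, rfl⟩ |
      ⟨w, w', v, hw, hA, hv, hvI, -, rfl⟩ | ⟨hA1, hA2, ⟨b, hb, rfl⟩ | ⟨a, ha, a', ha', haa, rfl⟩⟩ <;>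
    rcases hY.cases_none h1 h2 with ⟨x', y', hxy', hx', hy', -, rfl⟩ | ⟨z, z', hz, hzA, rfl⟩ |
      ⟨z, z', u, hz, hzA, hu, huI, -, rfl⟩ |
      ⟨hA1', hA2', ⟨c, hc, rfl⟩ | ⟨c, hc, c', hc', hcc, rfl⟩⟩ <;>
    simp only [Set.insert_subset_iff, Set.singleton_subset_iff, Set.mem_insert_iff,
      Set.mem_singleton_iff] at h <;> ext t <;> simp only [Set.mem_insert_iff,
      Set.mem_singleton_iff] <;> grind
  · have hf : ∀ {x}, M.Free I x → x ∈ M.W := fun hx => hx.mem_W hw hwI'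
    have e2 := W4 hw.symm
    rcases hX.cases_one hw hwI hwI' with ⟨x, y, hxy, hx, hy, -, rfl⟩ |
      ⟨hA, ⟨a, ha, rfl⟩ | ⟨b, hb, v, hv, hvI, -, rfl⟩⟩ |
      ⟨hA, ⟨b, hb, rfl⟩ | ⟨a, ha, y, hy, hyI, hay, -, rfl⟩⟩ <;>
    rcases hY.cases_one hw hwI hwI' with ⟨x', y', hxy', hx', hy', -, rfl⟩ |
      ⟨hA', ⟨a', ha', rfl⟩ | ⟨b', hb', v', hv', hvI', -, rfl⟩⟩ |
      ⟨hA', ⟨b', hb', rfl⟩ | ⟨a', ha', y', hy', hyI', hay', -, rfl⟩⟩ <;>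
    simp only [Set.insert_subset_iff, Set.singleton_subset_iff, Set.mem_insert_iff,
      Set.mem_singleton_iff] at h <;> ext t <;> simp only [Set.mem_insert_iff,
      Set.mem_singleton_iff] <;> grind
variable (M) in
/-- `J` covers `I` in the poset of even sets. -/
def Covers (I J : Set ω) : Prop :=
  M.Mem I ∧ M.Mem J ∧ I ⊂ J ∧ ∀ K, M.Mem K → I ⊂ K → K ⊆ J → K = J

theorem Mem.ssubset_union_atom (hI : M.Mem I) (hX : M.Atom I X) : I ⊂ I ∪ X := by
  obtain ⟨x, hx⟩ := hX.nonempty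
  exact Set.ssubset_iff_exists.2 ⟨Set.subset_union_left, x, .inr hx, hI.atom_disjoint hX x hx⟩

/-- An element `K` in between contains an atom, which lies in `X` and hence equals `X`. -/
theorem Mem.covers_union (hI : M.Mem I) (hX : M.Atom I X) : M.Covers I (I ∪ X) := by
  refine ⟨hI, hI.union_atom hX, hI.ssubset_union_atom hX, fun K hK hIK hKX => ?_⟩
  obtain ⟨X', hX', hXK⟩ := exists_atom hI hK hIK
  have : X' = X := hX'.eq_of_subset hX fun x hx =>
    (hKX (hXK hx)).resolve_left (hI.atom_disjoint hX' x hx)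
  exact hKX.antisymm (Set.union_subset hIK.subset (this ▸ hXK))

theorem Covers.exists_atom {J : Set ω} (h : M.Covers I J) : ∃ X, M.Atom I X ∧ J = I ∪ X := by
  obtain ⟨X, hX, hXJ⟩ := EvenModel.exists_atom h.1 h.2.1 h.2.2.1
  exact ⟨X, hX, (h.2.2.2 _ (h.1.union_atom hX) (h.1.ssubset_union_atom hX)
    (Set.union_subset h.2.2.1.subset hXJ)).symm⟩

end EvenModel

/-! ### The order of the letters and the comparison of atoms -/

namespace EvenModel

variable {ω : Type*} (M : EvenModel ω)

/-- The edge `e` precedes the vertices in `W` in the order attached to `I`. -/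
def Front (I : Set ω) (e : ω) : Prop := ∃ f ∈ I, f ∈ M.EA ∪ M.EB ∧ M.rk e ≤ M.rk f

open scoped Classical in
/-- The block of the letter `x` in the order attached to `I`. -/
noncomputable def block (I : Set ω) (x : ω) : ℕ :=
  if x ∈ M.W then 2 else if x ∈ M.EA ∪ M.EB then (if M.Front I x then 1 else 3) else 0

/-- The position of the letter `x` in the order attached to `I`. -/
noncomputable def key (I : Set ω) (x : ω) : ℕ ×ₗ ℕ := toLex (M.block I x, M.rk x)

/-- The lexicographic comparison with respect to the order attached to `I`. -/
def Lex (I X Y : Set ω) : Prop :=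
  ∃ x ∈ X, x ∉ Y ∧ ∀ z, M.key I z < M.key I x → (z ∈ X ↔ z ∈ Y)

open scoped Classical in
/-- The class of an atom in the priority order. -/
noncomputable def cls (X : Set ω) : ℕ :=
  -- The priority rule says nothing about sets without ends. Since the ends come first among the
  -- letters, the lexicographic comparison already places these last, so they can be given the
  -- highest class.
  if M.one ∈ X ∧ M.two ∈ X then 2
  else if M.one ∈ X ∨ M.two ∈ X then (if ∃ b ∈ M.EB, b ∈ X then 1 else 0) else 3

/-- The comparison of the atoms of `[I, ⊤]`. -/
def Prec (I X Y : Set ω) : Prop := M.cls X < M.cls Y ∨ (M.cls X = M.cls Y ∧ M.Lex I X Y)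

/-- Some atom of `[I, ⊤]` contained in `X ∪ D` precedes `X`. -/
def Earlier (I X D : Set ω) : Prop := ∃ Y, M.Atom I Y ∧ M.Prec I Y X ∧ Y ⊆ X ∪ D

variable {M} {I X Y : Set ω}

section keys

theorem key_lt {x y : ω} : M.key I x < M.key I y ↔
    M.block I x < M.block I y ∨ (M.block I x = M.block I y ∧ M.rk x < M.rk y) :=
  Prod.Lex.toLex_lt_toLex

theorem block_W {x : ω} (h : x ∈ M.W) : M.block I x = 2 := by simp [block, h]

theorem block_front {x : ω} (h : x ∈ M.EA ∪ M.EB) (hf : M.Front I x) : M.block I x = 1 := by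
  have : x ∉ M.W := fun hW => h.elim (W_EA hW) (W_EB hW)
  rw [block, if_neg this, if_pos h, if_pos hf]

theorem block_back {x : ω} (h : x ∈ M.EA ∪ M.EB) (hf : ¬ M.Front I x) : M.block I x = 3 := by
  have : x ∉ M.W := fun hW => h.elim (W_EA hW) (W_EB hW)
  rw [block, if_neg this, if_pos h, if_neg hf]

theorem block_end {w w' : ω} (h : M.Ends w w') : M.block I w = 0 := by
  simp [block, h.notMem_W, h.notMem_EA, h.notMem_EB]

theorem key_W_W {x y : ω} (hx : x ∈ M.W) (hy : y ∈ M.W) :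
    M.key I x < M.key I y ↔ M.rk x < M.rk y := by
  simp [key_lt, block_W hx, block_W hy]

theorem key_E_W {x y : ω} (hx : x ∈ M.EA ∪ M.EB) (hy : y ∈ M.W) :
    M.key I x < M.key I y ↔ M.Front I x := by
  by_cases h : M.Front I x
  · simp [key_lt, block_W hy, block_front hx h, h]
  · simp [key_lt, block_W hy, block_back hx h, h]

theorem key_W_E {x y : ω} (hx : x ∈ M.W) (hy : y ∈ M.EA ∪ M.EB) :
    M.key I x < M.key I y ↔ ¬ M.Front I y := by
  by_cases h : M.Front I y
  · simp [key_lt, block_W hx, block_front hy h, h]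
  · simp [key_lt, block_W hx, block_back hy h, h]

theorem Front.mono {x y : ω} (h : M.Front I y) (hxy : M.rk x ≤ M.rk y) : M.Front I x := by
  obtain ⟨f, hf, hf', h⟩ := h
  exact ⟨f, hf, hf', hxy.trans h⟩

/-- The edges at the front form an initial segment of all edges by rank, so the relative order of
edges never changes. -/
theorem key_E_E {x y : ω} (hx : x ∈ M.EA ∪ M.EB) (hy : y ∈ M.EA ∪ M.EB) :
    M.key I x < M.key I y ↔ M.rk x < M.rk y := by
  by_cases h : M.Front I x <;> by_cases h' : M.Front I y
  · simp [key_lt, block_front hx h, block_front hy h']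
  · have : M.rk x < M.rk y := by
      by_contra hlt; exact h' (h.mono (not_lt.1 hlt))
    simp [key_lt, block_front hx h, block_back hy h', this]
  · have : ¬ M.rk x < M.rk y := fun hlt => h (h'.mono hlt.le)
    simp [key_lt, block_back hx h, block_front hy h', this]
  · simp [key_lt, block_back hx h, block_back hy h']

theorem key_end {w w' x : ω} (hw : M.Ends w w') (hx : x ∈ M.W ∨ x ∈ M.EA ∨ x ∈ M.EB) :
    M.key I w < M.key I x := by
  refine key_lt.2 (.inl ?_)
  rw [block_end hw]
  by_cases hxW : x ∈ M.W
  · rw [block_W hxW]; norm_num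
  · have hxE : x ∈ M.EA ∪ M.EB := by simpa [hxW] using hx
    by_cases h : M.Front I x
    · rw [block_front hxE h]; norm_num
    · rw [block_back hxE h]; norm_num

theorem key_one_two : M.key I M.one < M.key I M.two :=
  key_lt.2 (.inr ⟨by rw [block_end ends_one_two, block_end ends_one_two.symm], M.rk_one_two⟩)

theorem key_inj {x y : ω} (hx : x ∈ M.U) (hy : y ∈ M.U) (h : M.key I x = M.key I y) : x = y :=
  rk_injOn hx hy (congrArg (fun p => (ofLex p).2) h)

/-- The only changes of the order are edges that move to the front. -/
theorem key_switch {J : Set ω} (hIJ : I ⊆ J) {x y : ω} (hx : x ∈ M.U) (hy : y ∈ M.U)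
    (h : M.key I x < M.key I y) (h' : M.key J y ≤ M.key J x) :
    y ∈ M.EA ∪ M.EB ∧ x ∈ M.W ∧ ¬ M.Front I y ∧ M.Front J y := by
  have hmono : ∀ z, M.Front I z → M.Front J z := fun z ⟨f, hf, h⟩ => ⟨f, hIJ hf, h⟩
  have h' := h'.not_gt
  rcases mem_U.1 hx with rfl | rfl | hx' | hx'
  · rcases mem_U.1 hy with rfl | rfl | hy'
    · exact absurd h (lt_irrefl _)
    · exact absurd key_one_two h'
    · exact absurd (key_end ends_one_two hy') h'
  · rcases mem_U.1 hy with rfl | rfl | hy'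
    · exact absurd key_one_two h.not_gt
    · exact absurd h (lt_irrefl _)
    · exact absurd (key_end ends_one_two.symm hy') h'
  · rcases mem_U.1 hy with rfl | rfl | hy' | hy'
    · exact absurd (key_end ends_one_two (.inl hx')) h.not_gt
    · exact absurd (key_end ends_one_two.symm (.inl hx')) h.not_gt
    · rw [key_W_W hx' hy'] at h h'; exact absurd h h'
    · rw [key_W_E hx' hy'] at h h'; exact ⟨hy', hx', h, not_not.1 h'⟩
  · rcases mem_U.1 hy with rfl | rfl | hy' | hy'
    · exact absurd (key_end ends_one_two (.inr hx')) h.not_gt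
    · exact absurd (key_end ends_one_two.symm (.inr hx')) h.not_gt
    · rw [key_E_W hx' hy'] at h h'; exact absurd (hmono _ h) h'
    · rw [key_E_E hx' hy'] at h h'; exact absurd h h'

end keys

section lex

/-- The first letter in which the two sets differ comes no later than `y`, so it cannot belong to
`Y`. -/
theorem lex_of (hX : X ⊆ M.U) (hY : Y ⊆ M.U) {y : ω} (hyX : y ∈ X) (hyY : y ∉ Y)
    (h : ∀ x ∈ Y, x ∉ X → M.key I y < M.key I x) : M.Lex I X Y := by
  have hfin : ((X \ Y) ∪ (Y \ X)).Finite := finite_of_subset_U (M := M) fun z hz => by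
    rcases hz with hz | hz
    exacts [hX hz.1, hY hz.1]
  obtain ⟨m, hm, hmin⟩ := Set.exists_min_image _ (M.key I) hfin ⟨y, .inl ⟨hyX, hyY⟩⟩
  rcases hm with hm | hm
  · refine ⟨m, hm.1, hm.2, fun z hz => ?_⟩
    by_contra hne
    have : z ∈ (X \ Y) ∪ (Y \ X) := by
      simp only [Set.mem_union, Set.mem_sdiff]; tauto
    exact absurd hz (hmin z this).not_gt
  · exact absurd (h m hm.1 hm.2) (hmin y (.inl ⟨hyX, hyY⟩)).not_gt

theorem Lex.exists (h : M.Lex I X Y) (hX : X ⊆ M.U) (hY : Y ⊆ M.U) :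
    ∃ y ∈ X, y ∉ Y ∧ ∀ x ∈ Y, x ∉ X → M.key I y < M.key I x := by
  obtain ⟨y, hyX, hyY, h⟩ := h
  refine ⟨y, hyX, hyY, fun x hx hxX => ?_⟩
  by_contra hlt
  rcases (not_lt.1 hlt).lt_or_eq with h' | h'
  · exact hxX ((h x h').2 hx)
  · exact hxX (key_inj (hY hx) (hX hyX) h' ▸ hyX)

/-- This is how a comparison at `J` is used below: for a letter of the later atom it produces a
letter of the earlier one that comes no later. -/
theorem Lex.exists_le (h : M.Lex I X Y) {z : ω} (hz : z ∈ Y) :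
    ∃ z' ∈ X, M.key I z' ≤ M.key I z := by
  obtain ⟨y, hyX, hyY, h⟩ := h
  by_cases hlt : M.key I z < M.key I y
  · exact ⟨z, (h z hlt).2 hz, le_rfl⟩
  · exact ⟨y, hyX, not_lt.1 hlt⟩

theorem Lex.irrefl : ¬ M.Lex I X X := fun ⟨_, h, h', _⟩ => h' h

theorem Lex.trans {Z : Set ω} (hX : X ⊆ M.U) (hY : Y ⊆ M.U) (h : M.Lex I X Y)
    (h' : M.Lex I Y Z) : M.Lex I X Z := by
  obtain ⟨x, hxX, hxY, hx⟩ := h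
  obtain ⟨y, hyY, hyZ, hy⟩ := h'
  rcases lt_trichotomy (M.key I x) (M.key I y) with hlt | heq | hlt
  · exact ⟨x, hxX, fun hxZ => hxY ((hy x hlt).2 hxZ),
      fun z hz => (hx z hz).trans (hy z (hz.trans hlt))⟩
  · exact absurd (key_inj (hX hxX) (hY hyY) heq ▸ hyY) hxY
  · exact ⟨y, (hx y hlt).2 hyY, hyZ, fun z hz => (hx z (hz.trans hlt)).trans (hy z hz)⟩

theorem Lex.total (hX : X ⊆ M.U) (hY : Y ⊆ M.U) (h : ¬ X ⊆ Y) (h' : ¬ Y ⊆ X) :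
    M.Lex I X Y ∨ M.Lex I Y X := by
  obtain ⟨x, hx, hxY⟩ := Set.not_subset.1 h
  obtain ⟨m, hm, hmin⟩ := Set.exists_min_image (Y \ X) (M.key I)
    (finite_of_subset_U (M := M) fun z hz => hY hz.1) (Set.not_subset.1 h')
  obtain ⟨k, hk, hkmin⟩ := Set.exists_min_image (X \ Y) (M.key I)
    (finite_of_subset_U (M := M) fun z hz => hX hz.1) ⟨x, hx, hxY⟩
  rcases lt_trichotomy (M.key I k) (M.key I m) with hlt | heq | hlt
  · exact .inl (lex_of hX hY hk.1 hk.2 fun z hz hzX => hlt.trans_le (hmin z ⟨hz, hzX⟩))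
  · exact absurd (key_inj (hX hk.1) (hY hm.1) heq ▸ hm.1) hk.2
  · exact .inr (lex_of hY hX hm.1 hm.2 fun z hz hzX => hlt.trans_le (hkmin z ⟨hz, hzX⟩))

theorem Prec.irrefl : ¬ M.Prec I X X := by
  rintro (h | h)
  exacts [lt_irrefl _ h, Lex.irrefl h.2]

theorem Prec.trans {Z : Set ω} (hX : X ⊆ M.U) (hY : Y ⊆ M.U) (h : M.Prec I X Y)
    (h' : M.Prec I Y Z) : M.Prec I X Z := by
  rcases h with h | h <;> rcases h' with h' | h'
  · exact .inl (h.trans h')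
  · exact .inl (h'.1 ▸ h)
  · exact .inl (h.1 ▸ h')
  · exact .inr ⟨h.1.trans h'.1, h.2.trans hX hY h'.2⟩

theorem Atom.prec_total (hX : M.Atom I X) (hY : M.Atom I Y) (hne : X ≠ Y) :
    M.Prec I X Y ∨ M.Prec I Y X := by
  rcases lt_trichotomy (M.cls X) (M.cls Y) with h | h | h
  · exact .inl (.inl h)
  · rcases Lex.total (I := I) hX.subset_U hY.subset_U (fun hs => hne (hX.eq_of_subset hY hs))
      (fun hs => hne (hY.eq_of_subset hX hs).symm) with h' | h'
    exacts [.inl (.inr ⟨h, h'⟩), .inr (.inr ⟨h.symm, h'⟩)]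
  · exact .inr (.inl h)

theorem prec_of (hX : X ⊆ M.U) (hY : Y ⊆ M.U) (hc : M.cls X ≤ M.cls Y) {y : ω} (hyX : y ∈ X)
    (hyY : y ∉ Y) (h : ∀ x ∈ Y, x ∉ X → M.key I y < M.key I x) : M.Prec I X Y := by
  rcases hc.lt_or_eq with hc | hc
  exacts [.inl hc, .inr ⟨hc, lex_of hX hY hyX hyY h⟩]

theorem cls_three (h1 : M.one ∉ X) (h2 : M.two ∉ X) : M.cls X = 3 := by simp [cls, h1, h2]

theorem cls_two (h1 : M.one ∈ X) (h2 : M.two ∈ X) : M.cls X = 2 := by simp [cls, h1, h2]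

theorem cls_one {w w' : ω} (hw : M.Ends w w') (h : w ∉ X) (h' : w' ∈ X)
    (hb : ∃ b ∈ M.EB, b ∈ X) : M.cls X = 1 := by
  rcases hw with ⟨rfl, rfl⟩ | ⟨rfl, rfl⟩ <;> simp [cls, h, h', hb]

theorem cls_zero {w w' : ω} (hw : M.Ends w w') (h : w ∉ X) (h' : w' ∈ X)
    (hb : ∀ b ∈ M.EB, b ∉ X) : M.cls X = 0 := by
  have : ¬ ∃ b ∈ M.EB, b ∈ X := fun ⟨b, h, h'⟩ => hb b h h'
  rcases hw with ⟨rfl, rfl⟩ | ⟨rfl, rfl⟩ <;> simp [cls, h, h', this]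

theorem cls_le (X : Set ω) : M.cls X ≤ 3 := by
  unfold cls; split_ifs <;> norm_num

theorem cls_lt_three (h : M.one ∈ X ∨ M.two ∈ X) : M.cls X < 3 := by
  unfold cls; split_ifs <;> simp

end lex

/-! ### Earlier atoms come first: atoms without ends of the bundle -/

section pairs

variable {Z Z' : Set ω} {x₁ x₂ y p : ω}

/-- An atom without ends of the bundle. -/
theorem Atom.cases_noEnds (hX : M.Atom I X) (h1 : M.one ∉ X) (h2 : M.two ∉ X) :
    (∃ b ∈ M.EB, b ∉ I ∧ M.one ∈ I ∧ M.two ∈ I ∧ X = {b}) ∨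
    (∃ x y, x ≠ y ∧ M.Free I x ∧ M.Free I y ∧ M.Linked (I ∪ {x, y}) x y ∧ X = {x, y}) := by
  have hn : ∀ {w w' : ω} {S : Set ω}, M.Ends w w' → M.one ∉ insert w' S → M.two ∉ insert w' S →
      False := fun hw h h' => by
    rcases hw with ⟨rfl, rfl⟩ | ⟨rfl, rfl⟩
    exacts [h' (by simp), h (by simp)]
  cases hX with
  | edge b hb hbI ho ht => exact .inl ⟨b, hb, hbI, ho, ht, rfl⟩
  | pair x y hxy hx hy h => exact .inr ⟨x, y, hxy, hx, hy, h, rfl⟩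
  | endEdge w w' a hw => exact (hn hw h1 h2).elim
  | endEdgeVertex w w' b v hw => exact (hn hw h1 h2).elim
  | endFreeEdge w w' b hw => exact (hn hw h1 h2).elim
  | endPair w w' a y hw => exact (hn hw h1 h2).elim
  | single w w' hw =>
    rcases hw with ⟨rfl, rfl⟩ | ⟨rfl, rfl⟩
    exacts [absurd rfl h2, absurd rfl h1]
  | endVertex w w' v hw => exact (hn hw h1 h2).elim
  | bothFreeEdge b => simp at h1
  | bothPair a a' => simp at h1

/-- A letter linked to an edge in `A` is linked to all of them. -/
theorem linked_edge (h1 : M.one ∈ I) (h2 : M.two ∈ I) (h : M.Linked (I ∪ {x₁, x₂}) x₁ x₂)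
    (hE : x₁ ∈ M.EA ∨ x₂ ∈ M.EA) (hp : p ∈ M.EA) : M.Linked (I ∪ {x₁, p}) x₁ p := by
  have hone : M.Linked (I ∪ {x₁, p}) M.one p :=
    .of_adj (M.adj_symm (M.adj_EA_one hp)) (.inl h1) (by simp)
  by_cases hx₁ : x₁ ∈ M.EA
  · exact (Linked.of_adj (M.adj_EA_one hx₁) (by simp) (.inl h1)).trans hone
  · have hx₂ := hE.resolve_left hx₁
    have h3 : M.Linked (I ∪ {x₁, x₂}) x₁ M.one :=
      h.trans (.of_adj (M.adj_EA_one hx₂) (by simp) (.inl h1))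
    refine Linked.trans (Linked.drop_edges h3 ?_ (by simp) (.inl h1) (.inr ⟨.inl h1, .inl h2⟩)) hone
    rintro z (hz | rfl | rfl) hz'
    · exact absurd (.inl hz) hz'
    · exact absurd (by simp) hz'
    · exact .inl hx₂

/-- The common hypotheses on an atom with two elements, listed in increasing order. -/
structure OrdPair (M : EvenModel ω) (I : Set ω) (x₁ x₂ : ω) : Prop where
  mem : M.Mem I
  free₁ : M.Free I x₁
  free₂ : M.Free I x₂
  linked : M.Linked (I ∪ {x₁, x₂}) x₁ x₂
  lt : M.key I x₁ < M.key I x₂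

namespace OrdPair

theorem ne (h : M.OrdPair I x₁ x₂) : x₁ ≠ x₂ := fun he => by
  have := h.lt; rw [he] at this; exact lt_irrefl _ this

theorem atom (h : M.OrdPair I x₁ x₂) : M.Atom I {x₁, x₂} := .pair _ _ h.ne h.free₁ h.free₂ h.linked

theorem one_notMem (h : M.OrdPair I x₁ x₂) : M.one ∉ ({x₁, x₂} : Set ω) := by
  simp [h.free₁.ne_one.symm, h.free₂.ne_one.symm]

theorem two_notMem (h : M.OrdPair I x₁ x₂) : M.two ∉ ({x₁, x₂} : Set ω) := by
  simp [h.free₁.ne_two.symm, h.free₂.ne_two.symm]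

theorem cls_eq (h : M.OrdPair I x₁ x₂) : M.cls {x₁, x₂} = 3 := cls_three h.one_notMem h.two_notMem

theorem free_of_union (h : M.OrdPair I x₁ x₂) (hp : M.Free (I ∪ {x₁, x₂}) p) : M.Free I p := by
  have h1 := h.one_notMem
  have h2 := h.two_notMem
  refine ⟨fun h => hp.1 (.inl h), hp.2.imp id fun hE => ?_⟩
  exact ⟨hE.1, hE.2.1.resolve_right h1, hE.2.2.resolve_right h2⟩

/-- The conclusion to be drawn if no atom in `X ∪ Z'` precedes `X`. -/
theorem lt_of_not_earlier (h : M.OrdPair I x₁ x₂) (hZ : M.Atom (I ∪ {x₁, x₂}) Z')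
    (h1 : M.one ∉ Z') (h2 : M.two ∉ Z') (hne : ¬ M.Earlier I {x₁, x₂} Z') (hp : p ∈ Z') :
    M.key I x₁ < M.key I p := by
  have hJ := h.mem.union_atom h.atom
  have hpJ := hJ.atom_disjoint hZ p hp
  have hpX : p ∉ ({x₁, x₂} : Set ω) := fun hx => hpJ (.inr hx)
  have hpU := hZ.subset_U hp
  by_contra hlt
  have hlt : M.key I p < M.key I x₁ := (not_lt.1 hlt).lt_of_ne fun he =>
    hpX (by rw [key_inj hpU h.free₁.mem_U he]; simp)
  have hall : ∀ x ∈ ({x₁, x₂} : Set ω), M.key I p < M.key I x := by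
    rintro x (rfl | rfl)
    exacts [hlt, hlt.trans h.lt]
  refine hne ?_
  rcases hZ.cases_noEnds h1 h2 with ⟨b, hb, hbJ, ho, ht, rfl⟩ | ⟨x, y, hxy, hx, hy, hl, rfl⟩
  · obtain rfl : p = b := hp
    have hat : M.Atom I {p} := .edge p hb (fun h => hpJ (.inl h))
      (ho.resolve_right h.one_notMem) (ht.resolve_right h.two_notMem)
    exact ⟨{p}, hat, prec_of hat.subset_U h.atom.subset_U (h.cls_eq ▸ cls_le _) rfl hpX
      fun x hx _ => hall x hx, fun z hz => .inr hz⟩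
  · have hpf : M.Free I p := h.free_of_union (by rcases hp with rfl | rfl <;> assumption)
    -- Parity gives `p` a partner in the union of `X` and `Z'`. The resulting atom starts before
    -- `x₁`, whatever the partner is.
    obtain ⟨u, huY, hup, huf, hul, hat⟩ := exists_pair_atom h.mem (hJ.union_atom hZ)
      (fun z hz => .inl (.inl hz)) (.inr hp) hpf
      ⟨fun ho => (ho.resolve_right h1).resolve_right h.one_notMem,
       fun ho => (ho.resolve_right h2).resolve_right h.two_notMem⟩
    refine ⟨{p, u}, hat, prec_of hat.subset_U h.atom.subset_U (h.cls_eq ▸ cls_le _) (by simp) hpX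
      fun x hx _ => hall x hx, ?_⟩
    rintro z (rfl | rfl)
    · exact .inr hp
    · rcases huY with (hz | hz) | hz
      exacts [absurd hz huf.1, .inl hz, .inr hz]

/-- Otherwise `{x₁, p}` would be an atom before `{x₁, x₂}`. -/
theorem lt_of_linked (h : M.OrdPair I x₁ x₂) (hne : ¬ M.Earlier I {x₁, x₂} Z') (hp : p ∈ Z')
    (hpX : p ∉ ({x₁, x₂} : Set ω)) (hpf : M.Free I p) (hl : M.Linked (I ∪ {x₁, p}) x₁ p) :
    M.key I x₂ < M.key I p := by
  simp only [Set.mem_insert_iff, Set.mem_singleton_iff, not_or] at hpX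
  by_contra hlt
  have hlt : M.key I p < M.key I x₂ := (not_lt.1 hlt).lt_of_ne fun he =>
    hpX.2 (key_inj hpf.mem_U h.free₂.mem_U he)
  have hat : M.Atom I {x₁, p} := .pair _ _ (Ne.symm hpX.1) h.free₁ hpf hl
  refine hne ⟨{x₁, p}, hat, prec_of hat.subset_U h.atom.subset_U (h.cls_eq ▸ cls_le _)
    (y := p) (by simp) (by simp [hpX]) ?_, ?_⟩
  · rintro x (rfl | rfl) hx
    · simp at hx
    · exact hlt
  · rintro z (rfl | rfl)
    exacts [.inl (by simp), .inr hp]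

/-- Only an edge can overtake, and it does so because one of `x₁`, `x₂` is an edge `e` in `A` of at
least the same rank. Then `p` is in `A` too and is linked to `x₁`. By `lt_of_linked` it comes after
`x₂`, hence after `e`, which is absurd. -/
theorem no_switch (h : M.OrdPair I x₁ x₂) (hne : ¬ M.Earlier I {x₁, x₂} Z') (hp : p ∈ Z')
    (hpJ : p ∉ I ∪ {x₁, x₂}) (hpU : p ∈ M.U) (hx₁p : M.key I x₁ < M.key I p) (hy : y ∈ M.U)
    (hyp : M.key I y < M.key I p) (hpy : M.key (I ∪ {x₁, x₂}) p ≤ M.key (I ∪ {x₁, x₂}) y) :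
    False := by
  obtain ⟨hpE, hyW, hnf, e, heJ, heE, hpe⟩ := key_switch Set.subset_union_left hy hpU hyp hpy
  have heX : e ∈ ({x₁, x₂} : Set ω) := heJ.resolve_left fun heI => hnf ⟨e, heI, heE, hpe⟩
  have hef : M.Free I e := by rcases heX with rfl | rfl; exacts [h.free₁, h.free₂]
  have heA : e ∈ M.EA := heE.resolve_right hef.notMem_EB
  have h12 : M.one ∈ I ∧ M.two ∈ I := (hef.2.resolve_left fun hW => W_EA hW heA).2
  have hpA : p ∈ M.EA := hpE.resolve_right fun hB => absurd (M.rk_EA_EB heA hB) hpe.not_gt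
  have hl := linked_edge h12.1 h12.2 h.linked
    (by rcases heX with rfl | rfl; exacts [.inl heA, .inr heA]) hpA
  have hx₂p := h.lt_of_linked hne hp (fun hx => hpJ (.inr hx))
    ⟨fun hx => hpJ (.inl hx), .inr ⟨hpA, h12⟩⟩ hl
  have : M.key I e < M.key I p := by rcases heX with rfl | rfl <;> assumption
  rw [key_E_E heE hpE] at this
  omega

/-- The letter `y` is one that the earlier atom gains, lying before all the letters that it gives
up. If it keeps `x₁`, it is `{x₁, y}`, which provides the link. -/
theorem exists_of_earlier (h : M.OrdPair I x₁ x₂) (h1 : M.one ∉ Z) (h2 : M.two ∉ Z)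
    (he : M.Earlier I {x₁, x₂} Z) :
    ∃ y ∈ Z, y ∈ M.U ∧ (M.key I y < M.key I x₁ ∨
      (M.Free I y ∧ M.Linked (I ∪ {x₁, y}) x₁ y ∧ M.key I y < M.key I x₂)) := by
  obtain ⟨Y, hY, hprec, hsub⟩ := he
  have hY1 : M.one ∉ Y := fun ho => (hsub ho).elim h.one_notMem h1
  have hY2 : M.two ∉ Y := fun ho => (hsub ho).elim h.two_notMem h2
  have hlex : M.Lex I Y {x₁, x₂} := by
    rcases hprec with hp | hp
    · rw [h.cls_eq, cls_three hY1 hY2] at hp; omega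
    · exact hp.2
  obtain ⟨y, hyY, hyX, hy⟩ := hlex.exists hY.subset_U h.atom.subset_U
  have hyZ : y ∈ Z := (hsub hyY).resolve_left hyX
  refine ⟨y, hyZ, hY.subset_U hyY, ?_⟩
  by_cases hx₁ : x₁ ∈ Y
  swap
  · exact .inl (hy x₁ (by simp) hx₁)
  simp only [Set.mem_insert_iff, Set.mem_singleton_iff, not_or] at hyX
  rcases hY.cases_noEnds hY1 hY2 with ⟨b, hb, hbJ, ho, ht, rfl⟩ | ⟨s, t, hst, hs, ht, hl, rfl⟩
  · exact absurd (hyY.trans hx₁.symm) hyX.1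
  · have hY : (s = x₁ ∧ t = y) ∨ (s = y ∧ t = x₁) := by
      simp only [Set.mem_insert_iff, Set.mem_singleton_iff] at hyY hx₁; grind
    have hx₂ : x₂ ∉ ({s, t} : Set ω) := by
      have := h.ne
      simp only [Set.mem_insert_iff, Set.mem_singleton_iff]; grind
    have hlt := hy x₂ (by simp) hx₂
    rcases hY with ⟨rfl, rfl⟩ | ⟨rfl, rfl⟩
    · exact .inr ⟨ht, hl, hlt⟩
    · exact .inr ⟨hs, by rw [Set.pair_comm]; exact hl.symm, hlt⟩

/-- Assume that `X ∪ Z'` contains no earlier atom. Then all of `Z'` lies behind `x₁`, and what is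
linked to `x₁` lies behind `x₂`. The letter `p` of `Z'`, not after `y` at `J`, cannot have overtaken
`y` (`no_switch`). So it lies between `x₁` and `y`, and `y` is before `x₂`. In each combination of
vertices and edges either `p` turns out to be linked to `x₁`, or the positions contradict each
other. -/
theorem earlier (h : M.OrdPair I x₁ x₂) (hZ : M.Atom (I ∪ {x₁, x₂}) Z)
    (hZ' : M.Atom (I ∪ {x₁, x₂}) Z') (h1 : M.one ∉ Z) (h2 : M.two ∉ Z) (h1' : M.one ∉ Z')
    (h2' : M.two ∉ Z') (he : M.Earlier I {x₁, x₂} Z) (hlex : M.Lex (I ∪ {x₁, x₂}) Z' Z) :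
    M.Earlier I {x₁, x₂} Z' := by
  by_contra hne
  have hJ := h.mem.union_atom h.atom
  obtain ⟨y, hyZ, hyU, hy⟩ := h.exists_of_earlier h1 h2 he
  obtain ⟨p, hpZ, hpy⟩ := hlex.exists_le hyZ
  have hpU := hZ'.subset_U hpZ
  have hpJ := hJ.atom_disjoint hZ' p hpZ
  have hpX : p ∉ ({x₁, x₂} : Set ω) := fun hx => hpJ (.inr hx)
  have hpI : p ∉ I := fun hx => hpJ (.inl hx)
  have hx₁p := h.lt_of_not_earlier hZ' h1' h2' hne hpZ
  have hns := h.no_switch hne hpZ hpJ hpU hx₁p hyU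
  rcases hy with hy | ⟨hyf, hyl, hyx₂⟩
  · exact hns (hy.trans hx₁p) hpy
  have hyJ := hJ.atom_disjoint hZ y hyZ
  have hlink := fun hf hl => h.lt_of_linked hne hpZ hpX hf hl
  have hpy' : p ≠ y := by
    rintro rfl
    exact hyx₂.not_gt (hlink hyf hyl)
  have hlt : M.key I p < M.key I y := by
    rcases lt_trichotomy (M.key I p) (M.key I y) with h' | h' | h'
    · exact h'
    · exact absurd (key_inj hpU hyU h') hpy'
    · exact (hns h' hpy).elim
  rcases hZ'.cases_noEnds h1' h2' with ⟨b, hb, hbJ, ho, ht, rfl⟩ | ⟨s, t, hst, hs, ht, hl, rfl⟩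
  · obtain rfl : p = b := hpZ
    have hone := ho.resolve_right h.one_notMem
    have htwo := ht.resolve_right h.two_notMem
    have hEW : ∀ {z K}, (z ∈ M.W ∨ z ∈ M.EA) → M.key K p ≤ M.key K z → z ∈ M.W := by
      intro z K hz hle
      refine hz.resolve_right fun hA => ?_
      have := (key_E_E (I := K) (.inl hA) (.inr hb)).2 (M.rk_EA_EB hA hb)
      exact absurd this hle.not_gt
    -- Among the edges those outside `A` come last, so `y`, which is behind the edge `p`, is a
    -- vertex and `p` is at the front already for `I`. Hence `x₁` is an edge in `A` and `x₂` a
    -- vertex. The component of the bundle now reaches `x₂` past the missing vertex `y`, while the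
    -- other letter of `Z` is a second missing vertex.
    have hyW : y ∈ M.W := hEW (hyf.2.imp id And.left) hlt.le
    have hpF := (key_E_W (.inr hb) hyW).1 hlt
    have hx₁A : x₁ ∈ M.EA := (h.free₁.2.resolve_left fun hW =>
      (key_W_E hW (.inr hb)).1 hx₁p hpF).1
    have hx₂W : x₂ ∈ M.W := h.free₂.2.resolve_right fun hA =>
      (key_W_E hyW (.inl hA.1)).1 hyx₂ (hpF.mono (M.rk_EA_EB hA.1 hb).le)
    have hZp : ∃ u ∈ Z, u ≠ y ∧ M.Free (I ∪ {x₁, x₂}) u := by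
      rcases hZ.cases_noEnds h1 h2 with ⟨c, hc, -, -, -, rfl⟩ | ⟨s, t, hst, hs, ht, -, rfl⟩
      · rw [Set.mem_singleton_iff.1 hyZ] at hyW
        exact absurd hc (W_EB hyW)
      · rcases hyZ with rfl | rfl
        exacts [⟨t, by simp, hst.symm, ht⟩, ⟨s, by simp, hst, hs⟩]
    obtain ⟨u, huZ, huy, huf⟩ := hZp
    obtain ⟨p', hp', hp'u⟩ := hlex.exists_le huZ
    rw [Set.mem_singleton_iff.1 hp'] at hp'u
    have huW : u ∈ M.W := hEW (huf.2.imp id And.left) hp'u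
    have hlo : M.Linked (I ∪ {x₁, x₂}) M.one x₂ :=
      (Linked.of_adj (M.adj_symm (M.adj_EA_one hx₁A)) (.inl hone) (by simp)).trans h.linked
    exact hlo.not_two_missing hJ.subset hyW hyJ (.inl rfl) hx₂W ((key_W_W hyW hx₂W).1 hyx₂) huW
      huf.1 huy
  · have hpf : M.Free I p := h.free_of_union (by rcases hpZ with rfl | rfl <;> assumption)
    have hnl : ¬ M.Linked (I ∪ {x₁, p}) x₁ p := fun hl =>
      (hlt.trans hyx₂).not_gt (hlink hpf hl)
    have hx₁ : x₁ ∈ M.W ∨ x₁ ∈ M.EA := h.free₁.2.imp id And.left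
    rcases hyf.2 with hyW | ⟨hyA, hone, htwo⟩
    · rcases hpf.2 with hpW | ⟨hpA, hone, htwo⟩
      · refine hnl ?_
        have hs : ∀ z, I ∪ {x₁, z} = I ∪ {x₁} ∪ {z} := fun z => by ext; simp; tauto
        rw [hs] at hyl ⊢
        refine hyl.of_lt (Set.union_subset h.mem.subset (by simpa using h.free₁.mem_U)) hpW
          ?_ ?_ hyW ((key_W_W hpW hyW).1 hlt)
        · rintro (hx | hx)
          exacts [hpI hx, hpX (by simp [Set.mem_singleton_iff.1 hx])]
        · rcases hx₁ with hW | hA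
          exacts [.inr ((key_W_W hW hpW).1 hx₁p), .inl hA]
      · rcases hx₁ with hW | hA
        · exact (key_W_E hW (.inl hpA)).1 hx₁p ((key_E_W (.inl hpA) hyW).1 hlt)
        · exact hnl (linked_edge hone htwo h.linked (.inl hA) hpA)
    · rcases hpf.2 with hpW | ⟨hpA, -, -⟩
      · have hyF := (key_W_E hpW (.inl hyA)).1 hlt
        have hx₂A : x₂ ∈ M.EA := (h.free₂.2.resolve_left fun hW =>
          hyF ((key_E_W (.inl hyA) hW).1 hyx₂)).1
        have : M.Front (I ∪ {x₁, x₂}) y :=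
          ⟨x₂, by simp, .inl hx₂A, ((key_E_E (.inl hyA) (.inl hx₂A)).1 hyx₂).le⟩
        exact hpy.not_gt ((key_E_W (.inl hyA) hpW).2 this)
      · exact hnl (linked_edge hone htwo hyl (.inr hyA) hpA)

end OrdPair

/-- The case of a single edge outside `A`. -/
theorem earlier_of_edge {b : ω} (hI : M.Mem I) (hb : b ∈ M.EB) (hbI : b ∉ I) (ho : M.one ∈ I)
    (ht : M.two ∈ I) (hZ' : M.Atom (I ∪ {b}) Z')
    (he : M.Earlier I {b} Z) (hlex : M.Lex (I ∪ {b}) Z' Z) : M.Earlier I {b} Z' := by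
  have hX : M.Atom I {b} := .edge b hb hbI ho ht
  have hJ := hI.union_atom hX
  have hends : ∀ {J S}, M.Mem J → I ⊆ J → M.Atom J S → M.one ∉ S ∧ M.two ∉ S := fun hJ hIJ hS =>
    ⟨fun h => hJ.atom_disjoint hS _ h (hIJ ho), fun h => hJ.atom_disjoint hS _ h (hIJ ht)⟩
  have hc3 : ∀ {S}, M.one ∉ S ∧ M.two ∉ S → M.cls S = 3 := fun h => cls_three h.1 h.2
  -- An edge outside `A` is isolated, so adding it creates no new links. It remains to see that `Z'`
  -- starts before `b`.
  have hZat : M.Atom I Z' := by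
    obtain ⟨h1, h2⟩ := hends hJ Set.subset_union_left hZ'
    rcases hZ'.cases_noEnds h1 h2 with ⟨c, hc, hcJ, -, -, rfl⟩ | ⟨s, t, hst, hs, ht', hl, rfl⟩
    · exact .edge c hc (fun h => hcJ (.inl h)) ho ht
    · have hf : ∀ {z}, M.Free (I ∪ {b}) z → M.Free I z := fun hz =>
        ⟨fun h => hz.1 (.inl h), hz.2.imp id fun h => ⟨h.1, ho, ht⟩⟩
      refine .pair s t hst (hf hs) (hf ht') (hl.drop_edges ?_ (by simp) (by simp)
        (.inr ⟨.inl ho, .inl ht⟩))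
      rintro z ((hz | rfl) | hz) hz'
      exacts [absurd (.inl hz) hz', .inr hb, absurd (.inr hz) hz']
  obtain ⟨Y, hY, hprec, hsub⟩ := he
  have hlexY : M.Lex I Y {b} := by
    rcases hprec with hp | hp
    · rw [hc3 (hends hI subset_rfl hX), hc3 (hends hI subset_rfl hY)] at hp; omega
    · exact hp.2
  obtain ⟨y, hyY, hyX, hy⟩ := hlexY.exists hY.subset_U hX.subset_U
  have hbY : b ∉ Y := fun hbY => hyX (by
    rw [← hX.eq_of_subset hY (by simpa using hbY)] at hyY; exact hyY)
  have hyb := hy b rfl hbY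
  obtain ⟨p, hpZ, hpy⟩ := hlex.exists_le ((hsub hyY).resolve_left hyX)
  have hpJ := hJ.atom_disjoint hZ' p hpZ
  have hpU := hZ'.subset_U hpZ
  have hbU := hX.subset_U rfl
  have hpb : p ≠ b := fun h => hpJ (.inr h)
  have hlt : M.key I p < M.key I b := by
    rcases lt_trichotomy (M.key I p) (M.key I b) with h' | h' | h'
    · exact h'
    · exact absurd (key_inj hpU hbU h') hpb
    · obtain ⟨hpE, hyW, hnf, e, heJ, heE, hpe⟩ :=
        key_switch Set.subset_union_left (hY.subset_U hyY) hpU (hyb.trans h') hpy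
      have : e = b := heJ.resolve_left fun heI => hnf ⟨e, heI, heE, hpe⟩
      rw [key_E_E (.inr hb) hpE] at h'
      subst this; omega
  refine ⟨Z', hZat, prec_of hZat.subset_U hX.subset_U
    (by rw [hc3 (hends hI subset_rfl hX)]; exact cls_le _) hpZ hpb ?_, Set.subset_union_right⟩
  rintro x rfl -
  exact hlt

end pairs

end EvenModel

namespace EvenModel

variable {ω : Type*} {M : EvenModel ω} {I X Y Z Z' : Set ω}

theorem exists_ordPair (hI : M.Mem I) {x y : ω} (hxy : x ≠ y) (hx : M.Free I x)
    (hy : M.Free I y) (h : M.Linked (I ∪ {x, y}) x y) :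
    ∃ x₁ x₂, M.OrdPair I x₁ x₂ ∧ ({x, y} : Set ω) = {x₁, x₂} := by
  rcases lt_trichotomy (M.key I x) (M.key I y) with h' | h' | h'
  · exact ⟨x, y, ⟨hI, hx, hy, h, h'⟩, rfl⟩
  · exact absurd (key_inj hx.mem_U hy.mem_U h') hxy
  · exact ⟨y, x, ⟨hI, hy, hx, by rw [Set.pair_comm]; exact h.symm, h'⟩, Set.pair_comm _ _⟩

theorem Mem.ends_disjoint (hI : M.Mem I) (hX : M.Atom I X) :
    (M.one ∈ I → M.one ∉ X) ∧ (M.two ∈ I → M.two ∉ X) :=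
  ⟨fun h h' => hI.atom_disjoint hX _ h' h, fun h h' => hI.atom_disjoint hX _ h' h⟩

theorem subset_of_atom (hI : M.Mem I) (hY : M.Atom I Y) (h : Y ⊆ I ∪ X ∪ Z) : Y ⊆ X ∪ Z :=
  fun z hz => by
    rcases h hz with (hzI | hzX) | hzZ
    exacts [absurd hzI (hI.atom_disjoint hY z hz), .inl hzX, .inr hzZ]

/-- If an end of the bundle is available, then it belongs to an atom. -/
theorem exists_atom_with_end (hI : M.Mem I) (hY : M.Mem Y) (hIY : I ⊆ Y)
    (h : (M.one ∈ Y ∧ M.one ∉ I) ∨ (M.two ∈ Y ∧ M.two ∉ I)) :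
    ∃ X, M.Atom I X ∧ X ⊆ Y ∧ M.cls X < 3 := by
  rcases ends_cases (M := M) I with ⟨h1, h2⟩ | ⟨h1, h2⟩ | ⟨w, w', hw, hwI, hwI'⟩
  · tauto
  · rcases h with h | h
    · obtain ⟨X, hX, hXY, he⟩ := exists_atom_of_end hI hY hIY h1 h2 ends_one_two.symm h.1
      exact ⟨X, hX, hXY, cls_lt_three he⟩
    · obtain ⟨X, hX, hXY, he⟩ := exists_atom_of_end hI hY hIY h1 h2 ends_one_two h.1
      exact ⟨X, hX, hXY, cls_lt_three he⟩
  · have hw'Y : w' ∈ Y := by rcases hw with ⟨rfl, rfl⟩ | ⟨rfl, rfl⟩ <;> tauto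
    obtain ⟨X, hX, hXY, he⟩ := exists_atom_of_other_end hI hY hIY hw hwI hwI' hw'Y
    exact ⟨X, hX, hXY, cls_lt_three (by rcases hw with ⟨rfl, rfl⟩ | ⟨rfl, rfl⟩ <;> tauto)⟩

theorem noEnds_of_cls (h : M.cls X = 3) : M.one ∉ X ∧ M.two ∉ X := by
  constructor <;> intro h' <;> exact absurd h (cls_lt_three (by tauto)).ne

theorem Prec.lex_of_three (h : M.Prec I X Y) (hX : M.cls X = 3) : M.cls Y = 3 ∧ M.Lex I X Y := by
  have := cls_le (M := M) Y
  rcases h with h | h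
  · omega
  · exact ⟨h.1 ▸ hX, h.2⟩

/-- If `Z'` brings an end of the bundle, then `X ∪ Z'` contains an atom with an end, and such an
atom precedes `X`. Otherwise neither `Z'` nor `Z` has an end, and the comparison is purely
lexicographic. -/
theorem OrdPair.earlier_of_prec {x₁ x₂ : ω} (h : M.OrdPair I x₁ x₂)
    (hZ : M.Atom (I ∪ {x₁, x₂}) Z) (hZ' : M.Atom (I ∪ {x₁, x₂}) Z')
    (he : M.Earlier I {x₁, x₂} Z) (hp : M.Prec (I ∪ {x₁, x₂}) Z' Z) :
    M.Earlier I {x₁, x₂} Z' := by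
  have hJ := h.mem.union_atom h.atom
  by_cases hend : M.one ∈ Z' ∨ M.two ∈ Z'
  · have hdis := hJ.ends_disjoint hZ'
    obtain ⟨Y, hY, hYs, hc⟩ := exists_atom_with_end h.mem (hJ.union_atom hZ')
      (fun z hz => .inl (.inl hz)) (by
        rcases hend with h' | h'
        · exact .inl ⟨.inr h', fun hI => hdis.1 (.inl hI) h'⟩
        · exact .inr ⟨.inr h', fun hI => hdis.2 (.inl hI) h'⟩)
    exact ⟨Y, hY, .inl (h.cls_eq ▸ hc), subset_of_atom h.mem hY hYs⟩
  · rw [not_or] at hend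
    obtain ⟨hc, hlex⟩ := hp.lex_of_three (cls_three hend.1 hend.2)
    obtain ⟨h1, h2⟩ := noEnds_of_cls hc
    exact h.earlier hZ hZ' h1 h2 hend.1 hend.2 he hlex

/-! ### Letters at the front when both ends are present -/

section both

variable {J : Set ω}

/-- What precedes an edge at the front is another edge. -/
theorem edge_of_le_front {p e : ω} (hp : p ∈ M.W ∨ p ∈ M.EA ∨ p ∈ M.EB) (he : e ∈ M.EA ∪ M.EB)
    (hf : M.Front J e) (hle : M.key J p ≤ M.key J e) :
    p ∈ M.EA ∪ M.EB ∧ M.rk p ≤ M.rk e := by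
  have hpE : p ∈ M.EA ∪ M.EB := hp.resolve_left fun hW =>
    absurd ((key_E_W he hW).2 hf) hle.not_gt
  exact ⟨hpE, not_lt.1 fun h => absurd ((key_E_E he hpE).2 h) hle.not_gt⟩

/-- What precedes a vertex adjacent to the component of the bundle is another such vertex or an
edge at the front. -/
theorem linked_of_le {S : Set ω} {p y e : ω} (hp : p ∈ M.W ∨ p ∈ M.EA ∨ p ∈ M.EB) (hpS : p ∉ S)
    (hS : S ⊆ M.U) (hy : y ∈ M.W) (he : e = M.one ∨ e = M.two)
    (hl : M.Linked (S ∪ {y}) e y) (hle : M.key J p ≤ M.key J y) :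
    (p ∈ M.W ∧ M.rk p ≤ M.rk y ∧ M.Linked (S ∪ {p}) e p) ∨
      (p ∈ M.EA ∪ M.EB ∧ M.Front J p) := by
  rcases hp with hp | hp
  · refine .inl ⟨hp, ?_⟩
    have hrk : M.rk p ≤ M.rk y := not_lt.1 fun h => absurd ((key_W_W hy hp).2 h) hle.not_gt
    refine ⟨hrk, ?_⟩
    rcases hrk.lt_or_eq with hlt | heq
    · refine hl.of_lt hS hp hpS (.inr ?_) hy hlt
      have := M.rk_two_W hp
      have := M.rk_one_two
      rcases he with rfl | rfl <;> omega
    · rwa [rk_injOn (mem_U.2 (by tauto)) (mem_U.2 (by tauto)) heq]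
  · refine .inr ⟨hp, by_contra fun hf => ?_⟩
    exact absurd ((key_W_E hy hp).2 hf) hle.not_gt

theorem Mem.atom_kinds (hJ : M.Mem J) (h1 : M.one ∈ J) (h2 : M.two ∈ J) (hZ : M.Atom J Z) {p : ω}
    (hp : p ∈ Z) : p ∈ M.W ∨ p ∈ M.EA ∨ p ∈ M.EB := by
  have hpJ := hJ.atom_disjoint hZ p hp
  rcases mem_U.1 (hZ.subset_U hp) with rfl | rfl | h
  exacts [absurd h1 hpJ, absurd h2 hpJ, h]

theorem lex_of_both {J : Set ω} (hJ : M.Mem J) (h1 : M.one ∈ J) (h2 : M.two ∈ J)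
    (hZ' : M.Atom J Z') (hp : M.Prec J Z' Z) : M.Lex J Z' Z :=
  have hd := hJ.ends_disjoint hZ'
  (hp.lex_of_three (cls_three (hd.1 h1) (hd.2 h2))).2

end both

/-! ### Earlier atoms come first: atoms that add the second end -/

section one

variable {w w' : ω}

/-- The atom `{w', a}`. -/
theorem earlier_endEdge {a : ω} (hI : M.Mem I) (hw : M.Ends w w') (hwI : w ∈ I) (hwI' : w' ∉ I)
    (hA : w' ∈ M.A) (ha : a ∈ M.EA) (hZ' : M.Atom (I ∪ {w', a}) Z')
    (he : M.Earlier I {w', a} Z) (hp : M.Prec (I ∪ {w', a}) Z' Z) :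
    M.Earlier I {w', a} Z' := by
  have hX : M.Atom I {w', a} := .endEdge w w' a hw hwI hwI' hA ha
  have hJ := hI.union_atom hX
  have h12 : M.one ∈ I ∪ {w', a} ∧ M.two ∈ I ∪ {w', a} := hw.iff.2 ⟨.inl hwI, by simp⟩
  have hlex := lex_of_both hJ h12.1 h12.2 hZ' hp
  have hcX : M.cls {w', a} = 0 := cls_zero hw
    (by simp [hw.ne]; rintro rfl; exact hw.notMem_EA ha) (by simp) (by
      rintro b hb (rfl | rfl)
      exacts [hw.symm.notMem_EB hb, EA_EB ha hb])
  have hwa : ∀ {a}, a ∈ M.EA → a ≠ w' := fun ha h => hw.symm.notMem_EA (h ▸ ha)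
  obtain ⟨Y, hY, hprec, hsub⟩ := he
  have hYw : w ∉ Y := fun h => hI.atom_disjoint hY _ h hwI
  obtain ⟨hcY, hlexY⟩ : M.cls Y = 0 ∧ M.Lex I Y {w', a} := by
    rcases hprec with h | h
    · omega
    · exact ⟨h.1.trans hcX, h.2⟩
  obtain ⟨y, hyY, hyX, hy⟩ := hlexY.exists hY.subset_U hX.subset_U
  have hyZ := (hsub hyY).resolve_left hyX
  simp only [Set.mem_insert_iff, Set.mem_singleton_iff, not_or] at hyX
  rcases hY.cases_one hw hwI hwI' with ⟨s, t, hst, hs, ht, -, rfl⟩ |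
      ⟨-, ⟨a', ha', rfl⟩ | ⟨b, hb, v, hv, hvI, -, rfl⟩⟩ | ⟨hA', -⟩
  · rw [cls_three (by simp [hs.ne_one.symm, ht.ne_one.symm])
      (by simp [hs.ne_two.symm, ht.ne_two.symm])] at hcY
    omega
  · obtain rfl : y = a' := by
      rcases hyY with h | h
      exacts [absurd h hyX.1, h]
    have hlt := (key_E_E (.inl ha') (.inl ha)).1
      (hy a (by simp) (by simp [hwa ha, Ne.symm hyX.2]))
    obtain ⟨p, hpZ, hpy⟩ := hlex.exists_le hyZ
    -- The edge `a`, now present, keeps all lower edges at the front. So `p` is an edge in `A` below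
    -- `a` and can replace it.
    obtain ⟨hpE, hprk⟩ := edge_of_le_front (hJ.atom_kinds h12.1 h12.2 hZ' hpZ) (.inl ha')
      ⟨a, by simp, .inl ha, hlt.le⟩ hpy
    have hpA : p ∈ M.EA := hpE.resolve_right fun h => absurd (M.rk_EA_EB ha' h) hprk.not_gt
    have hat : M.Atom I {w', p} := .endEdge w w' p hw hwI hwI' hA hpA
    have hpa : p ≠ a := by rintro rfl; omega
    refine ⟨_, hat, prec_of hat.subset_U hX.subset_U ?_ (y := p) (by simp)
      (by simp [hpa, hwa hpA]) ?_, by rintro z (rfl | rfl); exacts [.inl (by simp), .inr hpZ]⟩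
    · rw [cls_zero (X := {w', p}) hw (by simp [hw.ne]; rintro rfl; exact hw.notMem_EA hpA)
        (by simp) (by
        rintro b hb (rfl | rfl)
        exacts [hw.symm.notMem_EB hb, EA_EB hpA hb])]
      exact Nat.zero_le _
    · rintro x (rfl | rfl) hx
      · simp at hx
      · exact (key_E_E (.inl hpA) (.inl ha)).2 (by omega)
  · rw [cls_one hw hYw (by simp) ⟨b, hb, by simp⟩] at hcY
    omega
  · exact absurd hA hA'

/-- The atom `{w', b, v}`. -/
theorem earlier_endEdgeVertex {b v : ω} (hI : M.Mem I) (hw : M.Ends w w') (hwI : w ∈ I)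
    (hwI' : w' ∉ I) (hA : w' ∈ M.A) (hb : b ∈ M.EB) (hv : v ∈ M.W) (hvI : v ∉ I)
    (hl : M.Linked (I ∪ {w', v}) w' v) (hZ : M.Atom (I ∪ {w', b, v}) Z)
    (hZ' : M.Atom (I ∪ {w', b, v}) Z')
    (he : M.Earlier I {w', b, v} Z) (hp : M.Prec (I ∪ {w', b, v}) Z' Z) :
    M.Earlier I {w', b, v} Z' := by
  by_contra hne
  have hX : M.Atom I {w', b, v} := .endEdgeVertex w w' b v hw hwI hwI' hA hb hv hvI hl
  have hJ := hI.union_atom hX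
  have h12 : M.one ∈ I ∪ {w', b, v} ∧ M.two ∈ I ∪ {w', b, v} := hw.iff.2 ⟨.inl hwI, by simp⟩
  have hlex := lex_of_both hJ h12.1 h12.2 hZ' hp
  have hcX : M.cls {w', b, v} = 1 :=
    cls_one hw (fun h => hI.atom_disjoint hX _ h hwI) (by simp) ⟨b, hb, by simp⟩
  -- An edge in `A` would form with `w'` an atom of class 0, and `X` has class 1.
  have noA : ∀ p ∈ Z', p ∉ M.EA := fun p hpZ hpA => hne (by
    have hat : M.Atom I {w', p} := .endEdge w w' p hw hwI hwI' hA hpA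
    refine ⟨_, hat, .inl ?_, by rintro z (rfl | rfl); exacts [.inl (by simp), .inr hpZ]⟩
    rw [hcX, cls_zero (X := {w', p}) hw (fun h => hI.atom_disjoint hat _ h hwI) (by simp) (by
        rintro b hb (rfl | rfl)
        exacts [hw.symm.notMem_EB hb, EA_EB hpA hb])]
    exact Nat.zero_lt_one)
  -- Since `b` is present, all edges below it are at the front, and `Z'` must answer any of them in
  -- `Z` with an edge of no higher rank, necessarily outside `A`.
  have noF : ∀ e ∈ Z, e ∈ M.EA ∪ M.EB → M.rk e < M.rk b →
      ∃ p ∈ Z', p ∈ M.EB ∧ M.rk p ≤ M.rk e := fun e heZ heE hrk => by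
    obtain ⟨p, hpZ, hpe⟩ := hlex.exists_le heZ
    obtain ⟨hpE, hprk⟩ := edge_of_le_front (hJ.atom_kinds h12.1 h12.2 hZ' hpZ) heE
      ⟨b, by simp, .inr hb, hrk.le⟩ hpe
    exact ⟨p, hpZ, hpE.resolve_left (noA p hpZ), hprk⟩
  have noA' : ∀ p ∈ Z, p ∉ M.EA := fun p hpZ hpA => by
    obtain ⟨q, hqZ, hqB, hq⟩ := noF p hpZ (.inl hpA) (M.rk_EA_EB hpA hb)
    exact absurd (M.rk_EA_EB hpA hqB) hq.not_gt
  have noE : ∀ e, e ∈ M.EA ∪ M.EB → ¬ M.Front I e := fun e _ ⟨f, hf, hfE, _⟩ =>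
    hI.notMem_of_ends hw hwI' hfE hf
  obtain ⟨Y, hY, hprec, hsub⟩ := he
  have hYw : w ∉ Y := fun h => hI.atom_disjoint hY _ h hwI
  rcases hY.cases_one hw hwI hwI' with ⟨s, t, hst, hs, ht, -, rfl⟩ |
      ⟨-, ⟨a', ha', rfl⟩ | ⟨b', hb', v', hv', hvI', hl', rfl⟩⟩ | ⟨hA', -⟩
  · have h3 : M.cls {s, t} = 3 := cls_three (by simp [hs.ne_one.symm, ht.ne_one.symm])
      (by simp [hs.ne_two.symm, ht.ne_two.symm])
    rcases hprec with h | h <;> omega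
  · refine noA' a' ((hsub (by simp)).resolve_left ?_) ha'
    rintro (rfl | rfl | rfl)
    exacts [hw.symm.notMem_EA ha', EA_EB ha' hb, W_EA hv ha']
  · have hlexY : M.Lex I {w', b', v'} {w', b, v} := by
      rcases hprec with h | h
      · rw [hcX, cls_one hw hYw (by simp) ⟨b', hb', by simp⟩] at h; omega
      · exact h.2
    obtain ⟨y, hyY, hyX, hy⟩ := hlexY.exists hY.subset_U hX.subset_U
    have hyZ := (hsub hyY).resolve_left hyX
    have hbv : ∀ {b v}, b ∈ M.EB → v ∈ M.W → b ≠ v := fun hb hv h => W_EB hv (h ▸ hb)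
    have hwb : ∀ {b}, b ∈ M.EB → b ≠ w' := fun hb h => hw.symm.notMem_EB (h ▸ hb)
    have hwv : ∀ {v}, v ∈ M.W → v ≠ w' := fun hv h => hw.symm.notMem_W (h ▸ hv)
    simp only [Set.mem_insert_iff, Set.mem_singleton_iff, not_or] at hyX hyY
    by_cases hvv : v' = v
    · subst hvv
      have hyb : y = b' := by tauto
      subst hyb
      have hlt := (key_E_E (.inr hb') (.inr hb)).1 (hy b (by simp)
        (by simp [hwb hb, Ne.symm hyX.2.1, hbv hb hv]))
      obtain ⟨p, hpZ, hpB, hprk⟩ := noF y hyZ (.inr hb') hlt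
      have hat : M.Atom I {w', p, v'} := .endEdgeVertex w w' p v' hw hwI hwI' hA hpB hv hvI hl
      have hpb : p ≠ b := by rintro rfl; omega
      refine hne ⟨_, hat, prec_of hat.subset_U hX.subset_U ?_ (y := p) (by simp)
        (by simp [hpb, hwb hpB, hbv hpB hv]) ?_, ?_⟩
      · rw [hcX, cls_one hw (fun h => hI.atom_disjoint hat _ h hwI) (by simp) ⟨p, hpB, by simp⟩]
      · rintro x (rfl | rfl | rfl) hx
        · simp at hx
        · exact (key_E_E (.inr hpB) (.inr hb)).2 (by omega)
        · simp at hx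
      · rintro z (rfl | rfl | rfl)
        exacts [.inl (by simp), .inr hpZ, .inl (by simp)]
    · have hlt := hy v (by simp) (by simp [hwv hv, Ne.symm hvv, (hbv hb' hv).symm])
      have hyv : y = v' := by
        rcases hyY with h | rfl | h
        · exact absurd h hyX.1
        · exact absurd ((key_E_W (.inr hb') hv).1 hlt) (noE _ (.inr hb'))
        · exact h
      subst hyv
      rw [key_W_W hv' hv] at hlt
      -- As `I` contains no edges, the gained letter is the vertex `y`, lower than `v`. Then `Z`
      -- consists of `y` and another missing vertex, although `w'` is linked to `v` past `y`.
      have hJZ := hJ.ends_disjoint hZ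
      rcases hZ.cases_noEnds (hJZ.1 h12.1) (hJZ.2 h12.2) with
        ⟨c, hc, -, -, -, rfl⟩ | ⟨s, t, hst, hs, ht, -, rfl⟩
      · exact hbv hc hv' (Set.mem_singleton_iff.1 hyZ).symm
      · obtain ⟨u, huZ, huy, huf⟩ : ∃ u ∈ ({s, t} : Set ω), u ≠ y ∧
            M.Free (I ∪ {w', b, v}) u := by
          rcases hyZ with rfl | rfl
          exacts [⟨t, by simp, hst.symm, ht⟩, ⟨s, by simp, hst, hs⟩]
        have huW : u ∈ M.W := huf.2.resolve_right fun h => noA' u huZ h.1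
        have hS : I ∪ {w', v} ⊆ I ∪ {w', b, v} := by intro z; simp; tauto
        refine hl.not_two_missing (hS.trans hJ.subset) hv' (fun h => ?_) ?_ hv hlt huW
          (fun h => huf.1 (hS h)) huy
        · exact hJ.atom_disjoint hZ y hyZ (hS h)
        · rcases hw with ⟨rfl, rfl⟩ | ⟨rfl, rfl⟩ <;> simp
  · exact absurd hA hA'

/-- Omitting edges from the path from `w'` to `u`. -/
theorem linked_of_edge_pair {a u : ω} (hw : M.Ends w w') (hwI : w ∈ I) (ha : a ∈ M.EA)
    (hX : ∀ x ∈ X, x = w' ∨ x ∈ M.EA ∪ M.EB) (hwX : w' ∈ X)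
    (hl : M.Linked (I ∪ X ∪ {a, u}) a u) : M.Linked (I ∪ {w', u}) w' u := by
  have h12 : M.one ∈ I ∪ {w', u} ∧ M.two ∈ I ∪ {w', u} := hw.iff.2 ⟨.inl hwI, by simp⟩
  refine Linked.drop_edges (S := I ∪ X ∪ {a, u}) ?_ ?_ (by simp) (by simp) (.inr h12)
  · exact (Linked.of_adj (hw.symm.adj_EA ha) (.inl (.inr hwX)) (by simp)).trans hl
  · rintro z ((hz | hz) | rfl | rfl) hz'
    · exact absurd (.inl hz) hz'
    · rcases hX z hz with rfl | h
      exacts [absurd (by simp) hz', h]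
    · exact .inl ha
    · exact absurd (by simp) hz'

/-- The atom `{w', b}`. -/
theorem earlier_endFreeEdge {b : ω} (hI : M.Mem I) (hw : M.Ends w w') (hwI : w ∈ I)
    (hwI' : w' ∉ I) (hA : w' ∉ M.A) (hb : b ∈ M.EB) (hZ' : M.Atom (I ∪ {w', b}) Z')
    (he : M.Earlier I {w', b} Z) (hp : M.Prec (I ∪ {w', b}) Z' Z) :
    M.Earlier I {w', b} Z' := by
  by_contra hne
  have hX : M.Atom I {w', b} := .endFreeEdge w w' b hw hwI hwI' hA hb
  have hJ := hI.union_atom hX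
  have h12 : M.one ∈ I ∪ {w', b} ∧ M.two ∈ I ∪ {w', b} := hw.iff.2 ⟨.inl hwI, by simp⟩
  have hlex := lex_of_both hJ h12.1 h12.2 hZ' hp
  have hcX : M.cls {w', b} = 1 :=
    cls_one hw (fun h => hI.atom_disjoint hX _ h hwI) (by simp) ⟨b, hb, by simp⟩
  -- An edge in `A` and its partner in `Z'` would form with `w'` an atom of class 0.
  have noA : ∀ p ∈ Z', p ∉ M.EA := fun p hpZ hpA => hne (by
    have hJZ := hJ.ends_disjoint hZ'
    rcases hZ'.cases_noEnds (hJZ.1 h12.1) (hJZ.2 h12.2) with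
        ⟨c, hc, -, -, -, rfl⟩ | ⟨s, t, hst, hs, ht, hl, rfl⟩
    · exact absurd hc (EA_EB (Set.mem_singleton_iff.1 hpZ ▸ hpA))
    · obtain ⟨u, huZ, hup, huf, hl⟩ : ∃ u ∈ ({s, t} : Set ω), u ≠ p ∧
            M.Free (I ∪ {w', b}) u ∧ M.Linked (I ∪ {w', b} ∪ {p, u}) p u := by
        rcases hpZ with rfl | rfl
        · exact ⟨t, by simp, hst.symm, ht, hl⟩
        · exact ⟨s, by simp, hst, hs, by rw [Set.pair_comm p s]; exact hl.symm⟩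
      have hul : M.Linked (I ∪ {w', u}) w' u := linked_of_edge_pair hw hwI hpA
        (by rintro x (rfl | rfl); exacts [.inl rfl, .inr (.inr hb)]) (by simp) hl
      have hat : M.Atom I {w', p, u} := .endPair w w' p u hw hwI hwI' hA hpA
        (huf.2.imp id And.left) (fun h => huf.1 (.inl h)) hup.symm hul
      refine ⟨_, hat, .inl ?_, by
        rintro z (rfl | rfl | rfl); exacts [.inl (by simp), .inr hpZ, .inr huZ]⟩
      rw [hcX, cls_zero (X := {w', p, u}) hw (fun h => hI.atom_disjoint hat _ h hwI) (by simp) (by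
        rintro b hb (rfl | rfl | rfl)
        exacts [hw.symm.notMem_EB hb, EA_EB hpA hb, huf.notMem_EB hb])]
      exact Nat.zero_lt_one)
  have noF : ∀ e ∈ Z, e ∈ M.EA ∪ M.EB → M.rk e < M.rk b →
      ∃ p ∈ Z', p ∈ M.EB ∧ M.rk p ≤ M.rk e := fun e heZ heE hrk => by
    obtain ⟨p, hpZ, hpe⟩ := hlex.exists_le heZ
    obtain ⟨hpE, hprk⟩ := edge_of_le_front (hJ.atom_kinds h12.1 h12.2 hZ' hpZ) heE
      ⟨b, by simp, .inr hb, hrk.le⟩ hpe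
    exact ⟨p, hpZ, hpE.resolve_left (noA p hpZ), hprk⟩
  obtain ⟨Y, hY, hprec, hsub⟩ := he
  have hYw : w ∉ Y := fun h => hI.atom_disjoint hY _ h hwI
  have hwb : ∀ {b}, b ∈ M.EB → b ≠ w' := fun hb h => hw.symm.notMem_EB (h ▸ hb)
  rcases hY.cases_one hw hwI hwI' with ⟨s, t, hst, hs, ht, -, rfl⟩ | ⟨hA', -⟩ |
      ⟨-, ⟨b', hb', rfl⟩ | ⟨a, ha, y, hy, hyI, hay, hl, rfl⟩⟩
  · have h3 : M.cls {s, t} = 3 := cls_three (by simp [hs.ne_one.symm, ht.ne_one.symm])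
      (by simp [hs.ne_two.symm, ht.ne_two.symm])
    rcases hprec with h | h <;> omega
  · exact absurd hA' hA
  · have hlexY : M.Lex I {w', b'} {w', b} := by
      rcases hprec with h | h
      · rw [hcX, cls_one hw hYw (by simp) ⟨b', hb', by simp⟩] at h; omega
      · exact h.2
    obtain ⟨y, hyY, hyX, hy⟩ := hlexY.exists hY.subset_U hX.subset_U
    have hyZ := (hsub hyY).resolve_left hyX
    simp only [Set.mem_insert_iff, Set.mem_singleton_iff, not_or] at hyX hyY
    obtain rfl : y = b' := hyY.resolve_left hyX.1
    have hlt := (key_E_E (.inr hb') (.inr hb)).1 (hy b (by simp)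
        (by simp [hwb hb, Ne.symm hyX.2]))
    obtain ⟨p, hpZ, hpB, hprk⟩ := noF y hyZ (.inr hb') hlt
    have hat : M.Atom I {w', p} := .endFreeEdge w w' p hw hwI hwI' hA hpB
    have hpb : p ≠ b := by rintro rfl; omega
    refine hne ⟨_, hat, prec_of hat.subset_U hX.subset_U ?_ (y := p) (by simp)
        (by simp [hpb, hwb hpB]) ?_, ?_⟩
    · rw [hcX, cls_one hw (fun h => hI.atom_disjoint hat _ h hwI) (by simp) ⟨p, hpB, by simp⟩]
    · rintro x (rfl | rfl) hx
      · simp at hx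
      · exact (key_E_E (.inr hpB) (.inr hb)).2 (by omega)
    · rintro z (rfl | rfl)
      exacts [.inl (by simp), .inr hpZ]
  · have haZ : a ∈ Z := (hsub (by simp)).resolve_left (by
      rintro (rfl | rfl)
      exacts [hw.symm.notMem_EA ha, EA_EB ha hb])
    obtain ⟨q, hqZ, hqB, hq⟩ := noF a haZ (.inl ha) (M.rk_EA_EB ha hb)
    exact absurd (M.rk_EA_EB ha hqB) hq.not_gt

end one

end EvenModel

namespace EvenModel

variable {ω : Type*} {M : EvenModel ω} {I X Y Z Z' : Set ω}

section one

variable {w w' : ω}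

theorem Mem.not_front (hI : M.Mem I) (hw : M.Ends w w') (hwI' : w' ∉ I) (e : ω) :
    ¬ M.Front I e := fun ⟨_, hf, hfE, _⟩ => hI.notMem_of_ends hw hwI' hfE hf

theorem linked_end_edge {a : ω} (hw : M.Ends w w') (ha : a ∈ M.EA) :
    M.Linked (I ∪ {w', a}) w' a := .of_adj (hw.symm.adj_EA ha) (by simp) (by simp)

theorem cls_endPair {a y : ω} (hI : M.Mem I) (hw : M.Ends w w') (hwI : w ∈ I) (ha : a ∈ M.EA)
    (hy : y ∈ M.W ∪ M.EA) (hat : M.Atom I {w', a, y}) : M.cls {w', a, y} = 0 :=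
  cls_zero hw (fun h => hI.atom_disjoint hat _ h hwI) (by simp) (by
    rintro b hb (rfl | rfl | rfl)
    exacts [hw.symm.notMem_EB hb, EA_EB ha hb, hy.elim (fun h => W_EB h hb) (fun h => EA_EB h hb)])

/-- The atoms that precede `{w', a, y₀}`. -/
theorem exists_of_earlier_endPair {a y₀ : ω} (hI : M.Mem I) (hw : M.Ends w w') (hwI : w ∈ I)
    (hwI' : w' ∉ I) (hA : w' ∉ M.A) (ha : a ∈ M.EA) (hy₀ : y₀ ∈ M.W ∪ M.EA)
    (hX : M.Atom I {w', a, y₀}) (he : M.Earlier I {w', a, y₀} Z) :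
    ∃ c ∈ M.EA, ∃ y' ∈ M.W ∪ M.EA, ∃ y ∈ Z, (y = c ∨ y = y') ∧
      M.Linked (I ∪ {w', y}) w' y ∧ y ∉ ({w', a, y₀} : Set ω) ∧
      (∀ x ∈ ({w', a, y₀} : Set ω), x ∉ ({w', c, y'} : Set ω) → M.key I y < M.key I x) ∧
      ¬ (a ∈ ({w', c, y'} : Set ω) ∧ y₀ ∈ ({w', c, y'} : Set ω)) := by
  have hcX := cls_endPair hI hw hwI ha hy₀ hX
  obtain ⟨Y, hY, hprec, hsub⟩ := he
  have hYw : w ∉ Y := fun h => hI.atom_disjoint hY _ h hwI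
  obtain ⟨hcY, hlexY⟩ : M.cls Y = 0 ∧ M.Lex I Y {w', a, y₀} := by
    rcases hprec with h | h
    · omega
    · exact ⟨h.1.trans hcX, h.2⟩
  obtain ⟨y, hyY, hyX, hy⟩ := hlexY.exists hY.subset_U hX.subset_U
  have hyZ := (hsub hyY).resolve_left hyX
  rcases hY.cases_one hw hwI hwI' with ⟨s, t, hst, hs, ht, -, rfl⟩ | ⟨hA', -⟩ |
      ⟨-, ⟨b', hb', rfl⟩ | ⟨c, hc, y', hy', hyI, hay, hl, rfl⟩⟩
  · have h3 : M.cls {s, t} = 3 := cls_three (by simp [hs.ne_one.symm, ht.ne_one.symm])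
      (by simp [hs.ne_two.symm, ht.ne_two.symm])
    omega
  · exact absurd hA' hA
  · rw [cls_one hw hYw (by simp) ⟨b', hb', by simp⟩] at hcY; omega
  · have hyc : y = c ∨ y = y' := by
      rcases hyY with rfl | h | h
      exacts [absurd (by simp) hyX, .inl h, .inr h]
    refine ⟨c, hc, y', hy', y, hyZ, hyc, ?_, hyX, hy, ?_⟩
    · rcases hyc with rfl | rfl
      exacts [linked_end_edge hw hc, hl]
    · rintro ⟨h1, h2⟩
      refine hyX ?_
      rw [hX.eq_of_subset hY (by rintro z (rfl | rfl | rfl); exacts [by simp, h1, h2])]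
      exact hyY

theorem Ends.eq_one_or_two (hw : M.Ends w w') : w' = M.one ∨ w' = M.two := by
  rcases hw with h | h <;> tauto

theorem insert_pair_eq (x y : ω) : I ∪ {x, y} = I ∪ {x} ∪ {y} := by ext; simp; tauto

/-- The atom `{w', a, a'}`. -/
theorem earlier_endTwoEdges {a a' : ω} (hI : M.Mem I) (hw : M.Ends w w') (hwI : w ∈ I)
    (hwI' : w' ∉ I) (hA : w' ∉ M.A) (ha : a ∈ M.EA) (ha' : a' ∈ M.EA) (haa : M.rk a < M.rk a')
    (hZ' : M.Atom (I ∪ {w', a, a'}) Z') (he : M.Earlier I {w', a, a'} Z)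
    (hp : M.Prec (I ∪ {w', a, a'}) Z' Z) : M.Earlier I {w', a, a'} Z' := by
  by_contra hne
  have hwa : ∀ {a}, a ∈ M.EA → a ≠ w' := fun ha h => hw.symm.notMem_EA (h ▸ ha)
  have hX : M.Atom I {w', a, a'} := .endPair w w' a a' hw hwI hwI' hA ha (.inr ha')
    (hI.notMem_of_ends hw hwI' (.inl ha')) (by rintro rfl; omega) (linked_end_edge hw ha')
  have hJ := hI.union_atom hX
  have h12 : M.one ∈ I ∪ {w', a, a'} ∧ M.two ∈ I ∪ {w', a, a'} := hw.iff.2 ⟨.inl hwI, by simp⟩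
  have hlex := lex_of_both hJ h12.1 h12.2 hZ' hp
  have hcX := cls_endPair hI hw hwI ha (.inr ha') hX
  -- No letter of `Z'` that is linked to `w'` may come before `a'`, as it could replace `a'`. In
  -- particular `Z'` has no edge up to `a'`.
  have hswap : ∀ p ∈ Z', p ∈ M.W ∪ M.EA → M.Linked (I ∪ {w', p}) w' p →
      ¬ M.key I p < M.key I a' := fun p hpZ hpk hpl hlt => hne (by
    have hpJ := hJ.atom_disjoint hZ' p hpZ
    simp only [Set.mem_union, Set.mem_insert_iff, Set.mem_singleton_iff, not_or] at hpJ
    have hat : M.Atom I {w', a, p} := .endPair w w' a p hw hwI hwI' hA ha hpk hpJ.1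
      (Ne.symm hpJ.2.2.1) hpl
    refine ⟨_, hat, prec_of hat.subset_U hX.subset_U ?_ (y := p) (by simp) (by simp [hpJ]) ?_, ?_⟩
    · rw [cls_endPair hI hw hwI ha hpk hat]; exact Nat.zero_le _
    · rintro x (rfl | rfl | rfl) hx
      exacts [absurd (by simp) hx, absurd (by simp) hx, hlt]
    · rintro z (rfl | rfl | rfl)
      exacts [.inl (by simp), .inl (by simp), .inr hpZ])
  have hpA : ∀ p ∈ Z', p ∈ M.EA ∪ M.EB → ¬ M.rk p ≤ M.rk a' := fun p hpZ hpE hle => by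
    have hpA : p ∈ M.EA := hpE.resolve_right fun h => absurd (M.rk_EA_EB ha' h) hle.not_gt
    refine hswap p hpZ (.inr hpA) (linked_end_edge hw hpA) ((key_E_E hpE (.inl ha')).2 ?_)
    refine hle.lt_of_ne fun h => hJ.atom_disjoint hZ' p hpZ ?_
    rw [rk_injOn (hZ'.subset_U hpZ) (mem_U.2 (by tauto)) h]; simp
  obtain ⟨c, hc, y', hy', y, hyZ, hyc, hyl, hyX, hy, hnb⟩ :=
    exists_of_earlier_endPair hI hw hwI hwI' hA ha (.inr ha') hX he
  -- The earlier atom gives up `a` or `a'`, and `a'` is the later of the two.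
  have hya : M.key I y < M.key I a' := by
    by_cases h' : a' ∈ ({w', c, y'} : Set ω)
    · exact (hy a (by simp) fun h => hnb ⟨h, h'⟩).trans ((key_E_E (.inl ha) (.inl ha')).2 haa)
    · exact hy a' (by simp) h'
  obtain ⟨p, hpZ, hpy⟩ := hlex.exists_le hyZ
  have hpk := hJ.atom_kinds h12.1 h12.2 hZ' hpZ
  have hyk : y ∈ M.W ∨ y ∈ M.EA := by
    rcases hyc with rfl | rfl
    exacts [.inr hc, hy']
  rcases hyk with hyW | hyA
  · rw [insert_pair_eq] at hyl
    have hpS : p ∉ I ∪ {w'} := fun h => hJ.atom_disjoint hZ' p hpZ (by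
      rcases h with h | h
      exacts [.inl h, .inr (by simp [Set.mem_singleton_iff.1 h])])
    rcases linked_of_le hpk hpS (Set.union_subset hI.subset (by simpa using hw.symm.mem_U)) hyW
      hw.eq_one_or_two hyl hpy with
      ⟨hpW, -, hpl⟩ | ⟨hpE, f, hfJ, hfE, hpf⟩
    · refine hswap p hpZ (.inl hpW) (by rwa [insert_pair_eq]) ?_
      exact (key_W_E hpW (.inl ha')).2 (hI.not_front hw hwI' _)
    · refine hpA p hpZ hpE ?_
      rcases hfJ with hf | rfl | rfl | rfl
      · exact absurd hf (hI.notMem_of_ends hw hwI' hfE)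
      · exact absurd hfE (by simp [hw.symm.notMem_EA, hw.symm.notMem_EB])
      · omega
      · exact hpf
  · rw [key_E_E (.inl hyA) (.inl ha')] at hya
    obtain ⟨hpE, hprk⟩ := edge_of_le_front hpk (.inl hyA) ⟨a', by simp, .inl ha', hya.le⟩ hpy
    exact hpA p hpZ hpE (by omega)

/-- The atom `{w', a, v}`. -/
theorem earlier_endAdjVertex {a v : ω} (hI : M.Mem I) (hw : M.Ends w w') (hwI : w ∈ I)
    (hwI' : w' ∉ I) (hA : w' ∉ M.A) (ha : a ∈ M.EA) (hv : v ∈ M.W) (hvI : v ∉ I)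
    (hl : M.Linked (I ∪ {w', v}) w' v)
    (hZ' : M.Atom (I ∪ {w', a, v}) Z') (he : M.Earlier I {w', a, v} Z)
    (hp : M.Prec (I ∪ {w', a, v}) Z' Z) : M.Earlier I {w', a, v} Z' := by
  by_contra hne
  have hav : ∀ {a v}, a ∈ M.EA → v ∈ M.W → a ≠ v := fun ha hv h => W_EA hv (h ▸ ha)
  have hX : M.Atom I {w', a, v} :=
    .endPair w w' a v hw hwI hwI' hA ha (.inl hv) hvI (hav ha hv) hl
  have hJ := hI.union_atom hX
  have h12 : M.one ∈ I ∪ {w', a, v} ∧ M.two ∈ I ∪ {w', a, v} := hw.iff.2 ⟨.inl hwI, by simp⟩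
  have hlex := lex_of_both hJ h12.1 h12.2 hZ' hp
  have hcX := cls_endPair hI hw hwI ha (.inl hv) hX
  have hpJ : ∀ p ∈ Z', p ∉ I ∧ p ≠ w' ∧ p ≠ a ∧ p ≠ v := fun p hpZ => by
    have := hJ.atom_disjoint hZ' p hpZ
    simp only [Set.mem_union, Set.mem_insert_iff, Set.mem_singleton_iff, not_or] at this
    exact this
  -- A lower edge could replace `a`, and below, a lower vertex could replace `v`; such a vertex is
  -- linked by `Linked.of_lt`.
  have hpA : ∀ p ∈ Z', p ∈ M.EA ∪ M.EB → ¬ M.rk p ≤ M.rk a := fun p hpZ hpE hle => hne (by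
    have hpA : p ∈ M.EA := hpE.resolve_right fun h => absurd (M.rk_EA_EB ha h) hle.not_gt
    have hlt : M.rk p < M.rk a := hle.lt_of_ne fun h => (hpJ p hpZ).2.2.1
      (rk_injOn (hZ'.subset_U hpZ) (mem_U.2 (by tauto)) h)
    have hat : M.Atom I {w', p, v} :=
      .endPair w w' p v hw hwI hwI' hA hpA (.inl hv) hvI (hav hpA hv) hl
    refine ⟨_, hat, prec_of hat.subset_U hX.subset_U ?_ (y := p) (by simp) (by simp [hpJ p hpZ]) ?_,
      ?_⟩
    · rw [cls_endPair hI hw hwI hpA (.inl hv) hat]; exact Nat.zero_le _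
    · rintro x (rfl | rfl | rfl) hx
      exacts [absurd (by simp) hx, (key_E_E (.inl hpA) (.inl ha)).2 hlt, absurd (by simp) hx]
    · rintro z (rfl | rfl | rfl)
      exacts [.inl (by simp), .inr hpZ, .inl (by simp)])
  have hpW : ∀ p ∈ Z', p ∈ M.W → M.rk v < M.rk p := fun p hpZ hpW => by
    by_contra hle
    have hlt : M.rk p < M.rk v := (not_lt.1 hle).lt_of_ne fun h => (hpJ p hpZ).2.2.2
      (rk_injOn (hZ'.subset_U hpZ) (mem_U.2 (by tauto)) h)
    refine hne ?_
    have hpl : M.Linked (I ∪ {w', p}) w' p := by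
      rw [insert_pair_eq] at hl ⊢
      exact hl.of_lt (Set.union_subset hI.subset (by simpa using hw.symm.mem_U)) hpW
        (by simp [hpJ p hpZ]) (.inr (hw.symm.rk_lt hpW)) hv hlt
    have hat : M.Atom I {w', a, p} :=
      .endPair w w' a p hw hwI hwI' hA ha (.inl hpW) (hpJ p hpZ).1 (hav ha hpW) hpl
    refine ⟨_, hat, prec_of hat.subset_U hX.subset_U ?_ (y := p) (by simp) (by simp [hpJ p hpZ]) ?_,
      ?_⟩
    · rw [cls_endPair hI hw hwI ha (.inl hpW) hat]; exact Nat.zero_le _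
    · rintro x (rfl | rfl | rfl) hx
      exacts [absurd (by simp) hx, absurd (by simp) hx, (key_W_W hpW hv).2 hlt]
    · rintro z (rfl | rfl | rfl)
      exacts [.inl (by simp), .inl (by simp), .inr hpZ]
  obtain ⟨c, hc, y', hy', y, hyZ, hyc, hyl, hyX, hy, hnb⟩ :=
    exists_of_earlier_endPair hI hw hwI hwI' hA ha (.inl hv) hX he
  obtain ⟨p, hpZ, hpy⟩ := hlex.exists_le hyZ
  have hpk := hJ.atom_kinds h12.1 h12.2 hZ' hpZ
  by_cases hvY : v ∈ ({w', c, y'} : Set ω)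
  · have hvy' : v = y' := by
      rcases hvY with h | h | h
      exacts [absurd (h ▸ hv) hw.symm.notMem_W, absurd h.symm (hav hc hv), h]
    have hyc : y = c := hyc.resolve_right fun h => hyX (by simp [h, hvy'])
    subst hyc
    have hlt := (key_E_E (.inl hc) (.inl ha)).1 (hy a (by simp) fun h => hnb ⟨h, hvY⟩)
    obtain ⟨hpE, hprk⟩ := edge_of_le_front hpk (.inl hc) ⟨a, by simp, .inl ha, hlt.le⟩ hpy
    exact hpA p hpZ hpE (by omega)
  -- The letter `v` is given up. As `I` has no edges, `y` is a vertex below `v`. What is not after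
  -- `y` at `J` is either a vertex below `v` or an edge brought to the front by `a`, and `Z'`
  -- contains neither.
  · have hlt := hy v (by simp) hvY
    have hyk : y ∈ M.W ∨ y ∈ M.EA := by
      rcases hyc with rfl | rfl
      exacts [.inr hc, hy']
    have hyW : y ∈ M.W := hyk.resolve_right fun h =>
      hI.not_front hw hwI' _ ((key_E_W (.inl h) hv).1 hlt)
    rw [key_W_W hyW hv] at hlt
    rcases hpk with hpk | hpk
    · have := hpW p hpZ hpk
      exact absurd ((key_W_W hyW hpk).2 (hlt.trans this)) hpy.not_gt
    · have : M.Front (I ∪ {w', a, v}) p := by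
        by_contra hf
        exact absurd ((key_W_E hyW hpk).2 hf) hpy.not_gt
      obtain ⟨f, hfJ, hfE, hpf⟩ := this
      refine hpA p hpZ hpk ?_
      rcases hfJ with hf | rfl | rfl | rfl
      · exact absurd hf (hI.notMem_of_ends hw hwI' hfE)
      · exact absurd hfE (by simp [hw.symm.notMem_EA, hw.symm.notMem_EB])
      · exact hpf
      · exact absurd hfE (by simp [W_EA hv, W_EB hv])

theorem earlier_one (hI : M.Mem I) (hw : M.Ends w w') (hwI : w ∈ I) (hwI' : w' ∉ I)
    (hX : M.Atom I X) (hZ : M.Atom (I ∪ X) Z) (hZ' : M.Atom (I ∪ X) Z')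
    (he : M.Earlier I X Z) (hp : M.Prec (I ∪ X) Z' Z) : M.Earlier I X Z' := by
  rcases hX.cases_one hw hwI hwI' with ⟨x, y, hxy, hx, hy, hl, rfl⟩ |
      ⟨hA, ⟨a, ha, rfl⟩ | ⟨b, hb, v, hv, hvI, hl, rfl⟩⟩ |
      ⟨hA, ⟨b, hb, rfl⟩ | ⟨a, ha, y, hy, hyI, hay, hl, rfl⟩⟩
  · obtain ⟨x₁, x₂, h, hs⟩ := exists_ordPair hI hxy hx hy hl
    rw [hs] at hZ hZ' he hp ⊢
    exact h.earlier_of_prec hZ hZ' he hp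
  · exact earlier_endEdge hI hw hwI hwI' hA ha hZ' he hp
  · exact earlier_endEdgeVertex hI hw hwI hwI' hA hb hv hvI hl hZ hZ' he hp
  · exact earlier_endFreeEdge hI hw hwI hwI' hA hb hZ' he hp
  · rcases hy with hy | hy
    · exact earlier_endAdjVertex hI hw hwI hwI' hA ha hy hyI hl hZ' he hp
    · rcases lt_trichotomy (M.rk a) (M.rk y) with h | h | h
      · exact earlier_endTwoEdges hI hw hwI hwI' hA ha hy h hZ' he hp
      · exact absurd (rk_injOn (mem_U.2 (by tauto)) (mem_U.2 (by tauto)) h) hay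
      · rw [Set.pair_comm a y] at hZ' he hp ⊢
        exact earlier_endTwoEdges hI hw hwI hwI' hA hy ha h hZ' he hp

end one

/-! ### Earlier atoms come first: no end of the bundle in `I` -/

section none

variable {w w' : ω}

/-- The atom `{w'}`. -/
theorem earlier_single (hI : M.Mem I) (hw : M.Ends w w') (hwI : w ∉ I) (hwI' : w' ∉ I)
    (hA : w' ∉ M.A) (hZ' : M.Atom (I ∪ {w'}) Z')
    (he : M.Earlier I {w'} Z) (hp : M.Prec (I ∪ {w'}) Z' Z) : M.Earlier I {w'} Z' := by
  have hX : M.Atom I {w'} := .single w w' hw hwI hwI' hA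
  have hJ := hI.union_atom hX
  have hcX : M.cls {w'} = 0 := cls_zero hw (by simpa using hw.ne) rfl (by
    rintro b hb rfl; exact hw.symm.notMem_EB hb)
  obtain ⟨Y, hY, hprec, hsub⟩ := he
  have hlexY : M.Lex I Y {w'} := by
    rcases hprec with h | h
    · omega
    · exact h.2
  obtain ⟨y, hyY, hyX, hy⟩ := hlexY.exists hY.subset_U hX.subset_U
  have hwY : w' ∉ Y := fun h => hyX (by rw [hX.eq_of_subset hY (by simpa using h)]; exact hyY)
  have hlt := hy w' rfl hwY
  have hyZ := (hsub hyY).resolve_left hyX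
  -- Only the other end can come before `w'`. So `w'` is `two`, and by `two_mem_A` neither end is in
  -- `A`. The class of `Z` then forces `Z'` to contain `one`, which is an atom by itself.
  have hyw : y = w := by
    rcases mem_U.1 (hY.subset_U hyY) with h | h | h
    · exact (hw.eq_or_eq (.inl h)).resolve_right hyX
    · exact (hw.eq_or_eq (.inr h)).resolve_right hyX
    · exact absurd (key_end hw.symm h) hlt.not_gt
  subst hyw
  have h1 : y = M.one ∧ w' = M.two := by
    rcases hw with h | ⟨rfl, rfl⟩
    · exact h
    · exact absurd key_one_two hlt.not_gt
  have hA1 : y ∉ M.A := fun h => hA (by rw [h1.2]; rw [h1.1] at h; exact M.two_mem_A h)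
  have hcZ : M.cls Z < 3 := cls_lt_three (.inl (h1.1 ▸ hyZ))
  have hcZ' : M.cls Z' < 3 := by rcases hp with h | h <;> omega
  have hyZ' : y ∈ Z' := by
    by_contra hyZ'
    have h2 : M.two ∉ Z' := fun h => hJ.atom_disjoint hZ' _ h (.inr h1.2.symm)
    rw [cls_three (h1.1 ▸ hyZ') h2] at hcZ'
    omega
  have hat : M.Atom I {y} := .single w' y hw.symm hwI' hwI hA1
  refine ⟨{y}, hat, prec_of hat.subset_U hX.subset_U ?_ rfl hw.ne ?_, by simp [hyZ']⟩
  · rw [cls_zero (X := {y}) hw.symm (by simpa using hw.ne.symm) rfl (by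
      rintro b hb rfl; exact hw.notMem_EB hb)]
    exact Nat.zero_le _
  · rintro x rfl -
    exact hlt

/-- When `one` is in `A`, every vertex adjacent to `two` is adjacent to `one`, so `one` can replace
`two` at the start of a walk. -/
theorem Linked.one_of_two {v : ω} (hI : M.Mem I) (h1 : M.one ∉ I) (hA : M.one ∈ M.A)
    (hv : v ∈ M.W) (h : M.Linked (I ∪ {M.two, v}) M.two v) :
    M.Linked (I ∪ {M.one, v}) M.one v := by
  have hv1 : M.one ≠ v := fun h => one_notMem_W (h ▸ hv)
  have hv2 : v ≠ M.two := fun h => two_notMem_W (h ▸ hv)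
  refine ⟨by simp, by simp, fun T hT h1T => ?_⟩
  have key : M.ClosedIn ((T \ {M.one}) ∪ {M.two}) (I ∪ {M.two, v}) := by
    constructor
    · rintro z (hz | rfl)
      · rcases hT.1 hz.1 with h | h | h
        · exact .inl h
        · exact absurd h hz.2
        · exact .inr (.inr h)
      · simp
    · rintro z hz t ht hzt
      by_cases ht2 : t = M.two
      · exact .inr ht2
      have htI : t ∈ I ∪ {v} := by
        rcases ht with h | h | h
        exacts [.inl h, absurd h ht2, .inr h]
      have ht1 : t ≠ M.one := by
        rintro rfl
        rcases htI with h | h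
        exacts [h1 h, hv1 h]
      have htS : t ∈ I ∪ {M.one, v} := by
        rcases htI with h | h
        exacts [.inl h, .inr (.inr h)]
      refine .inl ⟨?_, ht1⟩
      rcases hz with hz | rfl
      · exact hT.2 z hz.1 t htS hzt
      · have htW : t ∈ M.W := by
          rcases htI with h | h
          · rcases mem_U.1 (hI.subset h) with h' | h' | h' | h'
            exacts [absurd h' ht1, absurd h' ht2, h', absurd (hI.ends t h h').1 h1]
          · rw [Set.mem_singleton_iff.1 h]; exact hv
        exact hT.2 _ h1T t htS (M.adj_one_of_adj_two hA htW hzt)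
  rcases h.2.2 _ key (.inr rfl) with h' | h'
  exacts [h'.1, absurd h' hv2]

/-- If the ends of the bundle are in `A`, then at most one vertex is linked to them. -/
theorem linked_unique {e e' v v' : ω} (hI : M.Mem I) (h1 : M.one ∉ I) (hA : M.one ∈ M.A)
    (he : e = M.one ∨ e = M.two) (he' : e' = M.one ∨ e' = M.two)
    (hv : v ∈ M.W) (hv' : v' ∈ M.W) (hvI : v ∉ I) (hvI' : v' ∉ I)
    (h : M.Linked (I ∪ {e, v}) e v) (h' : M.Linked (I ∪ {e', v'}) e' v') : v = v' := by
  -- If `one` is in `A` there are no jumps at all, so a walk from `one` cannot get past the missing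
  -- vertex `v`.
  have key : ∀ {v v'}, v ∈ M.W → v' ∈ M.W → v ∉ I → M.Linked (I ∪ {M.one, v'}) M.one v' →
      ¬ M.rk v < M.rk v' := fun {v v'} hv hv' hvI hl hlt => by
    have h1v : M.rk M.one < M.rk v := M.rk_one_two.trans (M.rk_two_W hv)
    obtain ⟨z, z', -, hz, hz', hzp, hpz', hzz', -⟩ := hl.exists_jump (p := v) (by
      rintro t (ht | rfl | rfl)
      exacts [hI.subset ht, mem_U.2 (by tauto), mem_U.2 (by tauto)]) hv (by
      rintro (h | rfl | rfl)
      exacts [hvI h, one_notMem_W hv, lt_irrefl _ hlt]) (.inr h1v) hv' hlt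
    exact (M.jump hzz' hv hz hz' hzp hpz').1 hA
  have hone : ∀ {e v}, (e = M.one ∨ e = M.two) → v ∈ M.W → M.Linked (I ∪ {e, v}) e v →
      M.Linked (I ∪ {M.one, v}) M.one v := by
    rintro e v (rfl | rfl) hv h
    exacts [h, h.one_of_two hI h1 hA hv]
  have a1 := key hv hv' hvI (hone he' hv' h')
  have a2 := key hv' hv hvI' (hone he hv h)
  exact rk_injOn (mem_U.2 (by tauto)) (mem_U.2 (by tauto)) (by omega)

theorem notMem_of_ends_notMem (hw : M.Ends w w') (h1 : M.one ∉ I) (h2 : M.two ∉ I) :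
    w ∉ I ∧ w' ∉ I := by
  rcases hw with ⟨rfl, rfl⟩ | ⟨rfl, rfl⟩ <;> tauto

theorem cls_endVertex {v : ω} (hw : M.Ends w w') (hv : v ∈ M.W) : M.cls {w', v} = 0 :=
  cls_zero hw (by
    rintro (h | h)
    exacts [hw.ne h, hw.notMem_W (Set.mem_singleton_iff.1 h ▸ hv)]) (by simp) (by
    rintro b hb (rfl | rfl)
    exacts [hw.symm.notMem_EB hb, W_EB hv hb])

/-- The atom `{w', v}`. -/
theorem earlier_endVertex {v : ω} (hI : M.Mem I) (hw : M.Ends w w') (h1 : M.one ∉ I)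
    (h2 : M.two ∉ I) (hA : w' ∈ M.A) (hv : v ∈ M.W) (hvI : v ∉ I)
    (hl : M.Linked (I ∪ {w', v}) w' v)
    (hZ' : M.Atom (I ∪ {w', v}) Z') (he : M.Earlier I {w', v} Z)
    (hp : M.Prec (I ∪ {w', v}) Z' Z) : M.Earlier I {w', v} Z' := by
  obtain ⟨hwI, hwI'⟩ := notMem_of_ends_notMem hw h1 h2
  have hX : M.Atom I {w', v} := .endVertex w w' v hw hwI hwI' hA hv hvI hl
  have hJ := hI.union_atom hX
  have hcX := cls_endVertex hw hv
  have hZw' : w' ∉ Z' := fun h => hJ.atom_disjoint hZ' _ h (by simp)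
  have hZ'3 : w ∉ Z' → M.cls Z' = 3 := fun h => by
    rcases hw with ⟨rfl, rfl⟩ | ⟨rfl, rfl⟩
    exacts [cls_three h hZw', cls_three hZw' h]
  -- If `Z` has an end, its class is below 3, and so is that of `Z'`; the only end left for `Z'` is
  -- `w`.
  have hwZ : w ∈ Z → w ∈ Z' := fun h => by
    by_contra hn
    have h3 := (hp.lex_of_three (hZ'3 hn)).1
    have := noEnds_of_cls h3
    rcases hw with ⟨rfl, rfl⟩ | ⟨rfl, rfl⟩
    exacts [this.1 h, this.2 h]
  obtain ⟨Y, hY, hprec, hsub⟩ := he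
  obtain ⟨hcY, hlexY⟩ : M.cls Y = 0 ∧ M.Lex I Y {w', v} := by
    rcases hprec with h | h
    · omega
    · exact ⟨h.1.trans hcX, h.2⟩
  obtain ⟨y, hyY, hyX, hy⟩ := hlexY.exists hY.subset_U hX.subset_U
  have hyZ := (hsub hyY).resolve_left hyX
  rcases hY.cases_none h1 h2 with ⟨s, t, hst, hs, ht, -, rfl⟩ | ⟨z, z', hz, hzA, rfl⟩ |
      ⟨z, z', u, hz, hzA, hu, huI, hul, rfl⟩ | ⟨hA1, hA2, hh⟩
  · have h3 : M.cls {s, t} = 3 := cls_three (by simp [hs.ne_one.symm, ht.ne_one.symm])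
      (by simp [hs.ne_two.symm, ht.ne_two.symm])
    omega
  · have hzw : z' = w := (hw.eq_or_eq hz.eq_one_or_two).resolve_right fun h => hzA (h ▸ hA)
    have hyz : y = z' := hyY
    refine ⟨_, hY, hprec, ?_⟩
    rintro t rfl
    exact .inr (hzw ▸ hwZ (by rw [← hzw, ← hyz]; exact hyZ))
  -- If `one` is in `A`, only one vertex is linked to the ends, so the earlier atom differs from `X`
  -- by the end alone. Otherwise `X` contains `two`, and either `Z'` contains `one`, an atom by
  -- itself, or a vertex of `Z'` replaces `v`.
  · by_cases hA1 : M.one ∈ M.A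
    · have huv := linked_unique hI h1 hA1 hz.eq_one_or_two hw.eq_one_or_two hu hv huI hvI hul hl
      subst huv
      have hyz : y = z' := by
        rcases hyY with h | h
        exacts [h, absurd (.inr h) hyX]
      have hzw : z' = w := (hw.eq_or_eq hz.eq_one_or_two).resolve_right fun h =>
        hyX (by simp [hyz, h])
      refine ⟨_, hY, hprec, ?_⟩
      rintro t (rfl | rfl)
      · exact .inr (hzw ▸ hwZ (by rw [← hzw, ← hyz]; exact hyZ))
      · exact .inl (by simp)
    · have hw2 : w = M.one ∧ w' = M.two := by
        rcases hw with h | ⟨rfl, rfl⟩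
        exacts [h, absurd hA hA1]
      have hzw : z' = w' := (hw.eq_or_eq hz.eq_one_or_two).resolve_left fun h =>
        hA1 (by rw [← hw2.1, ← h]; exact hzA)
      subst hzw
      have hyu : y = u := by
        rcases hyY with h | h
        exacts [absurd (.inl h) hyX, h]
      subst hyu
      by_cases hwZ' : w ∈ Z'
      · have hat : M.Atom I {w} :=
          .single _ _ hw.symm hwI' hwI (by rw [hw2.1]; exact hA1)
        refine ⟨_, hat, prec_of hat.subset_U hX.subset_U ?_ rfl ?_ ?_, by simp [hwZ']⟩
        · rw [cls_zero (X := {w}) hw.symm (by simpa using hw.ne.symm) rfl (by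
            rintro b hb rfl; exact hw.notMem_EB hb)]
          exact Nat.zero_le _
        · rintro (h | h)
          exacts [hw.ne h, hw.notMem_W (Set.mem_singleton_iff.1 h ▸ hv)]
        · rintro x (rfl | rfl) -
          · rw [hw2.1, hw2.2]; exact key_one_two
          · exact key_end hw (.inl hv)
      · have hlex := (hp.lex_of_three (hZ'3 hwZ')).2
        obtain ⟨p, hpZ, hpy⟩ := hlex.exists_le hyZ
        have hvy : v ≠ y := fun h => hyX (by simp [h])
        have hlt := (key_W_W hu hv).1 (hy v (by simp) (by
          rintro (h | h)
          exacts [hw.symm.notMem_W (h ▸ hv), hvy h]))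
        have hpJ := hJ.atom_disjoint hZ' p hpZ
        simp only [Set.mem_union, Set.mem_insert_iff, Set.mem_singleton_iff, not_or] at hpJ
        have hwJ : w ∉ I ∪ {z', v} := by
          rintro (h | h | h)
          exacts [hwI h, hw.ne h, hw.notMem_W (Set.mem_singleton_iff.1 h ▸ hv)]
        have hpW : p ∈ M.W := by
          have hends := noEnds_of_cls (hZ'3 hwZ')
          rcases hZ'.cases_noEnds hends.1 hends.2 with
            ⟨c, -, -, ho, ht, -⟩ | ⟨s, t, -, hs, ht, -, rfl⟩
          · exact absurd (hw.iff.1 ⟨ho, ht⟩).1 hwJ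
          · rcases hpZ with rfl | rfl
            exacts [hs.mem_W hw.symm hwJ, ht.mem_W hw.symm hwJ]
        rw [insert_pair_eq] at hul
        obtain ⟨-, hprk, hpl⟩ := (linked_of_le (.inl hpW) (by simp [hpJ])
          (Set.union_subset hI.subset (by simpa using hw.symm.mem_U)) hu hw.eq_one_or_two hul
          hpy).resolve_right fun h => h.1.elim (W_EA hpW) (W_EB hpW)
        rw [← insert_pair_eq] at hpl
        have hat : M.Atom I {z', p} := .endVertex w z' p hw hwI hwI' hA hpW hpJ.1 hpl
        refine ⟨_, hat, prec_of hat.subset_U hX.subset_U ?_ (y := p) (by simp) (by simp [hpJ]) ?_,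
          by rintro t (rfl | rfl); exacts [.inl (by simp), .inr hpZ]⟩
        · rw [cls_endVertex hw hpW]; exact Nat.zero_le _
        · rintro x (rfl | rfl) hx
          exacts [absurd (by simp) hx, (key_W_W hpW hv).2 (by omega)]
  · have : M.cls Y = 2 := by
      rcases hh with ⟨b, -, rfl⟩ | ⟨a, -, a', -, -, rfl⟩ <;> exact cls_two (by simp) (by simp)
    omega

/-- The atoms that contain both ends of the bundle. -/
theorem earlier_both (hI : M.Mem I) (h1 : M.one ∉ I) (h2 : M.two ∉ I) (hA1 : M.one ∈ M.A)
    (hA2 : M.two ∈ M.A) (hX : M.Atom I X) (h1X : M.one ∈ X) (h2X : M.two ∈ X)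
    (hXE : ∀ x ∈ X, x = M.one ∨ x = M.two ∨ x ∈ M.EA ∪ M.EB)
    (hZ' : M.Atom (I ∪ X) Z') (he : M.Earlier I X Z) (hp : M.Prec (I ∪ X) Z' Z)
    (hfront : ∀ p ∈ Z', p ∈ M.EA ∪ M.EB → M.Front (I ∪ X) p → M.Earlier I X Z' ∨
      ∃ u ∈ Z', u ∈ M.W ∧ M.Linked (I ∪ {M.one, M.two} ∪ {u}) M.one u)
    (hY : ∀ Y, M.Atom I Y → M.one ∈ Y → M.two ∈ Y → ∀ y ∈ Y, y ∉ X →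
      (∀ x ∈ X, x ∉ Y → M.key I y < M.key I x) → y ∈ M.EA ∪ M.EB ∧ M.Front (I ∪ X) y) :
    M.Earlier I X Z' := by
  by_contra hne
  have hJ := hI.union_atom hX
  have h12 : M.one ∈ I ∪ X ∧ M.two ∈ I ∪ X := ⟨.inr h1X, .inr h2X⟩
  have hlex := lex_of_both hJ h12.1 h12.2 hZ' hp
  have hcX := cls_two h1X h2X
  have hS : I ∪ {M.one, M.two} ⊆ I ∪ X := by
    rintro z (hz | rfl | rfl)
    exacts [.inl hz, h12.1, h12.2]
  -- A vertex linked to the ends is linked to one of them alone, and forms with it an atom of class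
  -- 0 before `X`.
  have hW : ∀ u ∈ Z', u ∈ M.W → ¬ M.Linked (I ∪ {M.one, M.two} ∪ {u}) M.one u := by
    intro u huZ huW hul
    have huI : u ∉ I := fun h => hJ.atom_disjoint hZ' u huZ (.inl h)
    have key : ∀ {w w'}, M.Ends w w' → w' ∈ M.A → M.Linked (I ∪ {w', u}) w' u → False := by
      intro w w' hw hA hl
      obtain ⟨hwI, hwI'⟩ := notMem_of_ends_notMem hw h1 h2
      refine hne ⟨_, .endVertex w w' u hw hwI hwI' hA huW huI hl, .inl ?_, ?_⟩
      · rw [hcX, cls_endVertex hw huW]; norm_num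
      · rintro t (rfl | rfl)
        · exact .inl (by rcases hw with ⟨rfl, rfl⟩ | ⟨rfl, rfl⟩ <;> assumption)
        · exact .inr huZ
    rcases hul.of_both h1 (fun h => one_notMem_W (h ▸ huW)) with h | h
    exacts [key ends_one_two.symm hA1 h, key ends_one_two hA2 h]
  have hF : ∀ p ∈ Z', p ∈ M.EA ∪ M.EB → ¬ M.Front (I ∪ X) p := fun p hpZ hpE hpf => by
    rcases hfront p hpZ hpE hpf with h | ⟨u, huZ, huW, hul⟩
    exacts [hne h, hW u huZ huW hul]
  obtain ⟨Y, hYat, hprec, hsub⟩ := he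
  have hcY : M.cls Y ≤ 2 := by rcases hprec with h | h <;> omega
  -- An edge of `Z` at the front has to be answered by an edge of `Z'` at the front, and there is
  -- none.
  have hdone : ∀ y ∈ Z, ¬ (y ∈ M.EA ∪ M.EB ∧ M.Front (I ∪ X) y) := fun y hyZ ⟨hyE, hyf⟩ => by
    obtain ⟨p, hpZ, hpy⟩ := hlex.exists_le hyZ
    obtain ⟨hpE, hprk⟩ := edge_of_le_front (hJ.atom_kinds h12.1 h12.2 hZ' hpZ) hyE hyf hpy
    exact hF p hpZ hpE (hyf.mono hprk)
  have hboth : M.one ∈ Y → M.two ∈ Y → False := fun h1Y h2Y => by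
    have hlexY : M.Lex I Y X := by
      rcases hprec with h | h
      · rw [hcX, cls_two h1Y h2Y] at h; omega
      · exact h.2
    obtain ⟨y, hyY, hyX, hy⟩ := hlexY.exists hYat.subset_U hX.subset_U
    exact hdone y ((hsub hyY).resolve_left hyX) (hY Y hYat h1Y h2Y y hyY hyX hy)
  rcases hYat.cases_none h1 h2 with ⟨s, t, hst, hs, ht, -, rfl⟩ | ⟨z, z', hz, hzA, rfl⟩ |
      ⟨z, z', u, hz, hzA, hu, huI, hul, rfl⟩ | ⟨-, -, hh⟩
  · have h3 : M.cls {s, t} = 3 := cls_three (by simp [hs.ne_one.symm, ht.ne_one.symm])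
      (by simp [hs.ne_two.symm, ht.ne_two.symm])
    omega
  · rcases hz.eq_one_or_two with rfl | rfl <;> contradiction
  · have huZ : u ∈ Z := (hsub (by simp)).resolve_left fun h => by
      rcases hXE u h with rfl | rfl | h' | h'
      exacts [one_notMem_W hu, two_notMem_W hu, W_EA hu h', W_EB hu h']
    have hul' : M.Linked (I ∪ {M.one, M.two} ∪ {u}) M.one u := by
      have h3 : M.Linked (I ∪ {M.one, M.two} ∪ {u}) z' u := hul.mono (by
        rintro t (ht | rfl | rfl)
        · exact .inl (.inl ht)
        · rcases hz.eq_one_or_two with rfl | rfl <;> simp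
        · simp)
      rcases hz.eq_one_or_two with rfl | rfl
      · exact h3
      · exact (Linked.of_adj M.adj_one_two (by simp) (by simp)).trans h3
    obtain ⟨p, hpZ, hpy⟩ := hlex.exists_le huZ
    have hpJ := hJ.atom_disjoint hZ' p hpZ
    rcases linked_of_le (hJ.atom_kinds h12.1 h12.2 hZ' hpZ) (fun h => hpJ (hS h))
      (hS.trans hJ.subset) hu (.inl rfl) hul' hpy with ⟨hpW, -, hpl⟩ | ⟨hpE, hpf⟩
    exacts [hW p hpZ hpW hpl, hF p hpZ hpE hpf]
  · rcases hh with ⟨b, -, rfl⟩ | ⟨a, -, a', -, -, rfl⟩ <;> exact hboth (by simp) (by simp)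

/-- An edge of `Z'` below `b` replaces `b`, by itself if it is outside `A`, and with its partner in
`Z'` if that is an edge in `A`. A vertex as partner is linked to the ends, which is the alternative
provided for in `earlier_both`. -/
theorem earlier_bothFreeEdge {b : ω} (hI : M.Mem I) (h1 : M.one ∉ I) (h2 : M.two ∉ I)
    (hA1 : M.one ∈ M.A) (hA2 : M.two ∈ M.A) (hb : b ∈ M.EB)
    (hZ' : M.Atom (I ∪ {M.one, M.two, b}) Z') (he : M.Earlier I {M.one, M.two, b} Z)
    (hp : M.Prec (I ∪ {M.one, M.two, b}) Z' Z) : M.Earlier I {M.one, M.two, b} Z' := by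
  have hX : M.Atom I {M.one, M.two, b} := .bothFreeEdge b h1 h2 hA1 hA2 hb
  have hJ := hI.union_atom hX
  have hcX : M.cls {M.one, M.two, b} = 2 := cls_two (by simp) (by simp)
  have hfr : ∀ {p}, M.Front (I ∪ {M.one, M.two, b}) p ↔ M.rk p ≤ M.rk b := by
    refine fun {p} => ⟨?_, fun h => ⟨b, by simp, .inr hb, h⟩⟩
    rintro ⟨f, hf | rfl | rfl | rfl, hfE, hpf⟩
    · exact absurd hf (hI.notMem_of_ends ends_one_two h2 hfE)
    · exact absurd hfE (by simp [one_notMem_EA, one_notMem_EB])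
    · exact absurd hfE (by simp [two_notMem_EA, two_notMem_EB])
    · exact hpf
  refine earlier_both hI h1 h2 hA1 hA2 hX (by simp) (by simp)
    (by rintro x (rfl | rfl | rfl) <;> simp [hb]) hZ' he hp ?_ ?_
  · intro p hpZ hpE hpf
    have hpJ := hJ.atom_disjoint hZ' p hpZ
    simp only [Set.mem_union, Set.mem_insert_iff, Set.mem_singleton_iff, not_or] at hpJ
    have hlt : M.rk p < M.rk b := (hfr.1 hpf).lt_of_ne fun h => hpJ.2.2.2
      (rk_injOn (hZ'.subset_U hpZ) (mem_U.2 (by tauto)) h)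
    have hsw : ∀ {Y : Set ω}, M.one ∈ Y → M.two ∈ Y → p ∈ Y → M.Atom I Y →
        M.Prec I Y {M.one, M.two, b} := fun {Y} ho ht hpY hY => by
      refine prec_of hY.subset_U hX.subset_U (by rw [hcX, cls_two ho ht]) hpY (by simp [hpJ]) ?_
      rintro x (rfl | rfl | rfl) hx
      exacts [absurd ho hx, absurd ht hx, (key_E_E hpE (.inr hb)).2 hlt]
    have hJZ := hJ.ends_disjoint hZ'
    rcases hZ'.cases_noEnds (hJZ.1 (by simp)) (hJZ.2 (by simp)) with
        ⟨c, hc, -, -, -, rfl⟩ | ⟨s, t, hst, hs, ht, hl, rfl⟩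
    · obtain rfl : p = c := hpZ
      have hat : M.Atom I {M.one, M.two, p} := .bothFreeEdge p h1 h2 hA1 hA2 hc
      exact .inl ⟨_, hat, hsw (by simp) (by simp) (by simp) hat, by
        rintro z (rfl | rfl | rfl); exacts [.inl (by simp), .inl (by simp), .inr rfl]⟩
    · obtain ⟨u, huZ, hup, hpf', huf, hl⟩ : ∃ u ∈ ({s, t} : Set ω), u ≠ p ∧
            M.Free (I ∪ {M.one, M.two, b}) p ∧ M.Free (I ∪ {M.one, M.two, b}) u ∧
            M.Linked (I ∪ {M.one, M.two, b} ∪ {p, u}) p u := by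
        rcases hpZ with rfl | rfl
        · exact ⟨t, by simp, hst.symm, hs, ht, hl⟩
        · exact ⟨s, by simp, hst, ht, hs, by rw [Set.pair_comm p s]; exact hl.symm⟩
      have hpA : p ∈ M.EA := hpE.resolve_right hpf'.notMem_EB
      rcases huf.2 with huW | ⟨huA, -⟩
      · refine .inr ⟨u, huZ, huW, ?_⟩
        refine Linked.drop_edges (S := I ∪ {M.one, M.two, b} ∪ {p, u})
          ((Linked.of_adj (M.adj_symm (M.adj_EA_one hpA)) (by simp) (by simp)).trans hl) ?_ (by simp)
          (by simp) (.inr (by simp))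
        rintro z ((hz | rfl | rfl | rfl) | rfl | rfl) hz'
        · exact absurd (.inl (.inl hz)) hz'
        · exact absurd (by simp) hz'
        · exact absurd (by simp) hz'
        · exact .inr hb
        · exact hpE
        · exact absurd (by simp) hz'
      · have hat : M.Atom I {M.one, M.two, p, u} := .bothPair p u h1 h2 hA1 hA2 hpA huA hup.symm
        exact .inl ⟨_, hat, hsw (by simp) (by simp) (by simp) hat, by
          rintro z (rfl | rfl | rfl | rfl)
          exacts [.inl (by simp), .inl (by simp), .inr hpZ, .inr huZ]⟩
  · intro Y hY ho ht y hyY hyX hy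
    rcases hY.cases_none h1 h2 with ⟨s, t, hst, hs, ht', -, rfl⟩ | ⟨z, z', hz, hzA, rfl⟩ |
      ⟨z, z', u, hz, hzA, hu, huI, hul, rfl⟩ | ⟨-, -, ⟨c, hc, rfl⟩ | ⟨a, ha, a', ha', -, rfl⟩⟩
    · exact absurd ho (by simp [hs.ne_one.symm, ht'.ne_one.symm])
    · exact absurd (ho.trans ht.symm) one_ne_two
    · exfalso
      rcases ho with ho | ho
      · rcases ht with ht | ht
        exacts [one_ne_two (ho.trans ht.symm), two_notMem_W (ht ▸ hu)]
      · exact one_notMem_W (ho ▸ hu)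
    · have hyc : y = c := by
        rcases hyY with rfl | rfl | h
        exacts [absurd (by simp) hyX, absurd (by simp) hyX, h]
      subst hyc
      have hyb : b ≠ y := fun h => hyX (by simp [h])
      have := hy b (by simp) (by
        rintro (rfl | rfl | h)
        exacts [one_notMem_EB hb, two_notMem_EB hb, hyb h])
      exact ⟨.inr hc, hfr.2 ((key_E_E (.inr hc) (.inr hb)).1 this).le⟩
    · have hyA : y ∈ M.EA := by
        rcases hyY with rfl | rfl | rfl | rfl
        exacts [absurd (by simp) hyX, absurd (by simp) hyX, ha, ha']
      exact ⟨.inl hyA, hfr.2 (M.rk_EA_EB hyA hb).le⟩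

/-- An edge of `Z'` below `a'` is in `A` and replaces `a'`. The gained letter of an earlier atom
with both ends is an edge below `a'`, which `a'` keeps at the front. -/
theorem earlier_bothPair {a a' : ω} (hI : M.Mem I) (h1 : M.one ∉ I) (h2 : M.two ∉ I)
    (hA1 : M.one ∈ M.A) (hA2 : M.two ∈ M.A) (ha : a ∈ M.EA) (ha' : a' ∈ M.EA)
    (haa : M.rk a < M.rk a')
    (hZ' : M.Atom (I ∪ {M.one, M.two, a, a'}) Z') (he : M.Earlier I {M.one, M.two, a, a'} Z)
    (hp : M.Prec (I ∪ {M.one, M.two, a, a'}) Z' Z) : M.Earlier I {M.one, M.two, a, a'} Z' := by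
  have hX : M.Atom I {M.one, M.two, a, a'} :=
    .bothPair a a' h1 h2 hA1 hA2 ha ha' (by rintro rfl; omega)
  have hJ := hI.union_atom hX
  have hcX : M.cls {M.one, M.two, a, a'} = 2 := cls_two (by simp) (by simp)
  have hfr : ∀ {p}, M.Front (I ∪ {M.one, M.two, a, a'}) p ↔ M.rk p ≤ M.rk a' := by
    refine fun {p} => ⟨?_, fun h => ⟨a', by simp, .inl ha', h⟩⟩
    rintro ⟨f, hf | rfl | rfl | rfl | rfl, hfE, hpf⟩
    · exact absurd hf (hI.notMem_of_ends ends_one_two h2 hfE)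
    · exact absurd hfE (by simp [one_notMem_EA, one_notMem_EB])
    · exact absurd hfE (by simp [two_notMem_EA, two_notMem_EB])
    · omega
    · exact hpf
  refine earlier_both hI h1 h2 hA1 hA2 hX (by simp) (by simp)
    (by rintro x (rfl | rfl | rfl | rfl) <;> simp [ha, ha']) hZ' he hp ?_ ?_
  · intro p hpZ hpE hpf
    have hpJ := hJ.atom_disjoint hZ' p hpZ
    simp only [Set.mem_union, Set.mem_insert_iff, Set.mem_singleton_iff, not_or] at hpJ
    have hle := hfr.1 hpf
    have hlt : M.rk p < M.rk a' := hle.lt_of_ne fun h => hpJ.2.2.2.2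
      (rk_injOn (hZ'.subset_U hpZ) (mem_U.2 (by tauto)) h)
    have hpA : p ∈ M.EA := hpE.resolve_right fun h => absurd (M.rk_EA_EB ha' h) hle.not_gt
    have hat : M.Atom I {M.one, M.two, a, p} :=
      .bothPair a p h1 h2 hA1 hA2 ha hpA (Ne.symm hpJ.2.2.2.1)
    refine .inl ⟨_, hat, prec_of hat.subset_U hX.subset_U
      (by rw [hcX, cls_two (by simp) (by simp)]) (y := p) (by simp) (by simp [hpJ]) ?_, ?_⟩
    · rintro x (rfl | rfl | rfl | rfl) hx
      exacts [absurd (by simp) hx, absurd (by simp) hx, absurd (by simp) hx,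
        (key_E_E hpE (.inl ha')).2 hlt]
    · rintro z (rfl | rfl | rfl | rfl)
      exacts [.inl (by simp), .inl (by simp), .inl (by simp), .inr hpZ]
  · intro Y hY ho ht y hyY hyX hy
    have hya : M.key I y < M.key I a' := by
      by_cases h' : a' ∈ Y
      · by_cases h : a ∈ Y
        · refine absurd ?_ hyX
          rw [hX.eq_of_subset hY (by rintro z (rfl | rfl | rfl | rfl) <;> assumption)]
          exact hyY
        · exact (hy a (by simp) h).trans ((key_E_E (.inl ha) (.inl ha')).2 haa)
      · exact hy a' (by simp) h'
    rcases hY.cases_none h1 h2 with ⟨s, t, hst, hs, ht', -, rfl⟩ | ⟨z, z', hz, hzA, rfl⟩ |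
      ⟨z, z', u, hz, hzA, hu, huI, hul, rfl⟩ | ⟨-, -, ⟨c, hc, rfl⟩ | ⟨c, hc, c', hc', -, rfl⟩⟩
    · exact absurd ho (by simp [hs.ne_one.symm, ht'.ne_one.symm])
    · exact absurd (ho.trans ht.symm) one_ne_two
    · exfalso
      rcases ho with ho | ho
      · rcases ht with ht | ht
        exacts [one_ne_two (ho.trans ht.symm), two_notMem_W (ht ▸ hu)]
      · exact one_notMem_W (ho ▸ hu)
    · have hyc : y = c := by
        rcases hyY with rfl | rfl | h
        exacts [absurd (by simp) hyX, absurd (by simp) hyX, h]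
      subst hyc
      exact ⟨.inr hc, hfr.2 ((key_E_E (.inr hc) (.inl ha')).1 hya).le⟩
    · have hyA : y ∈ M.EA := by
        rcases hyY with rfl | rfl | rfl | rfl
        exacts [absurd (by simp) hyX, absurd (by simp) hyX, hc, hc']
      exact ⟨.inl hyA, hfr.2 ((key_E_E (.inl hyA) (.inl ha')).1 hya).le⟩

end none

/-- Atoms above an earlier atom come first. -/
theorem earlier_of_prec (hI : M.Mem I) (hX : M.Atom I X) (hZ : M.Atom (I ∪ X) Z)
    (hZ' : M.Atom (I ∪ X) Z') (he : M.Earlier I X Z) (hp : M.Prec (I ∪ X) Z' Z) :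
    M.Earlier I X Z' := by
  have hpair : ∀ {x y}, x ≠ y → M.Free I x → M.Free I y → M.Linked (I ∪ {x, y}) x y →
      X = {x, y} → M.Earlier I X Z' := by
    rintro x y hxy hx hy hl rfl
    obtain ⟨x₁, x₂, h, hs⟩ := exists_ordPair hI hxy hx hy hl
    rw [hs] at hZ hZ' he hp ⊢
    exact h.earlier_of_prec hZ hZ' he hp
  rcases ends_cases (M := M) I with ⟨h1, h2⟩ | ⟨h1, h2⟩ | ⟨w, w', hw, hwI, hwI'⟩
  · rcases hX.cases_both h1 h2 with ⟨b, hb, hbI, rfl⟩ | ⟨x, y, hxy, hx, hy, hl, h⟩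
    · exact earlier_of_edge hI hb hbI h1 h2 hZ' he
        (lex_of_both (hI.union_atom hX) (.inl h1) (.inl h2) hZ' hp)
    · exact hpair hxy hx hy hl h
  · rcases hX.cases_none h1 h2 with ⟨x, y, hxy, hx, hy, hl, h⟩ | ⟨w, w', hw, hA, rfl⟩ |
      ⟨w, w', v, hw, hA, hv, hvI, hl, rfl⟩ | ⟨hA1, hA2, ⟨b, hb, rfl⟩ | ⟨a, ha, a', ha', haa, rfl⟩⟩
    · exact hpair hxy hx hy hl h
    · obtain ⟨hwI, hwI'⟩ := notMem_of_ends_notMem hw h1 h2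
      exact earlier_single hI hw hwI hwI' hA hZ' he hp
    · exact earlier_endVertex hI hw h1 h2 hA hv hvI hl hZ' he hp
    · exact earlier_bothFreeEdge hI h1 h2 hA1 hA2 hb hZ' he hp
    · rcases lt_trichotomy (M.rk a) (M.rk a') with h | h | h
      · exact earlier_bothPair hI h1 h2 hA1 hA2 ha ha' h hZ' he hp
      · exact absurd (rk_injOn (mem_U.2 (by tauto)) (mem_U.2 (by tauto)) h) haa
      · rw [Set.pair_comm a a'] at hZ' he hp ⊢
        exact earlier_bothPair hI h1 h2 hA1 hA2 ha' ha h hZ' he hp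
  · exact earlier_one hI hw hwI hwI' hX hZ hZ' he hp

end EvenModel

/-! ### The exchange condition -/

namespace EvenModel

variable {ω : Type*} {M : EvenModel ω} {I J X X' Y Z : Set ω}

theorem Earlier.of_atom (hI : M.Mem I) (hX' : M.Atom I X') (hp : M.Prec I X' X)
    (h : ∀ x ∈ X', x ∈ I ∪ X ∨ x ∈ Z) : M.Earlier I X Z := by
  refine ⟨X', hX', hp, fun x hx => ?_⟩
  rcases h x hx with (h | h) | h
  exacts [absurd h (hI.atom_disjoint hX' x hx), .inl h, .inr h]

theorem not_subset_of_prec (hI : M.Mem I) (hX' : M.Atom I X') (hX : M.Atom I X)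
    (hp : M.Prec I X' X) : ∃ x ∈ X', x ∉ I ∪ X := by
  by_contra! h
  have hs : X' ⊆ X := fun x hx => (h x hx).resolve_left (hI.atom_disjoint hX' x hx)
  rw [hX'.eq_of_subset hX hs] at hp
  exact hp.irrefl

/-- Every letter of an element above `J` belongs to an atom, if the ends of the bundle are in `J`. -/
theorem exists_atom_mem (hJ : M.Mem J) (hY : M.Mem Y) (hJY : J ⊆ Y) (h1 : M.one ∈ J)
    (h2 : M.two ∈ J) {y : ω} (hyY : y ∈ Y) (hyJ : y ∉ J) : ∃ Z, M.Atom J Z ∧ Z ⊆ Y ∧ y ∈ Z := by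
  have hfree : y ∈ M.W ∨ y ∈ M.EA → ∃ Z, M.Atom J Z ∧ Z ⊆ Y ∧ y ∈ Z := fun h => by
    obtain ⟨u, huY, -, -, -, hat⟩ := exists_pair_atom hJ hY hJY hyY
      ⟨hyJ, h.imp id fun h => ⟨h, h1, h2⟩⟩ ⟨fun _ => h1, fun _ => h2⟩
    exact ⟨_, hat, by rintro z (rfl | rfl) <;> assumption, by simp⟩
  rcases mem_U.1 (hY.subset hyY) with rfl | rfl | h | h | h
  · contradiction
  · contradiction
  · exact hfree (.inl h)
  · exact hfree (.inr h)
  · exact ⟨{y}, .edge y h hyJ h1 h2, by simpa using hyY, rfl⟩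

theorem exists_atom_mem_pair (hJ : M.Mem J) (hY : M.Mem Y) (hJY : J ⊆ Y)
    (hends : (M.one ∈ Y → M.one ∈ J) ∧ (M.two ∈ Y → M.two ∈ J)) {s t : ω} (hst : s ≠ t)
    (hsY : s ∈ Y) (htY : t ∈ Y) (hs : s ∈ M.W ∨ (s ∈ M.EA ∧ M.one ∈ J ∧ M.two ∈ J))
    (ht : t ∈ M.W ∨ (t ∈ M.EA ∧ M.one ∈ J ∧ M.two ∈ J)) (hl : M.Linked (J ∪ {s, t}) s t)
    (hn : ¬ (s ∈ J ∧ t ∈ J)) : ∃ Z, M.Atom J Z ∧ Z ⊆ Y ∧ (s ∈ J ∨ s ∈ Z) ∧ (t ∈ J ∨ t ∈ Z) := by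
  by_cases hsJ : s ∈ J
  · obtain ⟨u, huY, -, -, -, hat⟩ := exists_pair_atom hJ hY hJY htY ⟨by tauto, ht⟩ hends
    exact ⟨_, hat, by rintro z (rfl | rfl) <;> assumption, .inl hsJ, .inr (by simp)⟩
  by_cases htJ : t ∈ J
  · obtain ⟨u, huY, -, -, -, hat⟩ := exists_pair_atom hJ hY hJY hsY ⟨hsJ, hs⟩ hends
    exact ⟨_, hat, by rintro z (rfl | rfl) <;> assumption, .inr (by simp), .inl htJ⟩
  exact ⟨{s, t}, .pair s t hst ⟨hsJ, hs⟩ ⟨htJ, ht⟩ hl,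
    by rintro z (rfl | rfl) <;> assumption, .inr (by simp), .inr (by simp)⟩

/-- If `Y` offers a new end, an atom over `J` containing an end makes an atom with an end available
over `I`, and that precedes `X`. Otherwise the letters of `X'` missing from `J` lie in a single atom
over `J`: they are one letter, completed by parity, or a linked pair. -/
theorem exchange_noEnds (hI : M.Mem I) (hX' : M.Atom I X') (hX : M.Atom I X)
    (hp : M.Prec I X' X) (hY : M.Mem Y) (hJY : I ∪ X ⊆ Y) (hXY : X' ⊆ Y) (hc : M.cls X = 3) :
    ∃ Z, M.Atom (I ∪ X) Z ∧ Z ⊆ Y ∧ M.Earlier I X Z := by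
  have hJ := hI.union_atom hX
  obtain ⟨h1X, h2X⟩ := noEnds_of_cls hc
  by_cases hend : (M.one ∈ Y ∧ M.one ∉ I ∪ X) ∨ (M.two ∈ Y ∧ M.two ∉ I ∪ X)
  · obtain ⟨Z, hZ, hZY, hcZ⟩ := exists_atom_with_end hJ hY hJY hend
    have hZe : M.one ∈ Z ∨ M.two ∈ Z := by
      by_contra! h
      rw [cls_three h.1 h.2] at hcZ
      omega
    have hd := hJ.ends_disjoint hZ
    obtain ⟨Y', hY', hYs, hcY⟩ := exists_atom_with_end hI (hJ.union_atom hZ)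
      (fun z hz => .inl (.inl hz)) (by
        rcases hZe with h | h
        · exact .inl ⟨.inr h, fun h' => hd.1 (.inl h') h⟩
        · exact .inr ⟨.inr h, fun h' => hd.2 (.inl h') h⟩)
    exact ⟨Z, hZ, hZY, Y', hY', .inl (hc ▸ hcY), subset_of_atom hI hY' hYs⟩
  · have hends : (M.one ∈ Y → M.one ∈ I ∪ X) ∧ (M.two ∈ Y → M.two ∈ I ∪ X) :=
      ⟨fun h => by_contra fun h' => hend (.inl ⟨h, h'⟩), fun h => by_contra fun h' => hend (.inr ⟨h, h'⟩)⟩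
    have hd := hI.ends_disjoint hX'
    have h1' : M.one ∉ X' := fun h => hd.1 ((hends.1 (hXY h)).resolve_right h1X) h
    have h2' : M.two ∉ X' := fun h => hd.2 ((hends.2 (hXY h)).resolve_right h2X) h
    obtain ⟨x, hx, hxJ⟩ := not_subset_of_prec hI hX' hX hp
    rcases hX'.cases_noEnds h1' h2' with ⟨b, hb, hbI, ho, ht, rfl⟩ | ⟨s, t, hst, hs, ht, hl, rfl⟩
    · obtain rfl : x = b := hx
      exact ⟨{x}, .edge x hb hxJ (.inl ho) (.inl ht), hXY,
        .of_atom hI hX' hp fun z hz => .inr hz⟩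
    · have hk : ∀ {z}, M.Free I z → z ∈ M.W ∨ (z ∈ M.EA ∧ M.one ∈ I ∪ X ∧ M.two ∈ I ∪ X) :=
        fun hz => hz.2.imp id fun h => ⟨h.1, .inl h.2.1, .inl h.2.2⟩
      obtain ⟨Z, hZ, hZY, hsZ, htZ⟩ := exists_atom_mem_pair hJ hY hJY hends hst
        (hXY (by simp)) (hXY (by simp)) (hk hs) (hk ht)
        (hl.mono (Set.union_subset_union_left _ Set.subset_union_left)) (by
          rintro ⟨h, h'⟩
          rcases hx with rfl | rfl <;> contradiction)
      exact ⟨Z, hZ, hZY, .of_atom hI hX' hp (by rintro z (rfl | rfl) <;> assumption)⟩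

/-- The end `w'` is already in `X`. If the rest of `X'` is one letter or a linked pair, an atom over
`J` contains what is missing. Only in the case of an edge outside `A` together with a vertex need
the two missing letters not lie in one atom. -/
theorem exchange_one {w w' : ω} (hI : M.Mem I) (hX' : M.Atom I X') (hX : M.Atom I X)
    (hp : M.Prec I X' X) (hY : M.Mem Y) (hJY : I ∪ X ⊆ Y) (hXY : X' ⊆ Y) (hw : M.Ends w w')
    (hwI : w ∈ I) (hwI' : w' ∉ I) (hc : M.cls X < 3) :
    ∃ Z, M.Atom (I ∪ X) Z ∧ Z ⊆ Y ∧ M.Earlier I X Z := by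
  have hJ := hI.union_atom hX
  have hnw : ∀ {X}, M.Atom I X → w ∉ X := fun hX h => hI.atom_disjoint hX _ h hwI
  have hmem : ∀ {X}, M.Atom I X → M.cls X < 3 → w' ∈ X := fun {X} hX hc => by
    by_contra h
    have h' := hnw hX
    have : M.cls X = 3 := by
      rcases hw with ⟨rfl, rfl⟩ | ⟨rfl, rfl⟩
      exacts [cls_three h' h, cls_three h h']
    omega
  have hwX := hmem hX hc
  obtain ⟨h1, h2⟩ : M.one ∈ I ∪ X ∧ M.two ∈ I ∪ X := hw.iff.2 ⟨.inl hwI, .inr hwX⟩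
  obtain ⟨x, hx, hxJ⟩ := not_subset_of_prec hI hX' hX hp
  have hxw : x ≠ w' := fun h => hxJ (.inr (h ▸ hwX))
  have hc' : M.cls X' < 3 := by rcases hp with h | h <;> omega
  have hedge : ∀ {e}, X' = {w', e} → ∃ Z, M.Atom (I ∪ X) Z ∧ Z ⊆ Y ∧ M.Earlier I X Z := by
    rintro e rfl
    obtain rfl : x = e := hx.resolve_left hxw
    obtain ⟨Z, hZ, hZY, hxZ⟩ := exists_atom_mem hJ hY hJY h1 h2 (hXY hx) hxJ
    exact ⟨Z, hZ, hZY, .of_atom hI hX' hp (by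
      rintro z (rfl | rfl)
      exacts [.inl (.inr hwX), .inr hxZ])⟩
  rcases hX'.cases_one hw hwI hwI' with ⟨s, t, hst, hs, ht, -, rfl⟩ |
      ⟨hA, ⟨a', ha', h⟩ | ⟨b', hb', v', hv', hvI', hl', rfl⟩⟩ |
      ⟨hA, ⟨b', hb', h⟩ | ⟨a, ha, y, hy, hyI, hay, hl, rfl⟩⟩
  · have h3 : M.cls {s, t} = 3 := cls_three (by simp [hs.ne_one.symm, ht.ne_one.symm])
      (by simp [hs.ne_two.symm, ht.ne_two.symm])
    omega
  · exact hedge h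
  · have hc1 : M.cls {w', b', v'} = 1 := cls_one hw (hnw hX') (by simp) ⟨b', hb', by simp⟩
    have hbv : ∀ {b v}, b ∈ M.EB → v ∈ M.W → b ≠ v := fun hb hv h => W_EB hv (h ▸ hb)
    have hwb : ∀ {b}, b ∈ M.EB → b ≠ w' := fun hb h => hw.symm.notMem_EB (h ▸ hb)
    have hwv : ∀ {v}, v ∈ M.W → v ≠ w' := fun hv h => hw.symm.notMem_W (h ▸ hv)
    rcases hX.cases_one hw hwI hwI' with ⟨s, t, hst, hs, ht, -, rfl⟩ |
      ⟨-, ⟨a, ha, rfl⟩ | ⟨b, hb, v, hv, hvI, hl, rfl⟩⟩ | ⟨hA', -⟩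
    · have h3 : M.cls {s, t} = 3 := cls_three (by simp [hs.ne_one.symm, ht.ne_one.symm])
        (by simp [hs.ne_two.symm, ht.ne_two.symm])
      omega
    · have h0 : M.cls {w', a} = 0 := cls_zero hw (hnw hX) (by simp) (by
        rintro b hb (rfl | rfl)
        exacts [hw.symm.notMem_EB hb, EA_EB ha hb])
      rcases hp with h | h <;> omega
    · have hc2 : M.cls {w', b, v} = 1 := cls_one hw (hnw hX) (by simp) ⟨b, hb, by simp⟩
      have hlex : M.Lex I {w', b', v'} {w', b, v} := by
        rcases hp with h | h
        · omega
        · exact h.2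
      obtain ⟨y, hyX', hyX, hy⟩ := hlex.exists hX'.subset_U hX.subset_U
      have hyJ : y ∉ I ∪ {w', b, v} := by
        rintro (h | h)
        exacts [hI.atom_disjoint hX' y hyX' h, hyX h]
      -- Only the gained letter `y` is placed in `Z`. Exchanging it alone for the letter of `X` of
      -- the same kind gives an atom before `X`, which may differ from `X'`.
      obtain ⟨Z, hZ, hZY, hyZ⟩ := exists_atom_mem hJ hY hJY h1 h2 (hXY hyX') hyJ
      refine ⟨Z, hZ, hZY, ?_⟩
      have hyX0 := hyX
      simp only [Set.mem_insert_iff, Set.mem_singleton_iff, not_or] at hyX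
      rcases hyX' with h | rfl | rfl
      · exact absurd h hyX.1
      · have hlt := hy b (by simp) (by
          rintro (h | h | h)
          exacts [hwb hb h, hyX.2.1 h.symm, hbv hb hv' h])
        have hat : M.Atom I {w', y, v} := .endEdgeVertex w w' y v hw hwI hwI' hA hb' hv hvI hl
        refine .of_atom hI hat (prec_of hat.subset_U hX.subset_U ?_ (y := y) (by simp) hyX0 ?_) ?_
        · rw [hc2, cls_one hw (hnw hat) (by simp) ⟨y, hb', by simp⟩]
        · rintro t (rfl | rfl | rfl) ht
          exacts [absurd (by simp) ht, hlt, absurd (by simp) ht]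
        · rintro t (rfl | rfl | rfl)
          exacts [.inl (by simp), .inr hyZ, .inl (by simp)]
      · have hlt := hy v (by simp) (by
          rintro (h | h | h)
          exacts [hwv hv h, hbv hb' hv h.symm, hyX.2.2 h.symm])
        have hat : M.Atom I {w', b, y} := .endEdgeVertex w w' b y hw hwI hwI' hA hb hv' hvI' hl'
        refine .of_atom hI hat (prec_of hat.subset_U hX.subset_U ?_ (y := y) (by simp) hyX0 ?_) ?_
        · rw [hc2, cls_one hw (hnw hat) (by simp) ⟨b, hb, by simp⟩]
        · rintro t (rfl | rfl | rfl) ht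
          exacts [absurd (by simp) ht, absurd (by simp) ht, hlt]
        · rintro t (rfl | rfl | rfl)
          exacts [.inl (by simp), .inl (by simp), .inr hyZ]
    · exact absurd hA hA'
  · exact hedge h
  · have hk : y ∈ M.W ∨ (y ∈ M.EA ∧ M.one ∈ I ∪ X ∧ M.two ∈ I ∪ X) := hy.imp id fun h => ⟨h, h1, h2⟩
    have hwJ : w' ∈ I ∪ X ∪ {a, y} := .inl (.inr hwX)
    have hl' : M.Linked (I ∪ X ∪ {a, y}) a y :=
      (Linked.of_adj (M.adj_symm (hw.symm.adj_EA ha)) (by simp) hwJ).trans (hl.mono (by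
        rintro t (ht | rfl | rfl)
        exacts [.inl (.inl ht), hwJ, by simp]))
    obtain ⟨Z, hZ, hZY, haZ, hyZ⟩ := exists_atom_mem_pair hJ hY hJY ⟨fun _ => h1, fun _ => h2⟩ hay
      (hXY (by simp)) (hXY (by simp)) (.inr ⟨ha, h1, h2⟩) hk hl' (by
        rintro ⟨h, h'⟩
        rcases hx with rfl | rfl | rfl <;> contradiction)
    exact ⟨Z, hZ, hZY, .of_atom hI hX' hp (by
      rintro z (rfl | rfl | rfl)
      exacts [.inl (.inr hwX), haZ, hyZ])⟩

theorem cls_singleton_end {w w' : ω} (hw : M.Ends w w') : M.cls {w'} = 0 :=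
  cls_zero hw (by simpa using hw.ne) rfl (by rintro b hb rfl; exact hw.symm.notMem_EB hb)

theorem prec_one {v : ω} (h1 : M.one ∉ I) (h2 : M.two ∉ I) (hA : M.one ∉ M.A) (hv : v ∈ M.W)
    (hX : M.Atom I {M.two, v}) : M.Atom I {M.one} ∧ M.Prec I {M.one} {M.two, v} := by
  have hat : M.Atom I {M.one} := .single _ _ ends_one_two.symm h2 h1 hA
  refine ⟨hat, prec_of hat.subset_U hX.subset_U ?_ rfl ?_ ?_⟩
  · rw [cls_singleton_end ends_one_two.symm]; exact Nat.zero_le _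
  · rintro (h | h)
    exacts [one_ne_two h, one_notMem_W (Set.mem_singleton_iff.1 h ▸ hv)]
  · rintro x (rfl | rfl) -
    exacts [key_one_two, key_end ends_one_two (.inl hv)]

/-- Class 0 atoms differ from `X` by the other end, which can be added over `J`, or by a vertex. If
`X` contains both ends, what `X'` adds is one letter or two edges in `A`, and these lie in an atom
over `J`. -/
theorem exchange_none (hI : M.Mem I) (hX' : M.Atom I X') (hX : M.Atom I X)
    (hp : M.Prec I X' X) (hY : M.Mem Y) (hJY : I ∪ X ⊆ Y) (hXY : X' ⊆ Y) (h1 : M.one ∉ I)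
    (h2 : M.two ∉ I) (hc : M.cls X < 3) :
    ∃ Z, M.Atom (I ∪ X) Z ∧ Z ⊆ Y ∧ M.Earlier I X Z := by
  have hJ := hI.union_atom hX
  obtain ⟨x, hx, hxJ⟩ := not_subset_of_prec hI hX' hX hp
  have hc' : M.cls X' < 3 := by rcases hp with h | h <;> omega
  have hother : ∀ {w w'}, M.Ends w w' → w' ∈ X → w ∉ X → w ∈ Y →
      ∃ Z, M.Atom (I ∪ X) Z ∧ Z ⊆ Y ∧ w ∈ Z := fun {w w'} hw hw'X hwX hwY =>
    exists_atom_of_other_end hJ hY hJY hw.symm (.inr hw'X) (by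
      rintro (h | h)
      exacts [(notMem_of_ends_notMem hw h1 h2).1 h, hwX h]) hwY
  rcases hX.cases_none h1 h2 with ⟨s, t, hst, hs, ht, hl, rfl⟩ | ⟨w, w', hw, hA, rfl⟩ |
      ⟨w, w', v, hw, hA, hv, hvI, hl, rfl⟩ | ⟨hA1, hA2, hh⟩
  · have h3 : M.cls {s, t} = 3 := cls_three (by simp [hs.ne_one.symm, ht.ne_one.symm])
      (by simp [hs.ne_two.symm, ht.ne_two.symm])
    omega
  · have hcX := cls_singleton_end hw
    have hlex : M.Lex I X' {w'} := by
      rcases hp with h | h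
      · omega
      · exact h.2
    obtain ⟨y, hyX', hyX, hy⟩ := hlex.exists hX'.subset_U hX.subset_U
    have hwX' : w' ∉ X' := fun h =>
      hyX (by rw [hX.eq_of_subset hX' (by simpa using h)]; exact hyX')
    have hlt := hy w' rfl hwX'
    have hyw : y = w := by
      rcases mem_U.1 (hX'.subset_U hyX') with h | h | h
      · exact (hw.eq_or_eq (.inl h)).resolve_right hyX
      · exact (hw.eq_or_eq (.inr h)).resolve_right hyX
      · exact absurd (key_end hw.symm h) hlt.not_gt
    subst hyw
    have hA1 : y ∉ M.A := fun h => hA (by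
      rcases hw with ⟨rfl, rfl⟩ | ⟨rfl, rfl⟩
      · exact M.two_mem_A h
      · exact absurd key_one_two hlt.not_gt)
    obtain ⟨Z, hZ, hZY, hyZ⟩ := hother hw rfl hyX (hXY hyX')
    obtain ⟨hyI, hwI'⟩ := notMem_of_ends_notMem hw h1 h2
    have hat : M.Atom I {y} := .single w' y hw.symm hwI' hyI hA1
    refine ⟨Z, hZ, hZY, .of_atom hI hat (prec_of hat.subset_U hX.subset_U ?_ rfl hyX ?_) ?_⟩
    · rw [cls_singleton_end hw.symm]; exact Nat.zero_le _
    · rintro t rfl -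
      exact hlt
    · rintro t rfl
      exact .inr hyZ
  · have hcX := cls_endVertex hw hv
    have hwX : w ∉ ({w', v} : Set ω) := by
      rintro (h | h)
      exacts [hw.ne h, hw.notMem_W (Set.mem_singleton_iff.1 h ▸ hv)]
    have hcX' : M.cls X' = 0 := by rcases hp with h | h <;> omega
    have hdone : w ∈ X' → X' ⊆ insert w {w', v} →
        ∃ Z, M.Atom (I ∪ {w', v}) Z ∧ Z ⊆ Y ∧ M.Earlier I {w', v} Z := fun hwX' hs => by
      obtain ⟨Z, hZ, hZY, hwZ⟩ := hother hw (by simp) hwX (hXY hwX')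
      refine ⟨Z, hZ, hZY, .of_atom hI hX' hp fun z hz => ?_⟩
      rcases hs hz with rfl | h
      exacts [.inr hwZ, .inl (.inr h)]
    rcases hX'.cases_none h1 h2 with ⟨s, t, hst, hs, ht, -, rfl⟩ | ⟨z, z', hz, hzA, rfl⟩ |
      ⟨z, z', u, hz, hzA, hu, huI, hul, rfl⟩ | ⟨-, -, hh⟩
    · have h3 : M.cls {s, t} = 3 := cls_three (by simp [hs.ne_one.symm, ht.ne_one.symm])
        (by simp [hs.ne_two.symm, ht.ne_two.symm])
      omega
    · have hzw : z' = w := (hw.eq_or_eq hz.eq_one_or_two).resolve_right fun h => hzA (h ▸ hA)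
      subst hzw
      exact hdone rfl (by simp)
    · by_cases hA1 : M.one ∈ M.A
      · have huv := linked_unique hI h1 hA1 hz.eq_one_or_two hw.eq_one_or_two hu hv huI hvI hul hl
        subst huv
        have hzw : z' = w := (hw.eq_or_eq hz.eq_one_or_two).resolve_right fun h =>
          by rw [h] at hp; exact hp.irrefl
        subst hzw
        exact hdone (by simp) (by rintro t (rfl | rfl) <;> simp)
      · have hw2 : w = M.one ∧ w' = M.two := by
          rcases hw with h | ⟨rfl, rfl⟩
          exacts [h, absurd hA hA1]
        obtain ⟨rfl, rfl⟩ := hw2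
        have hzw : z' = M.two := hz.eq_one_or_two.resolve_left fun h => hA1 (h ▸ hzA)
        subst hzw
        -- If `one` is available, it is an atom before `X` and replaces `X'`. If not, no end can
        -- serve as partner of the new vertex over `J`, so the atom produced is a pair.
        by_cases hoY : M.one ∈ Y
        · obtain ⟨Z, hZ, hZY, hwZ⟩ := hother hw (by simp) hwX hoY
          obtain ⟨hat, hprec⟩ := prec_one h1 h2 hA1 hv hX
          exact ⟨Z, hZ, hZY, .of_atom hI hat hprec (by rintro t rfl; exact .inr hwZ)⟩
        · have hxu : x = u := hx.resolve_left fun h => hxJ (.inr (by simp [h]))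
          subst hxu
          obtain ⟨t, htY, -, -, -, hat⟩ := exists_pair_atom hJ hY hJY (hXY hx) ⟨hxJ, .inl hu⟩
            ⟨fun h => absurd h hoY, fun _ => by simp⟩
          refine ⟨_, hat, by rintro z (rfl | rfl); exacts [hXY hx, htY],
            .of_atom hI hX' hp ?_⟩
          rintro z (rfl | rfl)
          exacts [.inl (by simp), .inr (by simp)]
    · have : M.cls X' = 2 := by
        rcases hh with ⟨b, -, rfl⟩ | ⟨a, -, a', -, -, rfl⟩ <;> exact cls_two (by simp) (by simp)
      omega
  · have h12X : M.one ∈ X ∧ M.two ∈ X := by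
      rcases hh with ⟨b, -, rfl⟩ | ⟨a, -, a', -, -, rfl⟩ <;> simp
    have o1 : M.one ∈ I ∪ X := .inr h12X.1
    have o2 : M.two ∈ I ∪ X := .inr h12X.2
    have hone : (∀ y ∈ X', y ≠ x → y = M.one ∨ y = M.two) →
        ∃ Z, M.Atom (I ∪ X) Z ∧ Z ⊆ Y ∧ M.Earlier I X Z := fun h => by
      obtain ⟨Z, hZ, hZY, hxZ⟩ := exists_atom_mem hJ hY hJY o1 o2 (hXY hx) hxJ
      refine ⟨Z, hZ, hZY, .of_atom hI hX' hp fun y hy => ?_⟩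
      by_cases hyx : y = x
      · exact .inr (hyx ▸ hxZ)
      · rcases h y hy hyx with rfl | rfl
        exacts [.inl o1, .inl o2]
    rcases hX'.cases_none h1 h2 with ⟨s, t, hst, hs, ht, -, rfl⟩ | ⟨z, z', hz, hzA, rfl⟩ |
      ⟨z, z', u, hz, hzA, hu, huI, hul, rfl⟩ | ⟨-, -, ⟨b, -, rfl⟩ | ⟨a, ha, a', ha', haa, rfl⟩⟩
    · have h3 : M.cls {s, t} = 3 := cls_three (by simp [hs.ne_one.symm, ht.ne_one.symm])
        (by simp [hs.ne_two.symm, ht.ne_two.symm])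
      omega
    · rcases hz.eq_one_or_two with rfl | rfl <;> contradiction
    · refine hone ?_
      have hxu : x = u := hx.resolve_left fun h => by
        rcases hz.eq_one_or_two with h' | h' <;> rw [h, h'] at hxJ <;> contradiction
      rintro y (rfl | rfl) hyx
      exacts [hz.eq_one_or_two, absurd hxu.symm hyx]
    · refine hone ?_
      have hxb : x = b := by
        rcases hx with rfl | rfl | h
        exacts [absurd o1 hxJ, absurd o2 hxJ, h]
      rintro y (rfl | rfl | rfl) hyx
      exacts [.inl rfl, .inr rfl, absurd hxb.symm hyx]
    · have hl : M.Linked (I ∪ X ∪ {a, a'}) a a' :=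
        (Linked.of_adj (M.adj_EA_one ha) (by simp) (.inl o1)).trans
          (.of_adj (M.adj_symm (M.adj_EA_one ha')) (.inl o1) (by simp))
      obtain ⟨Z, hZ, hZY, haZ, hyZ⟩ := exists_atom_mem_pair hJ hY hJY
        ⟨fun _ => o1, fun _ => o2⟩ haa (hXY (by simp)) (hXY (by simp)) (.inr ⟨ha, o1, o2⟩)
        (.inr ⟨ha', o1, o2⟩) hl (by
          rintro ⟨h, h'⟩
          rcases hx with rfl | rfl | rfl | rfl <;> contradiction)
      exact ⟨Z, hZ, hZY, .of_atom hI hX' hp (by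
        rintro z (rfl | rfl | rfl | rfl)
        exacts [.inl o1, .inl o2, haZ, hyZ])⟩

/-- The exchange condition. -/
theorem exchange (hI : M.Mem I) (hX' : M.Atom I X') (hX : M.Atom I X)
    (hp : M.Prec I X' X) (hY : M.Mem Y) (hJY : I ∪ X ⊆ Y) (hXY : X' ⊆ Y) :
    ∃ Z, M.Atom (I ∪ X) Z ∧ Z ⊆ Y ∧ M.Earlier I X Z := by
  rcases (cls_le (M := M) X).lt_or_eq with hc | hc
  swap
  · exact exchange_noEnds hI hX' hX hp hY hJY hXY hc
  rcases ends_cases (M := M) I with ⟨h1, h2⟩ | ⟨h1, h2⟩ | ⟨w, w', hw, hwI, hwI'⟩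
  · have hd := hI.ends_disjoint hX
    rw [cls_three (hd.1 h1) (hd.2 h2)] at hc
    exact absurd hc (lt_irrefl _)
  · exact exchange_none hI hX' hX hp hY hJY hXY h1 h2 hc
  · exact exchange_one hI hX' hX hp hY hJY hXY hw hwI hwI' hc

end EvenModel

/-! ### From recursive atom orderings to CL-labelings -/

namespace PosetShelling

section CL

variable {P : Type*} [PartialOrder P] (r : P → P → P → Prop)

/-- The number of atoms of `[b, ⊤]` before `z`. -/
noncomputable def atomIndex (b z : P) : ℤ := ({a | b ⋖ a ∧ r b a z}.ncard : ℤ)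

/-- The number of atoms of `[b, ⊤]` that lie above an atom of `[x, ⊤]` preceding `b`. -/
noncomputable def earlierCount (x b : P) : ℤ :=
  ({z | b ⋖ z ∧ AboveEarlierAtom x (r x) b z}.ncard : ℤ)

open scoped Classical in
/-- The difference of the labels of two consecutive covers `x ⋖ b ⋖ z`. -/
noncomputable def labelStep (x b z : P) : ℤ :=
  -- The atoms above an earlier atom come first, so the index of `z`, counted from 0, is below their
  -- number exactly if `z` is one of them. The added 1 makes the remaining differences positive
  -- instead of nonnegative.
  atomIndex r b z - earlierCount r x b + if AboveEarlierAtom x (r x) b z then 0 else 1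

/-- The increment of the label at the cover `x ⋖ y`, when the preceding element of the chain is
given by `p`. -/
noncomputable def nextStep (p : Option P) (x y : P) : ℤ :=
  match p with
  | none => atomIndex r x y
  | some w => labelStep r w x y

/-- The labels of a chain from `x` on, when the preceding element and label are given. -/
noncomputable def labelsFrom : Option P → ℤ → P → List P → List ℤ
  | _, _, _, [] => []
  | p, ℓ, x, y :: c =>
    (ℓ + nextStep r p x y) :: labelsFrom (some x) (ℓ + nextStep r p x y) y c

variable {r}


theorem FormsRecursiveAtomOrdering.irrefl (h : FormsRecursiveAtomOrdering r) {x a : P}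
    (ha : x ⋖ a) : ¬ r x a a :=
  (h.ordersAtoms x).toIsStrictOrder.toIrrefl.irrefl ⟨a, ha⟩

theorem FormsRecursiveAtomOrdering.trans (h : FormsRecursiveAtomOrdering r) {x a b c : P}
    (ha : x ⋖ a) (hb : x ⋖ b) (hc : x ⋖ c) (hab : r x a b) (hbc : r x b c) : r x a c :=
  (h.ordersAtoms x).toIsStrictOrder.toIsTrans.trans ⟨a, ha⟩ ⟨b, hb⟩ ⟨c, hc⟩ hab hbc

theorem FormsRecursiveAtomOrdering.asymm (h : FormsRecursiveAtomOrdering r) {x a b : P}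
    (ha : x ⋖ a) (hb : x ⋖ b) (hab : r x a b) : ¬ r x b a :=
  fun hba => h.irrefl ha (h.trans ha hb ha hab hba)

theorem FormsRecursiveAtomOrdering.total (h : FormsRecursiveAtomOrdering r) {x a b : P}
    (ha : x ⋖ a) (hb : x ⋖ b) (hne : a ≠ b) : r x a b ∨ r x b a := by
  by_contra! hn
  exact hne (congrArg Subtype.val
    ((h.ordersAtoms x).toTrichotomous.trichotomous ⟨a, ha⟩ ⟨b, hb⟩ hn.1 hn.2))

theorem atomIndex_lt [Finite P] (h : FormsRecursiveAtomOrdering r) {b z z' : P} (hz : b ⋖ z)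
    (hz' : b ⋖ z') (hr : r b z z') : atomIndex r b z < atomIndex r b z' := by
  have : {a | b ⋖ a ∧ r b a z} ⊂ {a | b ⋖ a ∧ r b a z'} := by
    rw [Set.ssubset_iff_of_subset]
    · exact ⟨z, ⟨hz, hr⟩, fun hh => h.irrefl hz hh.2⟩
    · exact fun a ha => ⟨ha.1, h.trans ha.1 hz hz' ha.2 hr⟩
  exact Nat.cast_lt.2 (Set.ncard_lt_ncard this (Set.toFinite _))

theorem labelStep_neg [Finite P] (h : FormsRecursiveAtomOrdering r) {x b z : P} (hb : x ⋖ b)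
    (hz : b ⋖ z) (hz' : AboveEarlierAtom x (r x) b z) : labelStep r x b z < 0 := by
  have : {a | b ⋖ a ∧ r b a z} ⊂ {a | b ⋖ a ∧ AboveEarlierAtom x (r x) b a} := by
    rw [Set.ssubset_iff_of_subset]
    · exact ⟨z, ⟨hz, hz'⟩, fun hh => h.irrefl hz hh.2⟩
    · intro a ha
      refine ⟨ha.1, ?_⟩
      by_contra hn
      exact h.asymm ha.1 hz ha.2 (h.earlierComeFirst x b hb z a hz ha.1 hz' hn)
  have := Set.ncard_lt_ncard this (Set.toFinite _)
  rw [labelStep, if_pos hz', atomIndex, earlierCount]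
  lia

theorem labelStep_pos [Finite P] (h : FormsRecursiveAtomOrdering r) {x b z : P} (hb : x ⋖ b)
    (hz : b ⋖ z) (hz' : ¬ AboveEarlierAtom x (r x) b z) : 0 < labelStep r x b z := by
  have : {a | b ⋖ a ∧ AboveEarlierAtom x (r x) b a} ⊆ {a | b ⋖ a ∧ r b a z} :=
    fun a ha => ⟨ha.1, h.earlierComeFirst x b hb a z ha.1 hz ha.2 hz'⟩
  have := Set.ncard_le_ncard this (Set.toFinite _)
  rw [labelStep, if_neg hz', atomIndex, earlierCount]
  lia

theorem labelStep_lt [Finite P] (h : FormsRecursiveAtomOrdering r) {x b z z' : P} (hb : x ⋖ b)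
    (hz : b ⋖ z) (hz' : b ⋖ z') (hr : r b z z') : labelStep r x b z < labelStep r x b z' := by
  by_cases h1 : AboveEarlierAtom x (r x) b z
  · by_cases h2 : AboveEarlierAtom x (r x) b z'
    · have := atomIndex_lt h hz hz' hr
      simp only [labelStep, if_pos h1, if_pos h2]
      lia
    · exact (labelStep_neg h hb hz h1).trans (labelStep_pos h hb hz' h2)
  · by_cases h2 : AboveEarlierAtom x (r x) b z'
    · exact absurd (h.earlierComeFirst x b hb z' z hz' hz h2 h1) (h.asymm hz hz' hr)
    · have := atomIndex_lt h hz hz' hr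
      simp only [labelStep, if_neg h1, if_neg h2]
      lia

theorem nextStep_lt [Finite P] (h : FormsRecursiveAtomOrdering r) {p : Option P} {b z z' : P}
    (hp : ∀ w ∈ p, w ⋖ b) (hz : b ⋖ z) (hz' : b ⋖ z') (hr : r b z z') :
    nextStep r p b z < nextStep r p b z' := by
  cases p with
  | none => exact atomIndex_lt h hz hz' hr
  | some w => exact labelStep_lt h (hp w rfl) hz hz' hr

theorem le_of_isChain_covBy {y : P} : ∀ {c : List P} {x : P}, (x :: c).IsChain (· ⋖ ·) →
    (x :: c).getLast? = some y → x ≤ y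
  | [], x, _, hl => by simp at hl; exact hl.le
  | z :: c, x, hc, hl => by
    rw [List.isChain_cons_cons] at hc
    rw [List.getLast?_cons_cons] at hl
    exact hc.1.le.trans (le_of_isChain_covBy hc.2 hl)

/-- A chain whose first step is not the earliest possible one has a weak descent. -/
theorem not_pairwise_labelsFrom [Finite P] (h : FormsRecursiveAtomOrdering r) {y : P} :
    ∀ {d : List P} {x a a₀ : P} (ℓ : ℤ), x ⋖ a → (a :: d).IsChain (· ⋖ ·) →
      (a :: d).getLast? = some y → x ⋖ a₀ → a₀ ≤ y → r x a₀ a →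
      ¬ (ℓ :: labelsFrom r (some x) ℓ a d).Pairwise (· < ·)
  | [], x, a, a₀, ℓ, ha, _, hl, ha₀, hle, hr => by
    simp only [List.getLast?_singleton, Option.some.injEq] at hl
    subst hl
    rcases ha.eq_or_eq ha₀.le hle with he | he
    · exact absurd he ha₀.lt.ne'
    · subst he; exact absurd hr (h.irrefl ha)
  | z :: d, x, a, a₀, ℓ, ha, hc, hl, ha₀, hle, hr => by
    rw [List.isChain_cons_cons] at hc
    rw [List.getLast?_cons_cons] at hl
    have hay : a < y := hc.1.lt.trans_le (le_of_isChain_covBy hc.2 hl)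
    have ha₀y : a₀ < y := hle.lt_of_ne fun he => ha₀.2 ha.lt (he ▸ hay)
    obtain ⟨c, z₀, hxc, hca, haz₀, hcz₀, hz₀y⟩ := h.exchange x a₀ a y ha₀ ha hr ha₀y hay
    intro hp
    rw [labelsFrom] at hp
    -- If the chain goes on above an earlier atom, its label drops. If not, `z₀` comes before `z`
    -- because such atoms come first, and the same situation recurs one step higher. It cannot recur
    -- up to `y`.
    by_cases hz : AboveEarlierAtom x (r x) a z
    · have h1 := labelStep_neg h ha hc.1 hz
      have h2 := List.rel_of_pairwise_cons hp (List.mem_cons_self ..)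
      simp only [nextStep] at h2
      lia
    · have h1 := h.earlierComeFirst x a ha z₀ z haz₀ hc.1 ⟨c, hxc, hca, hcz₀.le⟩ hz
      exact not_pairwise_labelsFrom h _ hc.1 hc.2 hl haz₀ hz₀y h1 (List.Pairwise.of_cons hp)

/-- The chain takes the first atom below `y` at each step. Its labels increase, because nothing
below `y` lies above an earlier atom. Another chain that leaves it has a larger label at that point
and a weak descent afterwards. -/
theorem exists_increasing_chain [Finite P] (h : FormsRecursiveAtomOrdering r) {y : P} (x : P) :
    ∀ (p : Option P) (ℓ : ℤ), (∀ w ∈ p, w ⋖ x) → x ≤ y →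
      ∃ c, IsMaximalChain x y (x :: c) ∧ (labelsFrom r p ℓ x c).Pairwise (· < ·) ∧
        ∀ c', IsMaximalChain x y (x :: c') → c' ≠ c →
          ¬ (labelsFrom r p ℓ x c').Pairwise (· < ·) ∧
            List.Lex (· < ·) (labelsFrom r p ℓ x c) (labelsFrom r p ℓ x c') := by
  induction x using WellFoundedGT.induction with
  | ind x ih =>
  intro p ℓ hp hxy
  rcases hxy.eq_or_lt with rfl | hlt
  · refine ⟨[], ⟨by simp, rfl, rfl⟩, by simp [labelsFrom], ?_⟩
    rintro (_ | ⟨z, c'⟩) hc' hne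
    · exact absurd rfl hne
    · obtain ⟨h1, -, h2⟩ := hc'
      rw [List.isChain_cons_cons] at h1
      rw [List.getLast?_cons_cons] at h2
      exact absurd (h1.1.lt.trans_le (le_of_isChain_covBy h1.2 h2)) (lt_irrefl _)
  · obtain ⟨a₁, ha₁, ha₁y⟩ := exists_covBy_le_of_lt hlt
    obtain ⟨a, ⟨hxa, hay⟩, hmin⟩ := Set.exists_min_image {a | x ⋖ a ∧ a ≤ y} (atomIndex r x)
      (Set.toFinite _) ⟨a₁, ha₁, ha₁y⟩
    have hmin' : ∀ a', x ⋖ a' → a' ≤ y → ¬ r x a' a := fun a' h1 h2 h3 =>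
      absurd (atomIndex_lt h h1 hxa h3) (not_lt.2 (hmin a' ⟨h1, h2⟩))
    obtain ⟨c, ⟨hc1, -, hc2⟩, hc3, hc4⟩ :=
      ih a hxa.lt (some x) (ℓ + nextStep r p x a) (by simpa using hxa) hay
    refine ⟨a :: c, ⟨?_, rfl, ?_⟩, ?_, ?_⟩
    · exact List.isChain_cons_cons.2 ⟨hxa, hc1⟩
    · rwa [List.getLast?_cons_cons]
    · rw [labelsFrom]
      rw [← List.isChain_iff_pairwise] at hc3 ⊢
      cases c with
      | nil => simp [labelsFrom]
      | cons z c =>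
        rw [List.isChain_cons_cons] at hc1
        rw [List.getLast?_cons_cons] at hc2
        rw [labelsFrom] at hc3 ⊢
        refine List.isChain_cons_cons.2 ⟨?_, hc3⟩
        have := labelStep_pos h hxa hc1.1 fun ⟨a', h1, h2, h3⟩ =>
          hmin' a' h1 (h3.trans (le_of_isChain_covBy hc1.2 hc2)) h2
        simp only [nextStep]
        lia
    · rintro (_ | ⟨a', c'⟩) ⟨h1, -, h2⟩ hne
      · simp only [List.getLast?_singleton, Option.some.injEq] at h2
        exact absurd h2 hlt.ne
      · rw [List.isChain_cons_cons] at h1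
        rw [List.getLast?_cons_cons] at h2
        rw [labelsFrom, labelsFrom]
        by_cases he : a' = a
        · subst he
          obtain ⟨h3, h4⟩ := hc4 c' ⟨h1.2, rfl, h2⟩ (fun hh => hne (by rw [hh]))
          exact ⟨fun h5 => h3 h5.of_cons, List.Lex.cons h4⟩
        · have hr : r x a a' := (h.total hxa h1.1 (Ne.symm he)).resolve_right
            (hmin' a' h1.1 (le_of_isChain_covBy h1.2 h2))
          refine ⟨not_pairwise_labelsFrom h _ h1.1 h1.2 h2 hxa hay hr, List.Lex.rel ?_⟩
          have := nextStep_lt h hp hxa h1.1 hr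
          lia

variable [BoundedOrder P]

variable (r) in
/-- The labels of a maximal chain. -/
noncomputable def chainLabel (σ : List P) : ℕ → ℤ
  | 0 => atomIndex r (σ.getD 0 ⊥) (σ.getD 1 ⊥)
  | i + 1 => chainLabel σ i + labelStep r (σ.getD i ⊥) (σ.getD (i + 1) ⊥) (σ.getD (i + 2) ⊥)

theorem chainLabel_congr {σ τ : List P} : ∀ {i : ℕ},
    (∀ j ≤ i + 1, σ.getD j ⊥ = τ.getD j ⊥) → chainLabel r σ i = chainLabel r τ i
  | 0, h => by rw [chainLabel, chainLabel, h 0 (by lia), h 1 (by lia)]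
  | i + 1, h => by
    rw [chainLabel, chainLabel, h i (by lia), h (i + 1) (by lia), h (i + 2) (by lia),
      chainLabel_congr fun j hj => h j (by lia)]

/-- This translates labels indexed by positions in a full maximal chain into labels computed
recursively along the part from `x` on, which suit induction. -/
theorem map_chainLabel_eq {σ : List P} : ∀ {c : List P} {k : ℕ} {p : Option P} {ℓ : ℤ} {x : P},
    (∀ i ≤ c.length, σ.getD (k + i) ⊥ = (x :: c).getD i ⊥) →
    chainLabel r σ k = ℓ + nextStep r p x (σ.getD (k + 1) ⊥) →
    (List.range c.length).map (fun i => chainLabel r σ (k + i)) = labelsFrom r p ℓ x c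
  | [], _, _, _, _, _, _ => rfl
  | y :: c, k, p, ℓ, x, h1, h2 => by
    have hx : σ.getD k ⊥ = x := by simpa using h1 0 (by simp)
    have hy : σ.getD (k + 1) ⊥ = y := by simpa using h1 1 (by simp)
    rw [hy] at h2
    rw [labelsFrom, List.length_cons, List.range_succ_eq_map, List.map_cons, List.map_map]
    congr 1
    rw [← h2, ← map_chainLabel_eq (σ := σ) (k := k + 1)]
    · refine List.map_congr_left fun i _ => ?_
      simp only [Function.comp]
      congr 1
      lia
    · intro i hi
      have := h1 (i + 1) (by simpa using hi)
      rw [List.getD_cons_succ] at this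
      rw [← this]
      congr 1
      lia
    · rw [chainLabel, hx, hy]
      rfl

/-- A poset with a recursive atom ordering is CL-shellable. -/
theorem FormsRecursiveAtomOrdering.clShellable [Finite P] (h : FormsRecursiveAtomOrdering r) :
    CLShellable P := by
  refine ⟨ℤ, inferInstance, chainLabel r, ?_, ?_⟩
  · intro σ τ _ _ d hd i hi
    refine chainLabel_congr fun j hj => ?_
    have h1 : ∀ ρ : List P, ρ.getD j ⊥ = (ρ.take (d + 1)).getD j ⊥ := fun ρ => by
      rw [List.getD_eq_getElem?_getD, List.getD_eq_getElem?_getD,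
        List.getElem?_take_of_lt (by lia)]
    rw [h1 σ, h1 τ, hd]
  · rintro x y hxy s t ⟨hs1, hs2, hs3⟩ -
    obtain ⟨s, rfl⟩ : ∃ s', s = s' ++ [x] := by
      rw [List.getLast?_eq_some_iff] at hs3
      exact hs3
    obtain ⟨p, ℓ, hp, hlab⟩ : ∃ (p : Option P) (ℓ : ℤ), (∀ w ∈ p, w ⋖ x) ∧ ∀ c,
        rootedLabels (chainLabel r) (s ++ [x]) (x :: c) t = labelsFrom r p ℓ x c := by
      have hget : ∀ (c : List P), ∀ i ≤ c.length,
          (s ++ [x] ++ c ++ t.tail).getD (s.length + i) ⊥ = (x :: c).getD i ⊥ := by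
        intro c i hi
        rw [List.append_assoc s, List.singleton_append, List.append_assoc,
          List.getD_append_right _ _ _ _ (by lia), Nat.add_sub_cancel_left, List.getD_append]
        simpa using Nat.lt_succ_of_le hi
      rcases List.eq_nil_or_concat' s with rfl | ⟨s', w, rfl⟩
      -- The root is `x` alone, so there is no preceding cover and labels start from 0.
      · refine ⟨none, 0, by simp, fun c => ?_⟩
        have := map_chainLabel_eq (r := r) (σ := [] ++ [x] ++ c ++ t.tail) (c := c) (k := 0)
          (p := none) (ℓ := 0) (x := x) (hget c) (by simp [chainLabel, nextStep])
        simpa [rootedLabels] using this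
      -- The root ends with `w ⋖ x`, and `w` has position `s'.length`, which is also the index of
      -- the label of this cover.
      · refine ⟨some w, chainLabel r (s' ++ [w] ++ [x]) s'.length, ?_, fun c => ?_⟩
        · rintro _ ⟨⟩
          have := (List.isChain_append.1 (List.append_assoc s' [w] [x] ▸ hs1)).2.1
          simpa using this
        · have h1 : ∀ j ≤ s'.length + 1, (s' ++ [w] ++ [x] ++ c ++ t.tail).getD j ⊥ =
              (s' ++ [w] ++ [x]).getD j ⊥ := fun j hj => by
            rw [List.append_assoc _ c, List.getD_append]
            simp; lia
          have hw : (s' ++ [w] ++ [x] ++ c ++ t.tail).getD s'.length ⊥ = w := by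
            rw [h1 _ (by lia)]; simp
          have hx : (s' ++ [w] ++ [x] ++ c ++ t.tail).getD (s'.length + 1) ⊥ = x := by
            rw [h1 _ le_rfl]; simp
          have := map_chainLabel_eq (r := r) (σ := s' ++ [w] ++ [x] ++ c ++ t.tail) (c := c)
            (k := s'.length + 1) (p := some w) (ℓ := chainLabel r (s' ++ [w] ++ [x]) s'.length)
            (x := x) (by simpa using hget c) (by rw [chainLabel, hw, hx, chainLabel_congr h1]; rfl)
          simpa [rootedLabels] using this
    obtain ⟨c, hc1, hc2, hc3⟩ := exists_increasing_chain h x p ℓ hp hxy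
    refine ⟨x :: c, hc1, by rwa [hlab], fun c' hc' hne => ?_⟩
    obtain ⟨c', rfl⟩ : ∃ d, c' = x :: d := List.head?_eq_some_iff.1 hc'.2.1
    rw [hlab, hlab]
    exact hc3 c' hc' (fun hh => hne (by rw [hh]))

theorem FormsRecursiveAtomOrdering.isRecursiveAtomOrdering [Finite P]
    (h : FormsRecursiveAtomOrdering r) (x : P) (hx : x < ⊤) :
    IsRecursiveAtomOrdering x (r x) := by
  induction x using WellFoundedGT.induction with
  | ind x ih =>
  by_cases hc : x ⋖ ⊤
  · exact .length_one _ _ hc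
  · refine .step x (r x) r hx hc (h.ordersAtoms x) (fun b hb => ih b hb.lt ?_)
      (h.earlierComeFirst x) (h.exchange x)
    exact lt_top_iff_ne_top.2 fun hh => hc (hh ▸ hb)

theorem FormsRecursiveAtomOrdering.admits [Finite P] [Nontrivial P]
    (h : FormsRecursiveAtomOrdering r) : AdmitsRecursiveAtomOrdering P :=
  ⟨r ⊥, h.isRecursiveAtomOrdering ⊥ bot_lt_top⟩

end CL

end PosetShelling

/-! ### Positions in lists without repetition -/

namespace List

variable {γ : Type*}

open scoped Classical in
/-- The index of the first occurrence of `x` in `l`. -/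
noncomputable def position (l : List γ) (x : γ) : ℕ := l.idxOf x

theorem Nodup.position_getElem {l : List γ} (h : l.Nodup) {k : ℕ} (hk : k < l.length) :
    l.position l[k] = k := by
  classical
  exact h.idxOf_getElem k hk

theorem position_inj {l : List γ} {x y : γ} (hx : x ∈ l) (h : l.position x = l.position y) :
    x = y := by
  classical
  exact (idxOf_inj hx).1 h

theorem Nodup.pairwise_position {l : List γ} (h : l.Nodup) :
    l.Pairwise fun x y => l.position x < l.position y := by
  rw [pairwise_iff_getElem]
  intro i j hi hj hij
  rwa [h.position_getElem, h.position_getElem]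

theorem pair_sublist_or {l : List γ} {x y : γ} (hx : x ∈ l) (hy : y ∈ l) (hne : x ≠ y) :
    [x, y].Sublist l ∨ [y, x].Sublist l := by
  induction l with
  | nil => simp at hx
  | cons z l ih =>
    rcases mem_cons.1 hx with rfl | hx'
    · exact .inl (cons_sublist_cons.2 (singleton_sublist.2 ((mem_cons.1 hy).resolve_left hne.symm)))
    · rcases mem_cons.1 hy with rfl | hy'
      · exact .inr (cons_sublist_cons.2 (singleton_sublist.2 hx'))
      · exact (ih hx' hy').imp (.cons _) (.cons _)

theorem Pairwise.pair_sublist_iff {κ : Type*} [LinearOrder κ] {f : γ → κ} {l : List γ}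
    (h : l.Pairwise fun x y => f x < f y) {x y : γ} :
    [x, y].Sublist l ↔ x ∈ l ∧ y ∈ l ∧ f x < f y := by
  constructor
  · intro hs
    exact ⟨hs.subset (by simp), hs.subset (by simp), by simpa using h.sublist hs⟩
  · rintro ⟨hx, hy, hlt⟩
    refine (pair_sublist_or hx hy fun he => ?_).resolve_right fun hs => ?_
    · exact absurd hlt (by rw [he]; exact lt_irrefl _)
    · exact absurd hlt (not_lt.2 (le_of_lt (by simpa using h.sublist hs)))

end List

/-! ### The model of a labelled graph -/

namespace Graph

variable {α β : Type*} {G : Graph α β} {A : Set (α ⊕ β)}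

/-- Adjacency of the vertices numbered `i` and `j` in the members of a family. -/
def Family.AdjIndex (F : Family) (n i j : ℕ) : Prop :=
  (i = 0 ∧ j = 1) ∨ (i = 1 ∧ j = 0) ∨ F.SimpleEdge n i j ∨ F.SimpleEdge n j i

theorem IsFamilyMember.adj_iff {F : Family} {m : ℕ} {vs : List α} (h : G.IsFamilyMember F m vs)
    {i j : ℕ} (hi : i < vs.length) (hj : j < vs.length) :
    G.Adj vs[i] vs[j] ↔ F.AdjIndex vs.length i j := by
  have h1 : G.Adj vs[i] vs[j] ↔ {e | G.IsLink e vs[i] vs[j]}.encard ≠ 0 := by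
    rw [Set.encard_ne_zero]; rfl
  have h2 := h.two_le
  rw [h1, h.encard_eq, Ne, Nat.cast_eq_zero, Family.multiplicity, Family.AdjIndex]
  split_ifs <;> grind

theorem IsFamilyMember.two_le_length {F : Family} {m : ℕ} {vs : List α}
    (h : G.IsFamilyMember F m vs) : 2 ≤ vs.length := by
  have := h.allows
  cases F <;> simp only [Family.Allows] at this <;> lia

/-- The multiplicity exceeds 1 only between the first two vertices. -/
theorem IsFamilyMember.isMultiple_iff {F : Family} {m : ℕ} {u v : α} {vs : List α}
    (h : G.IsFamilyMember F m (u :: v :: vs)) {e : β} : G.IsMultiple e ↔ G.IsLink e u v := by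
  constructor
  · rintro ⟨f, x, y, hne, he, hf⟩
    obtain ⟨i, hi, rfl⟩ := List.mem_iff_getElem.1 ((h.mem_iff x).2 he.left_mem)
    obtain ⟨j, hj, rfl⟩ := List.mem_iff_getElem.1 ((h.mem_iff y).2 he.right_mem)
    have h1 : 1 < {e | G.IsLink e (u :: v :: vs)[i] (u :: v :: vs)[j]}.encard :=
      Set.one_lt_encard_iff.2 ⟨f, e, hf, he, hne⟩
    rw [h.encard_eq, Nat.one_lt_cast, Family.multiplicity] at h1
    split_ifs at h1 with h2
    · rcases h2 with ⟨rfl, rfl⟩ | ⟨rfl, rfl⟩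
      · simpa using he
      · simpa using he.symm
    all_goals lia
  · intro he
    have h1 := h.encard_eq 0 1 (by simp) (by simp)
    have h2 : 1 < {e | G.IsLink e u v}.encard := by
      have : {e | G.IsLink e u v}.encard = _ := h1
      rw [this, Nat.one_lt_cast, Family.multiplicity, if_pos (by simp)]
      exact h.two_le
    obtain ⟨f, hf, hne⟩ := Set.exists_ne_of_one_lt_encard h2 e
    exact ⟨f, u, v, hne, he, hf⟩

theorem IsAdmissible.inl_mem (hA : G.IsAdmissible A) {u v x : α}
    (hm : ∀ e, G.IsMultiple e → G.IsLink e u v) (hx : x ∈ G.vertexSet) (hu : x ≠ u) (hv : x ≠ v) :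
    Sum.inl x ∈ A :=
  hA.simple_mem x hx fun e he h => (he.eq_or_eq_of_isLink (hm e h)).elim hu hv

namespace Labeling

variable (ℓ : G.Labeling A)

/-- The vertices in the order `1, 2, …, n`. -/
def verts : List α := ℓ.one :: ℓ.two :: ℓ.rest

/-- The vertices and multiple edges in the order `1, 2, …, n, a₁, …, b₁, …`. -/
def base : List (α ⊕ β) := ℓ.verts.map Sum.inl ++ (ℓ.as ++ ℓ.bs).map Sum.inr

theorem length_verts : ℓ.verts.length = ℓ.rest.length + 2 := rfl

theorem isLink_one_two {e : β} : G.IsLink e ℓ.one ℓ.two ↔ G.IsMultiple e := by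
  obtain ⟨F, m, h | h⟩ := ℓ.member
  · exact h.isMultiple_iff.symm
  · rw [isLink_comm]
    exact h.isMultiple_iff.symm

theorem perm_member : ∃ F m vs, G.IsFamilyMember F m vs ∧ vs.Perm ℓ.verts := by
  obtain ⟨F, m, h | h⟩ := ℓ.member
  · exact ⟨F, m, _, h, List.Perm.refl _⟩
  · exact ⟨F, m, _, h, List.Perm.swap ..⟩

theorem nodup_verts : ℓ.verts.Nodup := by
  obtain ⟨F, m, vs, h, hp⟩ := ℓ.perm_member
  exact hp.nodup_iff.1 h.nodup

theorem mem_verts {x : α} : x ∈ ℓ.verts ↔ x ∈ G.vertexSet := by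
  obtain ⟨F, m, vs, h, hp⟩ := ℓ.perm_member
  rw [← hp.mem_iff, h.mem_iff]

theorem one_ne_two : ℓ.one ≠ ℓ.two := by
  have := ℓ.nodup_verts
  simp [verts] at this
  tauto

theorem nodup_base : ℓ.base.Nodup := by
  rw [base, List.nodup_append]
  refine ⟨ℓ.nodup_verts.map Sum.inl_injective, List.Nodup.map Sum.inr_injective ?_, ?_⟩
  · rw [List.nodup_append]
    refine ⟨ℓ.as_nodup, ℓ.bs_nodup, ?_⟩
    rintro a ha b hb rfl
    exact ((ℓ.mem_bs a).1 hb).2 ((ℓ.mem_as a).1 ha).2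
  · simp

/-- The position of a letter in `base`. -/
noncomputable def rank (x : α ⊕ β) : ℕ := ℓ.base.position x

theorem pairwise_base : ℓ.base.Pairwise fun x y => ℓ.rank x < ℓ.rank y :=
  ℓ.nodup_base.pairwise_position

theorem rank_vertex {k : ℕ} (hk : k < ℓ.verts.length) : ℓ.rank (Sum.inl ℓ.verts[k]) = k := by
  have h1 : k < ℓ.base.length := by simp only [base, List.length_append, List.length_map]; lia
  have h2 : ℓ.base[k] = Sum.inl ℓ.verts[k] := by simp [base, hk]
  rw [← h2, rank, ℓ.nodup_base.position_getElem]

/-- Adjacency in terms of the numbering of the family; only the ends of the bundle may be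
exchanged. -/
theorem exists_adj_iff : ∃ (F : Family) (σ : ℕ → ℕ), F.Allows ℓ.verts.length ∧
    (∀ k, 2 ≤ k → σ k = k) ∧ (∀ k < 2, σ k < 2) ∧ σ 0 + σ 1 = 1 ∧
    ∀ (i j : ℕ) (hi : i < ℓ.verts.length) (hj : j < ℓ.verts.length),
      G.Adj ℓ.verts[i] ℓ.verts[j] ↔ F.AdjIndex ℓ.verts.length (σ i) (σ j) := by
  obtain ⟨F, m, h | h⟩ := ℓ.member
  · exact ⟨F, id, h.allows, by simp, by simp, rfl, fun i j hi hj => h.adj_iff hi hj⟩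
  · set σ : ℕ → ℕ := fun k => if k = 0 then 1 else if k = 1 then 0 else k with hσ
    refine ⟨F, σ, h.allows, by grind, by grind, by simp [hσ], fun i j hi hj => ?_⟩
    have h1 : ∀ k, k < ℓ.verts.length → σ k < (ℓ.two :: ℓ.one :: ℓ.rest).length := by
      intro k hk
      simp only [length_verts] at hk
      simp only [List.length_cons]
      grind
    have h2 : ∀ k (hk : k < ℓ.verts.length),
        ℓ.verts[k] = (ℓ.two :: ℓ.one :: ℓ.rest)[σ k]'(h1 k hk) := by
      rintro (_ | _ | k) hk
      · simp [hσ, verts]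
      · simp [hσ, verts]
      · simp [hσ, verts]
    rw [h2 i hi, h2 j hj]
    exact h.adj_iff (h1 i hi) (h1 j hj)

theorem adj_one_two : G.Adj ℓ.one ℓ.two := by
  obtain ⟨F, σ, -, -, -, h, hadj⟩ := ℓ.exists_adj_iff
  have := hadj 0 1 (by simp [verts]) (by simp [verts])
  simp only [verts, List.getElem_cons_zero, List.getElem_cons_succ] at this
  rw [this, Family.AdjIndex]
  lia

/-- This is the connectedness of the graph in a form suited to induction along the numbering. -/
theorem exists_adj_lower {j : ℕ} (hj : j < ℓ.verts.length) (hj2 : 2 ≤ j) :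
    ∃ i, ∃ h : i < j, G.Adj (ℓ.verts[i]'(h.trans hj)) ℓ.verts[j] := by
  obtain ⟨F, σ, hF, hσ, hσ2, hσ1, hadj⟩ := ℓ.exists_adj_iff
  by_cases hj' : j = 2
  · have hn : F.AdjIndex ℓ.verts.length 1 2 := by
      subst hj'
      cases F <;> simp only [Family.AdjIndex, Family.SimpleEdge, Family.Allows] at hF ⊢ <;> lia
    obtain ⟨k, hk, hk'⟩ : ∃ k < 2, σ k = 1 := by
      rcases Nat.lt_or_ge (σ 0) 1 with h | h
      · exact ⟨1, by lia, by lia⟩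
      · exact ⟨0, by lia, by have := hσ2 0 (by lia); lia⟩
    refine ⟨k, by lia, ?_⟩
    rw [hadj, hk', hσ j hj2, hj']
    exact hn
  -- The predecessor is adjacent except for the last vertex of the `S` families, which hangs on the
  -- one before it.
  · have hn : F.AdjIndex ℓ.verts.length (j - 1) j ∨ F.AdjIndex ℓ.verts.length (j - 2) j ∧ 4 ≤ j := by
      cases F <;> simp only [Family.AdjIndex, Family.SimpleEdge, Family.Allows] at hF ⊢ <;> lia
    rcases hn with hn | ⟨hn, h4⟩
    · refine ⟨j - 1, by lia, ?_⟩
      rwa [hadj, hσ j hj2, hσ (j - 1) (by lia)]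
    · refine ⟨j - 2, by lia, ?_⟩
      rwa [hadj, hσ j hj2, hσ (j - 2) (by lia)]

/-- Counted from 0, the only edge past a vertex of index at least 2 joins `n - 3` to `n - 1`. It
occurs in the `S` and `T` families, where `n` is odd. The further edge of the primed families ends
at index 2 and passes over no such vertex. -/
theorem adj_jump {i j k : ℕ} (hk : k < ℓ.verts.length) (hij : i < j) (hjk : j < k) (hj2 : 2 ≤ j)
    (h : G.Adj (ℓ.verts[i]'(by lia)) ℓ.verts[k]) :
    Odd ℓ.verts.length ∧ G.Adj (ℓ.verts[i]'(by lia)) (ℓ.verts[j]'(by lia)) ∧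
      i + 3 = ℓ.verts.length ∧ k + 1 = ℓ.verts.length := by
  obtain ⟨F, σ, hF, hσ, hσ2, hσ1, hadj⟩ := ℓ.exists_adj_iff
  rw [hadj, hσ k (by lia)] at h
  have hi : 2 ≤ i := by
    by_contra hi
    have := hσ2 i (by lia)
    cases F <;> simp only [Family.AdjIndex, Family.SimpleEdge, Family.Allows] at hF h <;> lia
  rw [hadj, hσ i hi, hσ j hj2]
  rw [hσ i hi] at h
  cases F <;> simp only [Family.AdjIndex, Family.SimpleEdge, Family.Allows] at hF h ⊢ <;>
    first
    | omega
    | exact ⟨hF.2, by omega, by omega, by omega⟩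

theorem eq_two_of_adj_end {i j : ℕ} (hi : i < 2) (hj : j < ℓ.verts.length) (hj2 : 2 ≤ j)
    (h : G.Adj (ℓ.verts[i]'(by lia)) ℓ.verts[j]) : j = 2 := by
  obtain ⟨F, σ, hF, hσ, hσ2, hσ1, hadj⟩ := ℓ.exists_adj_iff
  rw [hadj, hσ j hj2] at h
  have := hσ2 i hi
  cases F <;> simp only [Family.AdjIndex, Family.SimpleEdge, Family.Allows] at hF h <;> lia

theorem mem_rest {x : α} : x ∈ ℓ.rest ↔ ∃ k, ∃ h : k < ℓ.verts.length, 2 ≤ k ∧ ℓ.verts[k] = x := by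
  constructor
  · intro hx
    obtain ⟨k, hk, rfl⟩ := List.mem_iff_getElem.1 hx
    exact ⟨k + 2, by simpa [verts] using hk, by lia, by simp [verts]⟩
  · rintro ⟨_ | _ | k, hk, h2, rfl⟩
    · lia
    · lia
    · simp [verts]

theorem multiple_iff {e : β} : G.IsMultiple e ↔ e ∈ ℓ.as ∨ e ∈ ℓ.bs := by
  rw [ℓ.mem_as, ℓ.mem_bs]; tauto

theorem rest_mem_A (hA : G.IsAdmissible A) {x : α} (hx : x ∈ ℓ.rest) : Sum.inl x ∈ A := by
  have hn := ℓ.nodup_verts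
  simp only [verts, List.nodup_cons, List.mem_cons, not_or] at hn
  refine hA.inl_mem (fun e => ℓ.isLink_one_two.2) (ℓ.mem_verts.1 (by simp [verts, hx])) ?_ ?_
  · rintro rfl; exact hn.1.2 hx
  · rintro rfl; exact hn.2.1 hx

/-- If `one` is in `A`, the number of vertices is even. If `two` were not, exactly one vertex would
be missing from `A`, against the evenness of `A` on vertices. -/
theorem two_mem_A (hA : G.IsAdmissible A) (h1 : Sum.inl ℓ.one ∈ A) : Sum.inl ℓ.two ∈ A := by
  classical
  by_contra h2
  have heven : Even (ℓ.rest.length + 2) := by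
    rw [← Nat.not_odd_iff_even]
    exact fun h => ℓ.odd h h1
  have hn := ℓ.nodup_verts
  simp only [verts, List.nodup_cons, List.mem_cons, not_or] at hn
  have hset : {v | v ∈ G.vertexSet ∧ Sum.inl v ∈ A} = ((ℓ.one :: ℓ.rest).toFinset : Set α) := by
    ext v
    simp only [Set.mem_ofPred_eq, ← ℓ.mem_verts, verts, List.mem_cons, List.coe_toFinset]
    constructor
    · rintro ⟨rfl | rfl | h, hv⟩
      exacts [.inl rfl, absurd hv h2, .inr h]
    · rintro (rfl | h)
      exacts [⟨.inl rfl, h1⟩, ⟨.inr (.inr h), ℓ.rest_mem_A hA h⟩]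
  have hev := hA.even_vertices
  rw [hset, Set.ncard_coe_finset, List.toFinset_card_of_nodup] at hev
  · rw [List.length_cons] at hev
    rcases heven with ⟨a, ha⟩
    rcases hev with ⟨b, hb⟩
    lia
  · exact List.nodup_cons.2 ⟨hn.1.2, hn.2.2⟩

/-- Adjacency of letters. -/
def letterAdj : α ⊕ β → α ⊕ β → Prop
  | .inl x, .inl y => G.Adj x y
  | .inl x, .inr e => e ∈ ℓ.as ∧ (x = ℓ.one ∨ x = ℓ.two)
  | .inr e, .inl x => e ∈ ℓ.as ∧ (x = ℓ.one ∨ x = ℓ.two)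
  | .inr _, .inr _ => False

theorem pairwise_rank : ([Sum.inl ℓ.one, Sum.inl ℓ.two] ++ ℓ.rest.map Sum.inl ++
    ℓ.as.map Sum.inr ++ ℓ.bs.map Sum.inr).Pairwise fun x y => ℓ.rank x < ℓ.rank y := by
  have := ℓ.pairwise_base
  rw [base, verts] at this
  simpa using this

theorem mem_verts_cases {x : α} :
    x ∈ ℓ.verts ↔ Sum.inl x ∈ ({Sum.inl ℓ.one, Sum.inl ℓ.two} ∪ Sum.inl '' {x | x ∈ ℓ.rest} :
      Set (α ⊕ β)) := by
  simp [verts, or_assoc]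

/-- The combinatorial model of a labelled graph. -/
noncomputable def model (hA : G.IsAdmissible A) : EvenModel (α ⊕ β) where
  one := Sum.inl ℓ.one
  two := Sum.inl ℓ.two
  W := Sum.inl '' {x | x ∈ ℓ.rest}
  EA := Sum.inr '' {e | e ∈ ℓ.as}
  EB := Sum.inr '' {e | e ∈ ℓ.bs}
  A := A
  adj := ℓ.letterAdj
  rk := ℓ.rank
  adj_symm := by
    rintro (x | x) (y | y) h
    exacts [Adj.symm h, h, h, h]
  adj_one_two := ℓ.adj_one_two
  adj_EA_one := by
    rintro _ ⟨e, he, rfl⟩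
    exact ⟨he, .inl rfl⟩
  adj_EA_two := by
    rintro _ ⟨e, he, rfl⟩
    exact ⟨he, .inr rfl⟩
  adj_EA := by
    rintro _ (x | x) ⟨e, he, rfl⟩ h
    · exact h.2.imp (congrArg _) (congrArg _)
    · exact h.elim
  adj_EB := by
    rintro _ (x | x) ⟨e, he, rfl⟩ h
    · exact ((ℓ.mem_bs e).1 he).2 ((ℓ.mem_as e).1 h.1).2
    · exact h
  W_A := by
    rintro _ ⟨x, hx, rfl⟩
    exact ℓ.rest_mem_A hA hx
  EA_A := by
    rintro _ ⟨e, he, rfl⟩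
    exact ((ℓ.mem_as e).1 he).2
  EB_A := by
    rintro _ ⟨e, he, rfl⟩
    exact ((ℓ.mem_bs e).1 he).2
  rk_one_two := by
    have := ℓ.pairwise_rank
    simp at this
    tauto
  rk_two_W := by
    rintro _ ⟨x, hx, rfl⟩
    have := ℓ.pairwise_rank
    simp only [List.pairwise_append] at this
    exact this.1.1.2.2 _ (by simp) _ (List.mem_map_of_mem hx)
  rk_two_EA := by
    rintro _ ⟨x, hx, rfl⟩
    have := ℓ.pairwise_rank
    simp only [List.pairwise_append] at this
    exact this.1.2.2 _ (by simp) _ (List.mem_map_of_mem hx)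
  rk_two_EB := by
    rintro _ ⟨x, hx, rfl⟩
    have := ℓ.pairwise_rank
    simp only [List.pairwise_append] at this
    exact this.2.2 _ (by simp) _ (List.mem_map_of_mem hx)
  rk_W_EA := by
    rintro _ _ ⟨y, hy, rfl⟩ ⟨x, hx, rfl⟩
    have := ℓ.pairwise_rank
    simp only [List.pairwise_append] at this
    exact this.1.2.2 _ (List.mem_append_right _ (List.mem_map_of_mem hy)) _
      (List.mem_map_of_mem hx)
  rk_W_EB := by
    rintro _ _ ⟨y, hy, rfl⟩ ⟨x, hx, rfl⟩
    have := ℓ.pairwise_rank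
    simp only [List.pairwise_append] at this
    exact this.2.2 _ (List.mem_append_left _ (List.mem_append_right _ (List.mem_map_of_mem hy))) _
      (List.mem_map_of_mem hx)
  rk_EA_EB := by
    rintro _ _ ⟨y, hy, rfl⟩ ⟨x, hx, rfl⟩
    have := ℓ.pairwise_rank
    simp only [List.pairwise_append] at this
    exact this.2.2 _ (List.mem_append_right _ (List.mem_map_of_mem hy)) _
      (List.mem_map_of_mem hx)
  rk_inj := by
    intro x hx y _ h
    refine List.position_inj (l := ℓ.base) ?_ h
    simp only [Set.mem_union, Set.mem_insert_iff, Set.mem_singleton_iff, Set.mem_image,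
      Set.mem_ofPred_eq] at hx
    simp only [base, verts, List.mem_append, List.mem_map, List.mem_cons]
    grind
  finite_letters := by
    refine (((Set.toFinite _).union ?_).union ?_).union ?_
    all_goals exact (List.finite_toSet _).image _
  two_mem_A := ℓ.two_mem_A hA
  jump := by
    rintro (y | y) (y' | y') _ hadj ⟨p, hp, rfl⟩ hy hy' h1 h2
    · rw [← mem_verts_cases] at hy hy'
      obtain ⟨i, hi, rfl⟩ := List.mem_iff_getElem.1 hy
      obtain ⟨k, hk, rfl⟩ := List.mem_iff_getElem.1 hy'
      obtain ⟨j, hj, hj2, rfl⟩ := ℓ.mem_rest.1 hp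
      rw [rank_vertex, rank_vertex] at h1 h2
      obtain ⟨h3, h4, h5, h6⟩ := ℓ.adj_jump hk h1 h2 hj2 hadj
      refine ⟨ℓ.odd h3, h4, ?_⟩
      rintro _ ⟨u, hu, rfl⟩ hup huy
      obtain ⟨l, hl, hl2, rfl⟩ := ℓ.mem_rest.1 hu
      rw [rank_vertex, rank_vertex]
      have h7 : l ≠ j := by rintro rfl; exact hup rfl
      have h8 : l ≠ k := by rintro rfl; exact huy rfl
      lia
    · simp at hy'
    · simp at hy
    · simp at hy
  adj_one_of_adj_two := by
    rintro _ h1 ⟨y, hy, rfl⟩ hadj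
    obtain ⟨j, hj, hj2, rfl⟩ := ℓ.mem_rest.1 hy
    have heven : Even (ℓ.rest.length + 2) := by
      rw [← Nat.not_odd_iff_even]
      exact fun h => ℓ.odd h h1
    have := ℓ.eq_two_of_adj_end (i := 1) (by lia) hj hj2 hadj
    subst this
    refine ℓ.even heven _ ?_
    simp only [verts, List.getElem_cons_succ]
    rw [List.head?_eq_getElem?]
    exact List.getElem?_eq_getElem _

end Labeling

end Graph

/-! ### Subgraphs and their set expressions -/

namespace Graph

variable {α β : Type*} {G H I J : Graph α β} {A : Set (α ⊕ β)}

theorem inl_mem_code {v : α} : Sum.inl v ∈ G.code I ↔ v ∈ I.vertexSet := by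
  simp [code]

theorem inr_mem_code {e : β} : Sum.inr e ∈ G.code I ↔ e ∈ I.edgeSet ∧ G.IsMultiple e := by
  simp [code]

/-- Where a simple edge joins two vertices, a semi-induced subgraph containing both has some edge
between them, and this can only be the simple edge itself. -/
theorem IsSemiInduced.le_iff (hI : I.IsSemiInduced G) (hJ : J.IsSemiInduced G) :
    I ≤ J ↔ G.code I ⊆ G.code J := by
  constructor
  · rintro h (v | e) hx
    · exact inl_mem_code.2 (h.vertexSet_mono (inl_mem_code.1 hx))
    · rw [inr_mem_code] at hx ⊢
      exact ⟨h.edgeSet_mono hx.1, hx.2⟩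
  · intro h
    have hV : ∀ v ∈ I.vertexSet, v ∈ J.vertexSet := fun v hv =>
      inl_mem_code.1 (h (inl_mem_code.2 hv))
    refine ⟨hV, fun e x y he => ?_⟩
    have heG := he.mono hI.1
    by_cases hm : G.IsMultiple e
    · exact (hJ.1.isLink_iff (inr_mem_code.1 (h (inr_mem_code.2 ⟨he.edge_mem, hm⟩))).1).2 heG
    · obtain ⟨f, hf⟩ := hJ.2 x (hV x he.left_mem) y (hV y he.right_mem) ⟨e, heG⟩
      by_cases hfe : f = e
      · exact hfe ▸ hf
      · exact absurd ⟨f, x, y, hfe, heG, hf.mono hJ.1⟩ hm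

/-- The component of `I` that contains the vertex `v`. -/
def componentAt (I : Graph α β) (v : α) : Graph α β where
  vertexSet := {u | u ∈ I.vertexSet ∧ Relation.ReflTransGen I.Adj v u}
  IsLink e x y := I.IsLink e x y ∧ Relation.ReflTransGen I.Adj v x
  isLink_symm := fun _ _ => ⟨fun _ _ h => ⟨h.1.symm, h.2.tail ⟨_, h.1⟩⟩⟩
  eq_or_eq_of_isLink_of_isLink := fun _ _ _ _ _ h h' => h.1.left_eq_or_eq h'.1
  left_mem_of_isLink := fun _ _ _ h => ⟨h.1.left_mem, h.2⟩

theorem componentAt_isComponent {v : α} (hv : v ∈ I.vertexSet) :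
    (I.componentAt v).IsComponent I := by
  refine ⟨IsClosedSubgraph.mk' ⟨fun u hu => hu.1, fun e x y h => h.1⟩ ?_, ⟨v, hv, .refl⟩, ?_⟩
  · rintro e x ⟨y, h⟩ hx
    exact ⟨x, y, h, hx.2⟩
  · have key : ∀ u, Relation.ReflTransGen I.Adj v u →
        Relation.ReflTransGen (I.componentAt v).Adj v u := by
      intro u hu
      induction hu with
      | refl => exact .refl
      | tail h h' ih =>
        obtain ⟨e, he⟩ := h'
        exact ih.tail ⟨e, he, h⟩
    have hsymm : Std.Symm (I.componentAt v).Adj := ⟨fun _ _ h => h.symm⟩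
    intro x hx y hy
    exact (Relation.ReflTransGen.stdSymm.symm _ _ (key x hx.2)).trans (key y hy.2)

/-- The subgraph of `G` with set expression `S`. -/
def ofCode (G : Graph α β) (S : Set (α ⊕ β)) : Graph α β where
  vertexSet := {v | v ∈ G.vertexSet ∧ Sum.inl v ∈ S}
  IsLink e x y := G.IsLink e x y ∧ Sum.inl x ∈ S ∧ Sum.inl y ∈ S ∧ (G.IsMultiple e → Sum.inr e ∈ S)
  isLink_symm := fun _ _ => ⟨fun _ _ h => ⟨h.1.symm, h.2.2.1, h.2.1, h.2.2.2⟩⟩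
  eq_or_eq_of_isLink_of_isLink := fun _ _ _ _ _ h h' => h.1.left_eq_or_eq h'.1
  left_mem_of_isLink := fun _ _ _ h => ⟨h.1.left_mem, h.2.1⟩

theorem ofCode_le (S : Set (α ⊕ β)) : G.ofCode S ≤ G := ⟨fun _ h => h.1, fun _ _ _ h => h.1⟩

namespace Labeling

variable (ℓ : G.Labeling A) (hA : G.IsAdmissible A)

theorem inl_mem_U {v : α} : Sum.inl v ∈ (ℓ.model hA).U ↔ v ∈ G.vertexSet := by
  rw [← ℓ.mem_verts, EvenModel.mem_U]
  simp [model, verts]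

theorem inr_mem_U {e : β} : Sum.inr e ∈ (ℓ.model hA).U ↔ G.IsMultiple e := by
  rw [ℓ.multiple_iff, EvenModel.mem_U]
  simp [model]

theorem inr_mem_edges {e : β} :
    Sum.inr e ∈ (ℓ.model hA).EA ∪ (ℓ.model hA).EB ↔ G.IsMultiple e := by
  rw [ℓ.multiple_iff]
  simp [model]

theorem inl_notMem_edges {v : α} : Sum.inl v ∉ (ℓ.model hA).EA ∪ (ℓ.model hA).EB := by
  simp [model]

theorem code_subset_U (hI : I ≤ G) : G.code I ⊆ (ℓ.model hA).U := by
  rintro (v | e) hx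
  · exact (ℓ.inl_mem_U hA).2 (hI.vertexSet_mono (inl_mem_code.1 hx))
  · exact (ℓ.inr_mem_U hA).2 (inr_mem_code.1 hx).2

theorem code_finite (ℓ : G.Labeling A) (hA : G.IsAdmissible A) (hI : I ≤ G) : (G.code I).Finite :=
  (ℓ.model hA).finite_letters.subset (ℓ.code_subset_U hA hI)

theorem isLink_of_multiple (hI : I ≤ G) {e : β} (he : e ∈ I.edgeSet) (hm : G.IsMultiple e) :
    I.IsLink e ℓ.one ℓ.two :=
  (hI.isLink_iff he).2 (ℓ.isLink_one_two.2 hm)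

theorem closedIn_code (hI : I.IsSemiInduced G) (hH : H.IsClosedSubgraph I) :
    (ℓ.model hA).ClosedIn (G.code H) (G.code I) := by
  constructor
  · rintro (v | e) hx
    · exact inl_mem_code.2 (hH.le.vertexSet_mono (inl_mem_code.1 hx))
    · rw [inr_mem_code] at hx ⊢
      exact ⟨hH.le.edgeSet_mono hx.1, hx.2⟩
  · rintro (x | e) hx (y | f) hy hadj
    · rw [inl_mem_code] at *
      exact (hH.mem_iff_of_adj (hI.2 x (hH.le.vertexSet_mono hx) y hy hadj)).1 hx
    · rw [inl_mem_code] at hx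
      rw [inr_mem_code] at *
      have hl := ℓ.isLink_of_multiple hI.1 hy.1 hy.2
      refine ⟨?_, hy.2⟩
      obtain ⟨-, rfl | rfl⟩ := hadj
      · exact hH.closed hl.inc_left hx
      · exact hH.closed hl.inc_right hx
    · rw [inr_mem_code] at hx
      rw [inl_mem_code] at *
      have hl := ℓ.isLink_of_multiple (hH.le.trans hI.1) hx.1 hx.2
      obtain ⟨-, rfl | rfl⟩ := hadj
      · exact hl.left_mem
      · exact hl.right_mem
    · exact hadj.elim

/-- Components are split off one at a time. Multiple edges in `A` go with the component of the ends,
and a union without vertices consists of isolated edges outside `A`. -/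
theorem evenSet_code (hI : I.IsSemiInduced G) (he : G.IsEvenSubgraph A I) :
    (ℓ.model hA).EvenSet (G.code I) := by
  have hfin := ℓ.code_finite hA hI.1
  suffices ∀ n, ∀ T, T.ncard = n → (ℓ.model hA).ClosedIn T (G.code I) → Even (T ∩ A).ncard from
    fun T hT => this _ T rfl hT
  intro n
  induction n using Nat.strong_induction_on with
  | _ n ih =>
  intro T hn hT
  by_cases hv : ∃ v, Sum.inl v ∈ T
  · obtain ⟨v, hv⟩ := hv
    have hvI : v ∈ I.vertexSet := inl_mem_code.1 (hT.1 hv)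
    have hcomp := componentAt_isComponent hvI
    have hcl := ℓ.closedIn_code hA hI hcomp.1
    have hsub : G.code (I.componentAt v) ∩ A ⊆ T := by
      have hV : ∀ u, Relation.ReflTransGen I.Adj v u → Sum.inl u ∈ T := by
        intro u hu
        induction hu with
        | refl => exact hv
        | tail _ h ih =>
          exact hT.2 _ ih _ (inl_mem_code.2 h.right_mem) (h.mono hI.1)
      rintro (u | e) ⟨hx, hxA⟩
      · exact hV u (inl_mem_code.1 hx).2
      · have hx' := inr_mem_code.1 hx
        have hl := ℓ.isLink_of_multiple (hcomp.1.le.trans hI.1) hx'.1 hx'.2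
        exact hT.2 _ (hV _ hl.left_mem.2) _ (hcl.1 hx) ⟨(ℓ.mem_as e).2 ⟨hx'.2, hxA⟩, .inl rfl⟩
    have h1 : Even (G.code (I.componentAt v) ∩ A).ncard := he _ hcomp
    have hT' : (ℓ.model hA).ClosedIn (T \ G.code (I.componentAt v)) (G.code I) := by
      refine ⟨fun x hx => hT.1 hx.1, fun x hx y hy hadj => ⟨hT.2 x hx.1 y hy hadj, fun hyc => ?_⟩⟩
      exact hx.2 (hcl.2 y hyc x (hT.1 hx.1) ((ℓ.model hA).adj_symm hadj))
    have h2 : Even ((T \ G.code (I.componentAt v)) ∩ A).ncard := by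
      refine ih _ ?_ _ rfl hT'
      rw [← hn]
      refine Set.ncard_lt_ncard ?_ (hfin.subset hT.1)
      exact ⟨Set.sdiff_subset, fun h => (h hv).2 (inl_mem_code.2 ⟨hvI, .refl⟩)⟩
    have h3 : T ∩ A = (G.code (I.componentAt v) ∩ A) ∪ ((T \ G.code (I.componentAt v)) ∩ A) := by
      ext x
      simp only [Set.mem_inter_iff, Set.mem_union, Set.mem_sdiff]
      have := @hsub x
      simp only [Set.mem_inter_iff] at this
      tauto
    rw [h3, Set.ncard_union_eq
      (Set.disjoint_sdiff_right.mono Set.inter_subset_left Set.inter_subset_left)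
      ((hfin.subset hcl.1).subset Set.inter_subset_left)
      ((hfin.subset hT'.1).subset Set.inter_subset_left)]
    exact h1.add h2
  · have : T ∩ A = ∅ := by
      by_contra! hne
      obtain ⟨v | e, hx, hxA⟩ := hne
      · exact hv ⟨v, hx⟩
      · obtain ⟨he, hm⟩ := inr_mem_code.1 (hT.1 hx)
        have hl := ℓ.isLink_of_multiple hI.1 he hm
        exact hv ⟨ℓ.one, hT.2 _ hx _ (inl_mem_code.2 hl.left_mem)
          ⟨(ℓ.mem_as e).2 ⟨hm, hxA⟩, .inl rfl⟩⟩
    rw [this]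
    simp

/-- The set expression of an even semi-induced subgraph. -/
theorem mem_code (I : G.EvenPoset A) : (ℓ.model hA).Mem (G.code I.1) where
  subset := ℓ.code_subset_U hA I.2.1.1
  ends := by
    rintro (v | e) hx he
    · exact absurd he (ℓ.inl_notMem_edges hA)
    · rw [inr_mem_code] at hx
      have hl := ℓ.isLink_of_multiple I.2.1.1 hx.1 hx.2
      exact ⟨inl_mem_code.2 hl.left_mem, inl_mem_code.2 hl.right_mem⟩
  edge := by
    intro h1 h2
    obtain ⟨e, he⟩ := I.2.1.2 _ (inl_mem_code.1 h1) _ (inl_mem_code.1 h2) ℓ.adj_one_two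
    have hm : G.IsMultiple e := ℓ.isLink_one_two.1 (he.mono I.2.1.1)
    exact ⟨Sum.inr e, inr_mem_code.2 ⟨he.edge_mem, hm⟩, (ℓ.inr_mem_edges hA).2 hm⟩
  even := ℓ.evenSet_code hA I.2.1 I.2.2

theorem code_ofCode {S : Set (α ⊕ β)} (hS : (ℓ.model hA).Mem S) : G.code (G.ofCode S) = S := by
  ext (v | e)
  · rw [inl_mem_code]
    exact ⟨fun h => h.2, fun h => ⟨(ℓ.inl_mem_U hA).1 (hS.subset h), h⟩⟩
  · rw [inr_mem_code]
    constructor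
    · rintro ⟨⟨x, y, h⟩, hm⟩
      exact h.2.2.2 hm
    · intro h
      have hm := (ℓ.inr_mem_U hA).1 (hS.subset h)
      obtain ⟨h1, h2⟩ := hS.ends _ h ((ℓ.inr_mem_edges hA).2 hm)
      exact ⟨⟨ℓ.one, ℓ.two, ℓ.isLink_one_two.2 hm, h1, h2, fun _ => h⟩, hm⟩

theorem ofCode_isSemiInduced {S : Set (α ⊕ β)} (hS : (ℓ.model hA).Mem S) :
    (G.ofCode S).IsSemiInduced G := by
  refine ⟨ofCode_le S, ?_⟩
  rintro x hx y hy ⟨e, he⟩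
  by_cases hm : G.IsMultiple e
  · have hl := ℓ.isLink_one_two.2 hm
    have h12 : (ℓ.model hA).one ∈ S ∧ (ℓ.model hA).two ∈ S := by
      rcases he.eq_and_eq_or_eq_and_eq hl with ⟨rfl, rfl⟩ | ⟨rfl, rfl⟩
      exacts [⟨hx.2, hy.2⟩, ⟨hy.2, hx.2⟩]
    obtain ⟨v | f, hf, hf'⟩ := hS.edge h12.1 h12.2
    · exact absurd hf' (ℓ.inl_notMem_edges hA)
    · have hfl := ℓ.isLink_one_two.2 ((ℓ.inr_mem_edges hA).1 hf')
      refine ⟨f, ?_, hx.2, hy.2, fun _ => hf⟩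
      rcases he.eq_and_eq_or_eq_and_eq hl with ⟨rfl, rfl⟩ | ⟨rfl, rfl⟩
      exacts [hfl, hfl.symm]
  · exact ⟨e, he, hx.2, hy.2, fun h => absurd h hm⟩

/-- The even semi-induced subgraph with a given set expression. -/
def ofMem {S : Set (α ⊕ β)} (hS : (ℓ.model hA).Mem S) : G.EvenPoset A :=
  ⟨G.ofCode S, ℓ.ofCode_isSemiInduced hA hS, fun _ hH =>
    hS.even _ (ℓ.code_ofCode hA hS ▸ ℓ.closedIn_code hA (ℓ.ofCode_isSemiInduced hA hS) hH.1)⟩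

theorem code_ofMem {S : Set (α ⊕ β)} (hS : (ℓ.model hA).Mem S) :
    G.code (ℓ.ofMem hA hS).1 = S := ℓ.code_ofCode hA hS

theorem mem_empty : (ℓ.model hA).Mem ∅ where
  subset := Set.empty_subset _
  ends := by simp
  edge := by simp
  even := fun T hT => by simp [Set.subset_empty_iff.1 hT.1]

/-- From any vertex one descends along lower neighbours to the ends of the bundle, and from there
climbs to every other vertex. -/
theorem verts_mem_of_closedIn {T : Set (α ⊕ β)} (hT : (ℓ.model hA).ClosedIn T (ℓ.model hA).U)
    {v : α} (hv : Sum.inl v ∈ T) {u : α} (hu : u ∈ G.vertexSet) : Sum.inl u ∈ T := by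
  have hU : ∀ {k : ℕ} (hk : k < ℓ.verts.length), Sum.inl ℓ.verts[k] ∈ (ℓ.model hA).U := fun hk =>
    (ℓ.inl_mem_U hA).2 (ℓ.mem_verts.1 (List.getElem_mem hk))
  have h0 : ℓ.verts[0]'(by simp [verts]) = ℓ.one := rfl
  have h1 : ℓ.verts[1]'(by simp [verts]) = ℓ.two := rfl
  have hdown : ∀ (k : ℕ) (hk : k < ℓ.verts.length), Sum.inl ℓ.verts[k] ∈ T →
      Sum.inl ℓ.one ∈ T ∧ Sum.inl ℓ.two ∈ T := by
    intro k
    induction k using Nat.strong_induction_on with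
    | _ k ih =>
    intro hk hkT
    rcases Nat.lt_or_ge k 2 with h | h
    · have hone := (ℓ.model hA).adj_one_two
      interval_cases k
      · exact ⟨hkT, hT.2 _ hkT _ ((ℓ.inl_mem_U hA).2 ℓ.adj_one_two.right_mem) hone⟩
      · exact ⟨hT.2 _ hkT _ ((ℓ.inl_mem_U hA).2 ℓ.adj_one_two.left_mem)
          ((ℓ.model hA).adj_symm hone), hkT⟩
    · obtain ⟨i, hik, hadj⟩ := ℓ.exists_adj_lower hk h
      exact ih i hik (hik.trans hk) (hT.2 _ hkT _ (hU _) hadj.symm)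
  have hup : Sum.inl ℓ.one ∈ T → Sum.inl ℓ.two ∈ T → ∀ (k : ℕ) (hk : k < ℓ.verts.length),
      Sum.inl ℓ.verts[k] ∈ T := by
    intro hone htwo k
    induction k using Nat.strong_induction_on with
    | _ k ih =>
    intro hk
    rcases Nat.lt_or_ge k 2 with h | h
    · interval_cases k
      exacts [hone, htwo]
    · obtain ⟨i, hik, hadj⟩ := ℓ.exists_adj_lower hk h
      exact hT.2 _ (ih i hik (hik.trans hk)) _ (hU hk) hadj
  obtain ⟨k, hk, rfl⟩ := List.mem_iff_getElem.1 (ℓ.mem_verts.2 ((ℓ.inl_mem_U hA).1 (hT.1 hv)))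
  obtain ⟨j, hj, rfl⟩ := List.mem_iff_getElem.1 (ℓ.mem_verts.2 hu)
  obtain ⟨h3, h4⟩ := hdown k hk hv
  exact hup h3 h4 j hj

theorem isBundle : G.IsBundle {e | G.IsLink e ℓ.one ℓ.two} := by
  obtain ⟨e, he⟩ := ℓ.adj_one_two
  obtain ⟨f, x, y, hne, h1, h2⟩ := ℓ.isLink_one_two.1 he
  refine ⟨⟨e, he, f, ?_, hne.symm⟩, ℓ.one, ℓ.two, rfl⟩
  exact ℓ.isLink_one_two.2 ⟨e, x, y, hne.symm, h2, h1⟩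

theorem mem_U : (ℓ.model hA).Mem (ℓ.model hA).U where
  subset := le_rfl
  ends := fun _ _ _ => ⟨(ℓ.inl_mem_U hA).2 ℓ.adj_one_two.left_mem,
    (ℓ.inl_mem_U hA).2 ℓ.adj_one_two.right_mem⟩
  edge := fun _ _ => by
    obtain ⟨e, he⟩ := ℓ.adj_one_two
    have hm := ℓ.isLink_one_two.1 he
    exact ⟨Sum.inr e, (ℓ.inr_mem_U hA).2 hm, (ℓ.inr_mem_edges hA).2 hm⟩
  even := by
    intro T hT
    by_cases hv : ∃ v, Sum.inl v ∈ T
    · obtain ⟨v, hv⟩ := hv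
      have hV : ∀ u ∈ G.vertexSet, Sum.inl u ∈ T := fun u => ℓ.verts_mem_of_closedIn hA hT hv
      -- With one vertex `T` contains all vertices, hence all edges in `A`. So it meets `A` in all
      -- of `A`, and admissibility makes both parts even.
      have h1 : T ∩ A = Sum.inl '' {v | v ∈ G.vertexSet ∧ Sum.inl v ∈ A} ∪
          Sum.inr '' {e | e ∈ {e | G.IsLink e ℓ.one ℓ.two} ∧ Sum.inr e ∈ A} := by
        ext (u | e)
        · simp only [Set.mem_inter_iff, Set.mem_union, Set.mem_image, Sum.inl.injEq, reduceCtorEq,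
            and_false, exists_false, or_false, exists_eq_right, Set.mem_ofPred_eq]
          exact ⟨fun h => ⟨(ℓ.inl_mem_U hA).1 (hT.1 h.1), h.2⟩, fun h => ⟨hV u h.1, h.2⟩⟩
        · simp only [Set.mem_inter_iff, Set.mem_union, Set.mem_image, Sum.inr.injEq, reduceCtorEq,
            and_false, exists_false, false_or, exists_eq_right, Set.mem_ofPred_eq,
            ℓ.isLink_one_two]
          refine ⟨fun h => ⟨(ℓ.inr_mem_U hA).1 (hT.1 h.1), h.2⟩, fun h => ⟨?_, h.2⟩⟩
          exact hT.2 _ (hV _ ℓ.adj_one_two.left_mem) _ ((ℓ.inr_mem_U hA).2 h.1)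
            ⟨(ℓ.mem_as e).2 h, .inl rfl⟩
      have hfin : (T ∩ A).Finite := ((ℓ.model hA).finite_letters.subset hT.1).inter_of_left A
      change Even (T ∩ A).ncard
      rw [h1] at hfin ⊢
      rw [Set.ncard_union_eq ?_ (hfin.subset Set.subset_union_left)
        (hfin.subset Set.subset_union_right), Set.ncard_image_of_injective _ Sum.inl_injective,
        Set.ncard_image_of_injective _ Sum.inr_injective]
      · exact hA.even_vertices.add (hA.bundle_even _ ℓ.isBundle)
      · rw [Set.disjoint_left]
        rintro _ ⟨u, -, rfl⟩ ⟨e, -, h⟩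
        exact absurd h (by simp)
    · have : T ∩ A = ∅ := by
        by_contra! hne
        obtain ⟨v | e, hx, hxA⟩ := hne
        · exact hv ⟨v, hx⟩
        · exact hv ⟨ℓ.one, hT.2 _ hx _ ((ℓ.inl_mem_U hA).2 ℓ.adj_one_two.left_mem)
            ⟨(ℓ.mem_as e).2 ⟨(ℓ.inr_mem_U hA).1 (hT.1 hx), hxA⟩, .inl rfl⟩⟩
      change Even (T ∩ A).ncard
      rw [this]
      simp

theorem code_le_iff {I J : G.EvenPoset A} : I ≤ J ↔ G.code I.1 ⊆ G.code J.1 :=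
  IsSemiInduced.le_iff I.2.1 J.2.1

theorem code_injective : Function.Injective fun I : G.EvenPoset A => G.code I.1 := fun _ _ h =>
  le_antisymm (code_le_iff.2 h.subset) (code_le_iff.2 h.symm.subset)

theorem code_lt_iff {I J : G.EvenPoset A} : I < J ↔ G.code I.1 ⊂ G.code J.1 := by
  rw [lt_iff_le_not_ge, code_le_iff, code_le_iff]
  rfl

theorem finite_evenPoset (ℓ : G.Labeling A) (hA : G.IsAdmissible A) : Finite (G.EvenPoset A) := by
  have : Finite (Set.powerset (ℓ.model hA).U) := (ℓ.model hA).finite_letters.powerset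
  refine Finite.of_injective
    (fun I : G.EvenPoset A => (⟨G.code I.1, ℓ.code_subset_U hA I.2.1.1⟩ :
      Set.powerset (ℓ.model hA).U)) fun I J h => code_injective (congrArg Subtype.val h)

/-- The empty graph and `G` are the bounds of the poset. -/
abbrev boundedOrder : BoundedOrder (G.EvenPoset A) where
  top := ℓ.ofMem hA (ℓ.mem_U hA)
  bot := ℓ.ofMem hA (ℓ.mem_empty hA)
  le_top I := code_le_iff.2 <| by
    rw [code_ofMem]
    exact ℓ.code_subset_U hA I.2.1.1
  bot_le I := code_le_iff.2 <| by
    rw [code_ofMem]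
    exact Set.empty_subset _

theorem nontrivial_evenPoset (ℓ : G.Labeling A) (hA : G.IsAdmissible A) :
    Nontrivial (G.EvenPoset A) := by
  refine ⟨ℓ.ofMem hA (ℓ.mem_U hA), ℓ.ofMem hA (ℓ.mem_empty hA), fun h => ?_⟩
  have := congrArg (fun I : G.EvenPoset A => G.code I.1) h
  simp only [code_ofMem] at this
  have h1 : Sum.inl ℓ.one ∈ (ℓ.model hA).U := (ℓ.inl_mem_U hA).2 ℓ.adj_one_two.left_mem
  rw [this] at h1
  exact h1

theorem covBy_iff {I J : G.EvenPoset A} :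
    I ⋖ J ↔ (ℓ.model hA).Covers (G.code I.1) (G.code J.1) := by
  constructor
  · intro h
    refine ⟨ℓ.mem_code hA I, ℓ.mem_code hA J, code_lt_iff.1 h.lt, fun K hK hIK hKJ => ?_⟩
    rw [← ℓ.code_ofMem hA hK] at hIK hKJ ⊢
    rcases h.eq_or_eq (code_lt_iff.2 hIK).le (code_le_iff.2 hKJ) with h' | h'
    · exact absurd h' (code_lt_iff.2 hIK).ne'
    · rw [h']
  · rintro ⟨-, -, h1, h2⟩
    refine ⟨code_lt_iff.2 h1, fun K hIK hKJ => hKJ.ne (code_injective ?_)⟩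
    exact h2 _ (ℓ.mem_code hA K) (code_lt_iff.1 hIK) (code_le_iff.1 hKJ.le)

end Labeling

end Graph

/-! ### The listed order of the letters agrees with the keys -/

namespace EvenModel

variable {ω : Type*} {M : EvenModel ω} {I : Set ω}

theorem pairwise_key_of_block {l : List ω} {c : ℕ} (h : l.Pairwise fun x y => M.rk x < M.rk y)
    (hc : ∀ x ∈ l, M.block I x = c) : l.Pairwise fun x y => M.key I x < M.key I y :=
  h.imp_of_mem fun hx hy hlt => key_lt.2 (.inr ⟨(hc _ hx).trans (hc _ hy).symm, hlt⟩)

/-- A list that consists of four blocks is increasing if each of its blocks is. -/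
theorem pairwise_key_append {l₀ l₁ l₂ l₃ : List ω}
    (h₀ : l₀.Pairwise fun x y => M.rk x < M.rk y) (h₁ : l₁.Pairwise fun x y => M.rk x < M.rk y)
    (h₂ : l₂.Pairwise fun x y => M.rk x < M.rk y) (h₃ : l₃.Pairwise fun x y => M.rk x < M.rk y)
    (hc₀ : ∀ x ∈ l₀, M.block I x = 0) (hc₁ : ∀ x ∈ l₁, M.block I x = 1)
    (hc₂ : ∀ x ∈ l₂, M.block I x = 2) (hc₃ : ∀ x ∈ l₃, M.block I x = 3) :
    (l₀ ++ l₁ ++ l₂ ++ l₃).Pairwise fun x y => M.key I x < M.key I y := by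
  refine List.pairwise_append.2 ⟨List.pairwise_append.2 ⟨List.pairwise_append.2
    ⟨pairwise_key_of_block h₀ hc₀, pairwise_key_of_block h₁ hc₁, ?_⟩,
    pairwise_key_of_block h₂ hc₂, ?_⟩, pairwise_key_of_block h₃ hc₃, ?_⟩
  · intro x hx y hy
    have := hc₀ x hx
    have := hc₁ y hy
    exact key_lt.2 (.inl (by lia))
  · intro x hx y hy
    have := hc₂ y hy
    rcases List.mem_append.1 hx with hx | hx
    · have := hc₀ x hx
      exact key_lt.2 (.inl (by lia))
    · have := hc₁ x hx
      exact key_lt.2 (.inl (by lia))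
  · intro x hx y hy
    have := hc₃ y hy
    rcases List.mem_append.1 hx with hx | hx
    · rcases List.mem_append.1 hx with hx | hx
      · have := hc₀ x hx
        exact key_lt.2 (.inl (by lia))
      · have := hc₁ x hx
        exact key_lt.2 (.inl (by lia))
    · have := hc₂ x hx
      exact key_lt.2 (.inl (by lia))

end EvenModel

namespace Graph

variable {α β : Type*} {G I J : Graph α β} {A : Set (α ⊕ β)}

namespace Labeling

theorem upToLast_append_afterLast (I : Graph α β) (es : List β) :
    upToLast I es ++ afterLast I es = es := List.rdropWhile_append_rtakeWhile ..

theorem notMem_of_mem_afterLast {es : List β} {e : β} (h : e ∈ afterLast I es) :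
    e ∉ I.edgeSet := by
  classical
  simpa using List.mem_rtakeWhile_imp h

/-- The witness is the last entry of the initial segment, which is an edge of `I` by the choice of
the segment. -/
theorem exists_of_mem_upToLast {es : List β} {f : β → ℕ} (hes : es.Pairwise fun x y => f x < f y)
    {e : β} (h : e ∈ upToLast I es) : ∃ g ∈ es, g ∈ I.edgeSet ∧ f e ≤ f g := by
  classical
  have hne : upToLast I es ≠ [] := List.ne_nil_of_mem h
  have hlast : (upToLast I es).getLast hne ∈ I.edgeSet := by
    by_contra hn
    exact List.rdropWhile_last_not (fun e => decide (e ∉ I.edgeSet)) es hne (decide_eq_true hn)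
  have hes' : (upToLast I es).Pairwise fun x y => f x < f y :=
    hes.sublist (List.rdropWhile_prefix _ _).sublist
  refine ⟨_, (List.rdropWhile_prefix _ _).subset (List.getLast_mem hne), hlast, ?_⟩
  rw [← List.dropLast_append_getLast hne] at hes' h
  rcases List.mem_append.1 h with h | h
  · exact ((List.pairwise_append.1 hes').2.2 _ h _ (by simp)).le
  · rw [List.mem_singleton.1 h]

variable (ℓ : G.Labeling A) (hA : G.IsAdmissible A)

theorem mem_letters {x : α ⊕ β} : x ∈ ℓ.letters I ↔ x ∈ (ℓ.model hA).U := by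
  have h1 := fun e => congrArg (e ∈ ·) (upToLast_append_afterLast I ℓ.as)
  have h2 := fun e => congrArg (e ∈ ·) (upToLast_append_afterLast I ℓ.bs)
  simp only [List.mem_append, eq_iff_iff] at h1 h2
  rcases x with v | e
  · rw [inl_mem_U, ← ℓ.mem_verts, letters]
    split_ifs <;> simp [verts]
  · rw [inr_mem_U, ℓ.multiple_iff, letters]
    specialize h1 e
    specialize h2 e
    split_ifs <;> simp <;> tauto

theorem front_iff {e : β} : (ℓ.model hA).Front (G.code I) (Sum.inr e) ↔
    ∃ f ∈ I.edgeSet, (f ∈ ℓ.as ∨ f ∈ ℓ.bs) ∧ ℓ.rank (Sum.inr e) ≤ ℓ.rank (Sum.inr f) := by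
  constructor
  · rintro ⟨v | f, hf, hE, hle⟩
    · exact absurd hE (ℓ.inl_notMem_edges hA)
    · exact ⟨f, (inr_mem_code.1 hf).1, ℓ.multiple_iff.1 (inr_mem_code.1 hf).2, hle⟩
  · rintro ⟨f, hf, hE, hle⟩
    have hm := ℓ.multiple_iff.2 hE
    exact ⟨Sum.inr f, inr_mem_code.2 ⟨hf, hm⟩, (ℓ.inr_mem_edges hA).2 hm, hle⟩

/-- In each of the three cases the list falls into the blocks ends, edges at the front, other
vertices, remaining edges, each of them increasing in rank. -/
theorem pairwise_letters : (ℓ.letters I).Pairwise fun x y =>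
    (ℓ.model hA).key (G.code I) x < (ℓ.model hA).key (G.code I) y := by
  have hrk := ℓ.pairwise_rank
  have hAB : (ℓ.as.map Sum.inr ++ ℓ.bs.map Sum.inr : List (α ⊕ β)).Pairwise
      fun x y => ℓ.rank x < ℓ.rank y := by
    rw [List.append_assoc] at hrk
    exact (List.pairwise_append.1 hrk).2.1
  have hAs := (List.pairwise_append.1 hAB).1
  have hBs := (List.pairwise_append.1 hAB).2.1
  have hAs' : ℓ.as.Pairwise fun x y => ℓ.rank (Sum.inr x) < ℓ.rank (Sum.inr y) := by
    rwa [List.pairwise_map] at hAs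
  have hBs' : ℓ.bs.Pairwise fun x y => ℓ.rank (Sum.inr x) < ℓ.rank (Sum.inr y) := by
    rwa [List.pairwise_map] at hBs
  have hAB' : ∀ a ∈ ℓ.as, ∀ b ∈ ℓ.bs, ℓ.rank (Sum.inr a) < ℓ.rank (Sum.inr b) := fun a ha b hb =>
    (List.pairwise_append.1 hAB).2.2 _ (List.mem_map_of_mem ha) _ (List.mem_map_of_mem hb)
  rw [List.append_assoc, List.append_assoc, List.pairwise_append] at hrk
  have hEnd := hrk.1
  have hW := (List.pairwise_append.1 hrk.2.1).1
  have hcEnd : ∀ x ∈ ([Sum.inl ℓ.one, Sum.inl ℓ.two] : List (α ⊕ β)),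
      (ℓ.model hA).block (G.code I) x = 0 := by
    intro x hx
    have hx' : x = Sum.inl ℓ.one ∨ x = Sum.inl ℓ.two := by simpa using hx
    rcases hx' with rfl | rfl
    · exact EvenModel.block_end EvenModel.ends_one_two
    · exact EvenModel.block_end EvenModel.ends_one_two.symm
  have hcW : ∀ x ∈ ℓ.rest.map Sum.inl, (ℓ.model hA).block (G.code I) x = 2 := by
    rintro _ hx
    obtain ⟨v, hv, rfl⟩ := List.mem_map.1 hx
    exact EvenModel.block_W ⟨v, hv, rfl⟩
  have hfront : ∀ e, (e ∈ ℓ.as ∨ e ∈ ℓ.bs) → (∃ f ∈ I.edgeSet, (f ∈ ℓ.as ∨ f ∈ ℓ.bs) ∧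
      ℓ.rank (Sum.inr e) ≤ ℓ.rank (Sum.inr f)) →
      (ℓ.model hA).block (G.code I) (Sum.inr e) = 1 := fun e he hf =>
    EvenModel.block_front ((ℓ.inr_mem_edges hA).2 (ℓ.multiple_iff.2 he)) ((ℓ.front_iff hA).2 hf)
  have hback : ∀ e, (e ∈ ℓ.as ∨ e ∈ ℓ.bs) → (∀ f ∈ I.edgeSet, (f ∈ ℓ.as ∨ f ∈ ℓ.bs) →
      ℓ.rank (Sum.inr f) < ℓ.rank (Sum.inr e)) →
      (ℓ.model hA).block (G.code I) (Sum.inr e) = 3 := fun e he hf =>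
    EvenModel.block_back ((ℓ.inr_mem_edges hA).2 (ℓ.multiple_iff.2 he)) fun hF => by
      obtain ⟨f, h1, h2, h3⟩ := (ℓ.front_iff hA).1 hF
      exact absurd (hf f h1 h2) (not_lt.2 h3)
  have hup : ∀ es : List β, (upToLast I es).Sublist es := fun es =>
    (List.rdropWhile_prefix _ _).sublist
  have haf : ∀ es : List β, (afterLast I es).Sublist es := fun es =>
    (List.rtakeWhile_suffix _ _).sublist
  have hsplit : ∀ es : List β, (es.map Sum.inr).Pairwise (fun x y => ℓ.rank x < ℓ.rank y) →
      ∀ e ∈ afterLast I es, ∀ f ∈ es, f ∈ I.edgeSet →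
        ℓ.rank (Sum.inr f) < ℓ.rank (Sum.inr e) := by
    intro es hes e he f hf hfI
    rw [← upToLast_append_afterLast I es] at hes hf
    rw [List.map_append, List.pairwise_append] at hes
    rcases List.mem_append.1 hf with hf | hf
    · exact hes.2.2 _ (List.mem_map_of_mem hf) _ (List.mem_map_of_mem he)
    · exact absurd hfI (notMem_of_mem_afterLast hf)
  rw [letters]
  split_ifs with hb ha
  · obtain ⟨b, hb, hbI⟩ := hb
    rw [List.append_assoc [Sum.inl ℓ.one, Sum.inl ℓ.two]]
    refine EvenModel.pairwise_key_append hEnd ?_ hW (hBs.sublist ((haf _).map _)) hcEnd ?_ hcW ?_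
    · exact hAB.sublist ((List.Sublist.refl _).append ((hup _).map _))
    · intro x hx
      rcases List.mem_append.1 hx with hx | hx
      · obtain ⟨a, ha, rfl⟩ := List.mem_map.1 hx
        exact hfront a (.inl ha) ⟨b, hbI, .inr hb, (hAB' a ha b hb).le⟩
      · obtain ⟨e, he, rfl⟩ := List.mem_map.1 hx
        obtain ⟨g, hg, hgI, hle⟩ := exists_of_mem_upToLast hBs' he
        exact hfront e (.inr ((hup _).subset he)) ⟨g, hgI, .inr hg, hle⟩
    · intro x hx
      obtain ⟨e, he, rfl⟩ := List.mem_map.1 hx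
      refine hback e (.inr ((haf _).subset he)) ?_
      rintro f hfI (hf | hf)
      · exact hAB' f hf e ((haf _).subset he)
      · exact hsplit _ hBs e he f hf hfI
  · rw [List.append_assoc _ (List.map Sum.inr (afterLast I ℓ.as))]
    refine EvenModel.pairwise_key_append hEnd (hAs.sublist ((hup _).map _)) hW ?_ hcEnd ?_ hcW ?_
    · exact hAB.sublist (((haf _).map _).append (List.Sublist.refl _))
    · intro x hx
      obtain ⟨e, he, rfl⟩ := List.mem_map.1 hx
      obtain ⟨g, hg, hgI, hle⟩ := exists_of_mem_upToLast hAs' he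
      exact hfront e (.inl ((hup _).subset he)) ⟨g, hgI, .inl hg, hle⟩
    · intro x hx
      rcases List.mem_append.1 hx with hx | hx
      · obtain ⟨e, he, rfl⟩ := List.mem_map.1 hx
        refine hback e (.inl ((haf _).subset he)) ?_
        rintro f hfI (hf | hf)
        · exact hsplit _ hAs e he f hf hfI
        · exact absurd ⟨f, hf, hfI⟩ hb
      · obtain ⟨e, he, rfl⟩ := List.mem_map.1 hx
        refine hback e (.inr he) ?_
        rintro f hfI (hf | hf)
        · exact hAB' f hf e he
        · exact absurd ⟨f, hf, hfI⟩ hb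
  · have h0 := EvenModel.pairwise_key_append (M := ℓ.model hA) (I := G.code I) (l₁ := [])
      hEnd List.Pairwise.nil hW hAB hcEnd (by simp) hcW ?_
    · simpa using h0
    · intro x hx
      have : ∃ e, (e ∈ ℓ.as ∨ e ∈ ℓ.bs) ∧ Sum.inr e = x := by
        rcases List.mem_append.1 hx with hx | hx
        all_goals
          obtain ⟨e, he, rfl⟩ := List.mem_map.1 hx
          exact ⟨e, by tauto, rfl⟩
      obtain ⟨e, he, rfl⟩ := this
      refine hback e he ?_
      rintro f hfI (hf | hf)
      · exact absurd ⟨f, hf, hfI⟩ ha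
      · exact absurd ⟨f, hf, hfI⟩ hb

theorem letterLT_iff {x y : α ⊕ β} : ℓ.LetterLT I x y ↔
    x ∈ (ℓ.model hA).U ∧ y ∈ (ℓ.model hA).U ∧
      (ℓ.model hA).key (G.code I) x < (ℓ.model hA).key (G.code I) y := by
  rw [LetterLT, (ℓ.pairwise_letters hA).pair_sublist_iff, ℓ.mem_letters hA, ℓ.mem_letters hA]

variable {X Y : Set (α ⊕ β)}

theorem lexLT_iff (hX : X ⊆ (ℓ.model hA).U) (hY : Y ⊆ (ℓ.model hA).U) :
    ℓ.LexLT I X Y ↔ (ℓ.model hA).Lex (G.code I) X Y := by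
  constructor
  · rintro ⟨x, hx, hxY, h⟩
    refine ⟨x, hx, hxY, fun z hz => ?_⟩
    by_cases hzU : z ∈ (ℓ.model hA).U
    · exact h z ((ℓ.letterLT_iff hA).2 ⟨hzU, hX hx, hz⟩)
    · exact ⟨fun h => absurd (hX h) hzU, fun h => absurd (hY h) hzU⟩
  · rintro ⟨x, hx, hxY, h⟩
    exact ⟨x, hx, hxY, fun z hz => h z ((ℓ.letterLT_iff hA).1 hz).2.2⟩

open scoped Classical in
theorem endCount_eq (X : Set (α ⊕ β)) : ℓ.endCount X =
    (if Sum.inl ℓ.one ∈ X then 1 else 0) + (if Sum.inl ℓ.two ∈ X then 1 else 0) := by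
  have hne : (Sum.inl ℓ.one : α ⊕ β) ≠ Sum.inl ℓ.two := fun h => ℓ.one_ne_two (Sum.inl_injective h)
  rw [endCount]
  split_ifs with h1 h2 h2
  · rw [Set.inter_eq_right.2 (by rintro _ (rfl | rfl) <;> assumption), Set.ncard_pair hne]
  · rw [show X ∩ {Sum.inl ℓ.one, Sum.inl ℓ.two} = {Sum.inl ℓ.one} by ext; simp; grind]
    simp
  · rw [show X ∩ {Sum.inl ℓ.one, Sum.inl ℓ.two} = {Sum.inl ℓ.two} by ext; simp; grind]
    simp
  · rw [show X ∩ {Sum.inl ℓ.one, Sum.inl ℓ.two} = ∅ by ext; simp; grind]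
    simp

/-- The bound on the class of `Y` excludes sets without ends, which the priority rule leaves to the
lexicographic comparison. -/
theorem priority_iff : ℓ.Priority X Y ↔
    (ℓ.model hA).cls X < (ℓ.model hA).cls Y ∧ (ℓ.model hA).cls Y ≤ 2 := by
  classical
  have hB : ∀ Z : Set (α ⊕ β), (∃ b ∈ (ℓ.model hA).EB, b ∈ Z) ↔ ℓ.HasB Z := fun Z => by
    simp [model, HasB]
  have hc : ∀ Z : Set (α ⊕ β), (ℓ.model hA).cls Z =
      if Sum.inl ℓ.one ∈ Z ∧ Sum.inl ℓ.two ∈ Z then 2 else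
        if Sum.inl ℓ.one ∈ Z ∨ Sum.inl ℓ.two ∈ Z then if ℓ.HasB Z then 1 else 0 else 3 := by
    intro Z
    simp only [EvenModel.cls, hB]
    rfl
  rw [Priority, endCount_eq, endCount_eq, hc, hc]
  by_cases h1 : Sum.inl ℓ.one ∈ X <;> by_cases h2 : Sum.inl ℓ.two ∈ X <;>
    by_cases h3 : Sum.inl ℓ.one ∈ Y <;> by_cases h4 : Sum.inl ℓ.two ∈ Y <;>
    by_cases h5 : ℓ.HasB X <;> by_cases h6 : ℓ.HasB Y <;> simp [h1, h2, h3, h4, h5, h6]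

end Labeling

end Graph

/-! ### Transfer to the poset of even subgraphs -/

namespace Graph

variable {α β : Type*} {G : Graph α β} {A : Set (α ⊕ β)}

namespace Labeling

section prec

variable (ℓ : G.Labeling A) (hA : G.IsAdmissible A) {X Y : Set (α ⊕ β)} {I J J' : G.EvenPoset A}

/-- The two rules could differ only if one of the sets has no end. Then the other, if it has one,
also wins lexicographically, because the ends are the first letters. -/
theorem priority_or_lex_iff (hX : X ⊆ (ℓ.model hA).U) (hY : Y ⊆ (ℓ.model hA).U) {I : Graph α β} :
    (ℓ.Priority X Y ∨ (¬ ℓ.Priority Y X ∧ ℓ.LexLT I X Y)) ↔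
      (ℓ.model hA).Prec (G.code I) X Y := by
  rw [ℓ.priority_iff hA, ℓ.priority_iff hA, ℓ.lexLT_iff hA hX hY, EvenModel.Prec]
  have hX3 := EvenModel.cls_le (M := ℓ.model hA) X
  have hY3 := EvenModel.cls_le (M := ℓ.model hA) Y
  have hend : ∀ {Z Z' : Set (α ⊕ β)}, Z ⊆ (ℓ.model hA).U → Z' ⊆ (ℓ.model hA).U →
      (ℓ.model hA).cls Z < 3 → (ℓ.model hA).cls Z' = 3 → (ℓ.model hA).Lex (G.code I) Z Z' := by
    intro Z Z' hZU hZU' hZ hZ'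
    have h1 : (ℓ.model hA).one ∉ Z' := fun h => by
      have := EvenModel.cls_lt_three (X := Z') (.inl h); lia
    have h2 : (ℓ.model hA).two ∉ Z' := fun h => by
      have := EvenModel.cls_lt_three (X := Z') (.inr h); lia
    have h3 : ∃ w w', (ℓ.model hA).Ends w w' ∧ w ∈ Z := by
      by_contra! hn
      exact hZ.ne (EvenModel.cls_three (hn _ _ EvenModel.ends_one_two)
        (hn _ _ EvenModel.ends_one_two.symm))
    obtain ⟨w, w', hw, hwZ⟩ := h3
    have hwZ' : w ∉ Z' := by rcases hw with ⟨rfl, -⟩ | ⟨rfl, -⟩ <;> assumption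
    refine EvenModel.lex_of hZU hZU' hwZ hwZ' fun x hx _ => EvenModel.key_end hw ?_
    rcases EvenModel.mem_U.1 (hZU' hx) with rfl | rfl | h
    exacts [absurd hx h1, absurd hx h2, h]
  constructor
  · rintro (h | ⟨h, hl⟩)
    · exact .inl h.1
    · rcases lt_trichotomy ((ℓ.model hA).cls X) ((ℓ.model hA).cls Y) with h' | h' | h'
      · exact .inl h'
      · exact .inr ⟨h', hl⟩
      · have h3 : (ℓ.model hA).cls X = 3 := by
          by_contra hn
          exact h ⟨h', by lia⟩
        exact absurd (hl.trans hX hY (hend hY hX (h3 ▸ h') h3)) EvenModel.Lex.irrefl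
  · rintro (h | ⟨h, hl⟩)
    · by_cases h3 : (ℓ.model hA).cls Y = 3
      · exact .inr ⟨fun h' => absurd h'.1 h.not_gt, hend hX hY (h3 ▸ h) h3⟩
      · exact .inl ⟨h, by lia⟩
    · exact .inr ⟨fun h' => absurd h'.1 h.le.not_gt, hl⟩

theorem atom_sdiff (h : I ⋖ J) :
    (ℓ.model hA).Atom (G.code I.1) (G.code J.1 \ G.code I.1) := by
  obtain ⟨X, hX, he⟩ := ((ℓ.covBy_iff hA).1 h).exists_atom
  have hd := (ℓ.mem_code hA I).atom_disjoint hX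
  rw [he, Set.union_sdiff_cancel_left fun x hx => hd x hx.2 hx.1]
  exact hX

theorem union_sdiff (h : I ⋖ J) : G.code I.1 ∪ (G.code J.1 \ G.code I.1) = G.code J.1 :=
  Set.union_sdiff_cancel (code_le_iff.1 h.le)

theorem exists_covBy_of_atom (hX : (ℓ.model hA).Atom (G.code I.1) X) :
    ∃ J, I ⋖ J ∧ G.code J.1 \ G.code I.1 = X := by
  have hI := ℓ.mem_code hA I
  refine ⟨ℓ.ofMem hA (hI.union_atom hX), ?_, ?_⟩
  · rw [ℓ.covBy_iff hA, code_ofMem]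
    exact hI.covers_union hX
  · rw [code_ofMem]
    exact Set.union_sdiff_cancel_left fun x hx => hI.atom_disjoint hX x hx.2 hx.1

theorem atomLT_iff (hJ : I ⋖ J) (hJ' : I ⋖ J') : ℓ.AtomLT I J J' ↔
    (ℓ.model hA).Prec (G.code I.1) (G.code J.1 \ G.code I.1) (G.code J'.1 \ G.code I.1) :=
  ℓ.priority_or_lex_iff hA (ℓ.atom_sdiff hA hJ).subset_U (ℓ.atom_sdiff hA hJ').subset_U

theorem aboveEarlierAtom_iff (hJ : I ⋖ J) (hJ' : J ⋖ J') :
    PosetShelling.AboveEarlierAtom I (ℓ.AtomLT I) J J' ↔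
      (ℓ.model hA).Earlier (G.code I.1) (G.code J.1 \ G.code I.1) (G.code J'.1 \ G.code J.1) := by
  constructor
  · rintro ⟨K, hK, hKJ, hle⟩
    refine ⟨_, ℓ.atom_sdiff hA hK, (ℓ.atomLT_iff hA hK hJ).1 hKJ, fun x hx => ?_⟩
    by_cases h : x ∈ G.code J.1
    · exact .inl ⟨h, hx.2⟩
    · exact .inr ⟨code_le_iff.1 hle hx.1, h⟩
  · rintro ⟨Y, hY, hp, hsub⟩
    obtain ⟨K, hK, rfl⟩ := ℓ.exists_covBy_of_atom hA hY
    refine ⟨K, hK, (ℓ.atomLT_iff hA hK hJ).2 hp, code_le_iff.2 ?_⟩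
    rw [← union_sdiff hK]
    refine Set.union_subset (code_le_iff.1 (hJ.le.trans hJ'.le)) fun x hx => ?_
    rcases hsub hx with h | h
    exacts [code_le_iff.1 hJ'.le h.1, h.1]

theorem ordersAtoms (hA : G.IsAdmissible A) (I : G.EvenPoset A) :
    PosetShelling.OrdersAtoms I (ℓ.AtomLT I) := by
  refine { trichotomous := ?_, irrefl := ?_, trans := ?_ }
  · rintro ⟨J, hJ⟩ ⟨J', hJ'⟩ h1 h2
    rw [ℓ.atomLT_iff hA hJ hJ'] at h1
    rw [ℓ.atomLT_iff hA hJ' hJ] at h2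
    by_contra hne
    refine ((ℓ.atom_sdiff hA hJ).prec_total (ℓ.atom_sdiff hA hJ') fun he => hne ?_).elim h1 h2
    refine Subtype.ext (code_injective ?_)
    change G.code J.1 = G.code J'.1
    rw [← union_sdiff hJ, he, union_sdiff hJ']
  · rintro ⟨J, hJ⟩ h
    exact EvenModel.Prec.irrefl ((ℓ.atomLT_iff hA hJ hJ).1 h)
  · rintro ⟨J, hJ⟩ ⟨J', hJ'⟩ ⟨K, hK⟩ h1 h2
    exact (ℓ.atomLT_iff hA hJ hK).2 (((ℓ.atomLT_iff hA hJ hJ').1 h1).trans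
      (ℓ.atom_sdiff hA hJ).subset_U (ℓ.atom_sdiff hA hJ').subset_U ((ℓ.atomLT_iff hA hJ' hK).1 h2))

/-- The orderings of the atoms form a recursive atom ordering. -/
theorem formsRecursiveAtomOrdering (hA : G.IsAdmissible A) :
    PosetShelling.FormsRecursiveAtomOrdering ℓ.AtomLT where
  ordersAtoms := ℓ.ordersAtoms hA
  earlierComeFirst := by
    intro I J hJ Z Z' hZ hZ' h h'
    rw [ℓ.aboveEarlierAtom_iff hA hJ hZ] at h
    rw [ℓ.aboveEarlierAtom_iff hA hJ hZ'] at h'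
    rw [ℓ.atomLT_iff hA hZ hZ']
    have hU := union_sdiff hJ
    refine ((ℓ.atom_sdiff hA hZ).prec_total (ℓ.atom_sdiff hA hZ') fun he => h' (he ▸ h)).resolve_right
      fun hp => h' ?_
    have hz := ℓ.atom_sdiff hA hZ
    have hz' := ℓ.atom_sdiff hA hZ'
    refine EvenModel.earlier_of_prec (ℓ.mem_code hA I) (ℓ.atom_sdiff hA hJ) ?_ ?_ h ?_
    · rwa [hU]
    · rwa [hU]
    · rwa [hU]
  exchange := by
    intro I K J Y hK hJ hKJ hKY hJY
    have hU := union_sdiff hJ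
    obtain ⟨Z, hZ, hZY, he⟩ := EvenModel.exchange (ℓ.mem_code hA I) (ℓ.atom_sdiff hA hK)
      (ℓ.atom_sdiff hA hJ) ((ℓ.atomLT_iff hA hK hJ).1 hKJ) (ℓ.mem_code hA Y)
      (by rw [hU]; exact code_le_iff.1 hJY.le)
      (Set.sdiff_subset.trans (code_le_iff.1 hKY.le))
    rw [hU] at hZ
    obtain ⟨J', hJ', rfl⟩ := ℓ.exists_covBy_of_atom hA hZ
    obtain ⟨C, hC, hCJ, hle⟩ := (ℓ.aboveEarlierAtom_iff hA hJ hJ').2 he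
    refine ⟨C, J', hC, hCJ, hJ', hle.lt_of_ne ?_, code_le_iff.2 ?_⟩
    · rintro rfl
      exact hC.2 hJ.lt hJ'.lt
    · rw [← union_sdiff hJ']
      exact Set.union_subset (code_le_iff.1 hJY.le) hZY

end prec

end Labeling

/-! ### Existence of a labeling -/

theorem IsFamilyMember.adj_path {F : Family} {m : ℕ} {u v w : α} {vs : List α}
    (h : G.IsFamilyMember F m (u :: v :: w :: vs)) : G.Adj v w := by
  have := (h.adj_iff (i := 1) (j := 2) (by simp) (by simp)).2 (by
    have := h.allows
    cases F <;> simp only [Family.AdjIndex, Family.SimpleEdge, Family.Allows] at this ⊢ <;> lia)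
  simpa using this

/-- If both ends were in `A`, all vertices would be, an odd number. -/
theorem IsFamilyMember.exists_end_notMem {F : Family} {m : ℕ} {u v : α} {vs : List α}
    (h : G.IsFamilyMember F m (u :: v :: vs)) (hA : G.IsAdmissible A)
    (hodd : Odd (vs.length + 2)) : Sum.inl u ∉ A ∨ Sum.inl v ∉ A := by
  classical
  by_contra! huv
  have hset : {x | x ∈ G.vertexSet ∧ Sum.inl x ∈ A} = ((u :: v :: vs).toFinset : Set α) := by
    ext x
    rw [List.coe_toFinset]
    change x ∈ G.vertexSet ∧ Sum.inl x ∈ A ↔ x ∈ u :: v :: vs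
    rw [h.mem_iff]
    refine ⟨fun hx => hx.1, fun hx => ⟨hx, ?_⟩⟩
    by_cases hu : x = u
    · exact hu ▸ huv.1
    · by_cases hv : x = v
      · exact hv ▸ huv.2
      · exact hA.inl_mem (fun e => h.isMultiple_iff.1) hx hu hv
  have hev := hA.even_vertices
  rw [hset, Set.ncard_coe_finset, List.toFinset_card_of_nodup h.nodup] at hev
  exact (Nat.not_even_iff_odd.2 hodd) hev

theorem IsListed.nonempty_labeling (hG : G.IsListed) (hA : G.IsAdmissible A) :
    Nonempty (G.Labeling A) := by
  classical
  obtain ⟨F, m, vs, h⟩ := hG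
  obtain ⟨u, v, rest, rfl⟩ : ∃ u v rest, vs = u :: v :: rest := by
    have := h.two_le_length
    match vs, this with
    | u :: v :: rest, _ => exact ⟨u, v, rest, rfl⟩
  have hfin : {e | G.IsMultiple e}.Finite := by
    have h1 : {e | G.IsMultiple e} = {e | G.IsLink e u v} := by
      ext e; exact h.isMultiple_iff
    have h2 : {e | G.IsLink e u v}.encard = _ := h.encard_eq 0 1 (by simp) (by simp)
    rw [h1, ← Set.encard_ne_top_iff, h2]
    exact ENat.natCast_ne_top _
  have hfa : {e | G.IsMultiple e ∧ Sum.inr e ∈ A}.Finite := hfin.subset fun e he => he.1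
  have hfb : {e | G.IsMultiple e ∧ Sum.inr e ∉ A}.Finite := hfin.subset fun e he => he.1
  suffices ∃ one two, (∃ F m, G.IsFamilyMember F m (one :: two :: rest) ∨
      G.IsFamilyMember F m (two :: one :: rest)) ∧
      (Odd (rest.length + 2) → Sum.inl one ∉ A) ∧
      (Even (rest.length + 2) → ∀ three ∈ rest.head?, G.Adj one three) by
    obtain ⟨one, two, h1, h2, h3⟩ := this
    exact ⟨{
      one := one, two := two, rest := rest
      as := hfa.toFinset.toList, bs := hfb.toFinset.toList
      member := h1, odd := h2, even := h3
      as_nodup := Finset.nodup_toList _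
      mem_as := by simp
      bs_nodup := Finset.nodup_toList _
      mem_bs := by simp }⟩
  rcases Nat.even_or_odd (rest.length + 2) with he | ho
  -- For even `n` the end that starts the path is named 1, since it is adjacent to the next vertex
  -- in every family.
  · refine ⟨v, u, ⟨F, m, .inr h⟩, fun ho => absurd he (Nat.not_even_iff_odd.2 ho), fun _ w hw => ?_⟩
    cases rest with
    | nil => simp at hw
    | cons x rest =>
      simp only [List.head?_cons, Option.mem_def, Option.some.injEq] at hw
      exact hw ▸ h.adj_path
  · rcases h.exists_end_notMem hA ho with hu | hv
    · exact ⟨u, v, ⟨F, m, .inl h⟩, fun _ => hu, fun he => absurd he (Nat.not_even_iff_odd.2 ho)⟩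
    · exact ⟨v, u, ⟨F, m, .inr h⟩, fun _ => hv, fun he => absurd he (Nat.not_even_iff_odd.2 ho)⟩

end Graph

theorem theorem5p4 {α β : Type*} (G : Graph α β) (hG : G.IsListed)
    (A : Set (α ⊕ β)) (hA : G.IsAdmissible A) :
    ∃ _ : BoundedOrder (G.EvenPoset A),
      (Nonempty (G.Labeling A) ∧
        ∀ ℓ : G.Labeling A, PosetShelling.FormsRecursiveAtomOrdering ℓ.AtomLT) ∧
      PosetShelling.AdmitsRecursiveAtomOrdering (G.EvenPoset A) ∧
      PosetShelling.CLShellable (G.EvenPoset A) := by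
  obtain ⟨ℓ⟩ := hG.nonempty_labeling hA
  have := ℓ.finite_evenPoset hA
  have := ℓ.nontrivial_evenPoset hA
  let _ := ℓ.boundedOrder hA
  have h := ℓ.formsRecursiveAtomOrdering hA
  exact ⟨ℓ.boundedOrder hA, ⟨⟨ℓ⟩, fun ℓ' => ℓ'.formsRecursiveAtomOrdering hA⟩, h.admits,
    h.clShellable⟩
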